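/- Let $n\ge 2$, let $V:(0,+\infty)\to\mathbb R$ be smooth, and let $\mu$ be a spherically symmetric probability measure on $\mathbb R^n$ with Lebesgue density proportional to $e^{-V(\|x\|)}$ and with finite second moment $\int_{\mathbb R^n}\|x\|^2\,\mu(dx)<\infty$ ($V$ is not assumed to be convex). Let $\nu$ be its radial part, that is, the probability measure on $(0,+\infty)$ with Lebesgue density proportional to $r^{n-1}e^{-V(r)}$. Let $$\mathcal L_\mu f(x)=\Delta f(x)-\frac{V'(\|x\|)}{\|x\|}\,x\cdot\nabla f(x)\quad(x\in\mathbb R^n),\qquad \mathcal L_\nu f(r)=f''(r)-\Big(V'(r)-\frac{n-1}{r}\Big)f'(r)\quad(r>0),$$ the latter with Neumann's condition at the boundary $r=0$. Their spectral gaps are given by the variational formula $$\lambda_1(-\mathcal L_\mu)=\inf\Big\{\int_{\mathbb R^n}\|\nabla f\|^2\,d\mu \;:\; f\in W^{1,2}(\mu),\ \int f\,d\mu=0,\ \int f^2\,d\mu=1\Big\},$$ $$\lambda_1(-\mathcal L_\nu)=\inf\Big\{\int_0^{+\infty}(f')^2\,d\nu \;:\; f\in W^{1,2}(\nu),\ \int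 f\,d\nu=0,\ \int f^2\,d\nu=1\Big\},$$ where $W^{1,2}(\mu)$ (respectively $W^{1,2}(\nu)$) is the space of all $f\in L^2(\mu)$ having a weak gradient on $\mathbb R^n$ that belongs to $L^2(\mu)$ (respectively all $f\in L^2(\nu)$ having a weak derivative on $(0,+\infty)$ that belongs to $L^2(\nu)$); equivalently, they are the optimal constants in the Poincaré inequalities for $\mu$ and $\nu$. Then $$\min\left\{\lambda_1(-\mathcal L_\nu),\ \frac{n-1}{\int_{\mathbb R^n}\|x\|^2\,\mu(dx)}\right\}\ \le\ \lambda_1(-\mathcal L_\mu)\ \le\ \min\left\{\lambda_1(-\mathcal L_\nu),\ \frac{n}{\int_{\mathbb R^n}\|x\|^2\,\mu(dx)}\right\}.$$ -/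

import Mathlib

open MeasureTheory Set
open scoped ContDiff

/-- `G` is the weak gradient of `f` on the open set `Ω`: both are locally Lebesgue integrable on
`Ω`, and the integration by parts formula holds in every direction `v` against every smooth
function with compact support in `Ω`. -/
def HasWeakGradientOn {E : Type*} [NormedAddCommGroup E] [InnerProductSpace ℝ E] [MeasureSpace E]
    (Ω : Set E) (f : E → ℝ) (G : E → E) : Prop :=
  LocallyIntegrableOn f Ω volume ∧ LocallyIntegrableOn G Ω volume ∧
    ∀ φ : E → ℝ, ContDiff ℝ ∞ φ → HasCompactSupport φ → tsupport φ ⊆ Ω →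
      ∀ v : E, ∫ x, f x * fderiv ℝ φ x v = -∫ x, φ x * inner ℝ (G x) v

/-- `f` belongs to the weighted Sobolev space `W^{1,2}(μ)` on the open set `Ω`, with weak
gradient `G`. No condition is imposed at the boundary of `Ω` (Neumann conditions). -/
structure IsSobolevWithGradient {E : Type*} [NormedAddCommGroup E] [InnerProductSpace ℝ E]
    [MeasureSpace E] (Ω : Set E) (μ : Measure E) (f : E → ℝ) (G : E → E) : Prop where
  memLp : MemLp f 2 μ
  hasWeakGradientOn : HasWeakGradientOn Ω f G
  memLp_gradient : MemLp G 2 μ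

/-- The spectral gap `λ₁(-L_μ)` of the (Neumann) diffusion operator
`L_μ = Δ - ∇U · ∇` on the open set `Ω`, for a probability measure `μ` with density proportional to
`e^{-U}` on `Ω`: the infimum of the Dirichlet energy
`∫ f (-L_μ f) dμ = ∫ ‖∇f‖² dμ` over all `f ∈ W^{1,2}(μ)` (the domain of the Dirichlet form) that
are orthogonal to the constants and normalized in `L²(μ)`. -/
noncomputable def spectralGap {E : Type*} [NormedAddCommGroup E] [InnerProductSpace ℝ E]
    [MeasureSpace E] (Ω : Set E) (μ : Measure E) : ℝ :=
  sInf {e : ℝ | ∃ (f : E → ℝ) (G : E → E), IsSobolevWithGradient Ω μ f G ∧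
    ∫ x, f x ∂μ = 0 ∧ ∫ x, f x ^ 2 ∂μ = 1 ∧ e = ∫ x, ‖G x‖ ^ 2 ∂μ}

/-- The measure `μ` has a density with respect to `m` that is proportional to `ρ`. -/
def HasDensityProportionalTo {E : Type*} [MeasurableSpace E] (μ m : Measure E) (ρ : E → ℝ) :
    Prop :=
  ∃ c : ℝ, 0 < c ∧ μ = m.withDensity (fun x => ENNReal.ofReal (c * ρ x))

/-! Under `μ` a point is `r • θ` with `θ` uniform on the unit sphere and `r` independent of law `ν`
(`map_smul_uniformOnSphere_prod`). Everything rests on this product structure.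

Lower bound. Let `f` be centred and of unit norm, and let `F(θ) = ∫ f(rθ) dν(r)`. The variance of
`f` is the mean over `θ` of its variance along the ray through `θ`, plus the variance of `F` on the
sphere. The gap of `ν` times the first term is at most the radial energy, because `f` restricted to
almost every ray lies in `W^{1,2}(ν)` (`IsSobolevWithGradient.ae_isSobolevWithGradient_ray`). For
the second term, the sphere satisfies a Poincaré inequality with constant `n - 1`, and the spherical
gradient of `F` is the `ν`-average of `r` times the tangential gradient of `f`; Cauchy–Schwarz turns
this into the factor `∫ r² dν` (`radial_average_poincare`). Radial and tangential energies add up to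
`∫ ‖∇f‖² dμ` (`min_spectralGap_le_integral_norm_sq`).

The sphere inequality (`sphere_poincare`) is the Gaussian one applied to `H(x) = ‖x‖ (Φ(x) - m)`,
with `Φ` homogeneous of degree zero and `m` its mean: it reads `n Var Φ ≤ Var Φ + ∫ ‖∇Φ‖²`. The
Gaussian inequality tensorizes by Efron–Stein from dimension one, where Cauchy–Schwarz and Tonelli
suffice.

Upper bound. Test functions `f(‖x‖)` give the gap of `ν`; the coordinates, summed over the index,
give `n / ∫ ‖x‖² dμ`.

Since `V` may be singular at `0`, `μ` is known to be comparable with Lebesgue measure only on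
compact sets avoiding the origin. Sobolev functions are therefore mollified on spherical shells, and
the inequalities are arranged so that sharp radial cutoffs are never differentiated. -/

/-! ### Mollification and local smooth approximation -/

open Filter Topology Convolution ENNReal in
/-- Continuity of translations in `L²`. -/
theorem tendsto_eLpNorm_translate_sub {E F : Type*} [NormedAddCommGroup E] [MeasurableSpace E]
    [BorelSpace E] [NormedSpace ℝ E] [FiniteDimensional ℝ E] [NormedAddCommGroup F]
    {μ : Measure E} [μ.IsAddHaarMeasure] {h : E → F} (hh : MemLp h 2 μ) :
    Tendsto (fun y => eLpNorm (fun x => h (x - y) - h x) 2 μ) (𝓝 0) (𝓝 0) := by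
  have hmp : ∀ y : E, MeasurePreserving (fun x => x - y) μ μ :=
    fun y => measurePreserving_sub_right μ y
  let g : E → C(E, E) := fun y => ⟨fun x => x - y, by fun_prop⟩
  have hg : Continuous g := by
    refine ContinuousMap.continuous_of_continuous_uncurry _ ?_
    change Continuous fun p : E × E => p.2 - p.1
    fun_prop
  have hc := (continuous_const (y := hh.toLp h)).compMeasurePreservingLp hg
    (fun y => hmp y) (by simp)
  have := tendsto_iff_edist_tendsto_0.1 (hc.tendsto 0)
  refine this.congr fun y => ?_
  rw [Lp.edist_def]
  refine eLpNorm_congr_ae ?_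
  have h1 := (Lp.coeFn_compMeasurePreserving (hh.toLp h) (hmp y)).trans
    ((hmp y).quasiMeasurePreserving.ae_eq_comp hh.coeFn_toLp)
  have h2 := (Lp.coeFn_compMeasurePreserving (hh.toLp h) (hmp 0)).trans
    ((hmp 0).quasiMeasurePreserving.ae_eq_comp hh.coeFn_toLp)
  filter_upwards [h1, h2] with x hx1 hx2
  simp only [Pi.sub_apply]
  erw [hx1, hx2]
  simp

open Filter Topology Convolution ENNReal in
/-- Convolution with a bump function of small support is close to the identity in `L²`. -/
theorem exists_eLpNorm_normed_convolution_sub_le {E F : Type*} [NormedAddCommGroup E]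
    [MeasurableSpace E] [BorelSpace E] [NormedSpace ℝ E] [FiniteDimensional ℝ E]
    [NormedAddCommGroup F] [NormedSpace ℝ F] [CompleteSpace F]
    {μ : Measure E} [μ.IsAddHaarMeasure] {h : E → F} (hh : MemLp h 2 μ) {ε : ℝ≥0∞}
    (hε : 0 < ε) :
    ∃ δ > 0, ∀ φ : ContDiffBump (0 : E), φ.rOut ≤ δ →
      eLpNorm (fun x => (φ.normed μ ⋆[ContinuousLinearMap.lsmul ℝ ℝ, μ] h) x - h x) 2 μ ≤ ε := by
  -- A strongly measurable representative makes `h (x - y) - h x` jointly measurable, as Tonelli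
  -- will require.
  wlog hm : StronglyMeasurable h generalizing h
  · obtain ⟨δ, hδ, H⟩ := this (h := hh.1.mk h) (hh.ae_eq hh.1.ae_eq_mk) hh.1.stronglyMeasurable_mk
    refine ⟨δ, hδ, fun φ hφ => (le_of_eq ?_).trans (H φ hφ)⟩
    refine eLpNorm_congr_ae ?_
    filter_upwards [hh.1.ae_eq_mk] with x hx
    rw [hx, convolution_congr _ EventuallyEq.rfl hh.1.ae_eq_mk]
  obtain ⟨δ, hδ, H⟩ := Metric.eventually_nhds_iff.1
    ((tendsto_eLpNorm_translate_sub hh).eventually (ge_mem_nhds hε))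
  refine ⟨δ / 2, by positivity, fun φ hφ => ?_⟩
  have hloc : LocallyIntegrable h μ := hh.locallyIntegrable (by norm_num)
  set ρ := φ.normed μ with hρ
  have hρ0 : ∀ y, 0 ≤ ρ y := fun y => φ.nonneg_normed y
  have hρc : Continuous ρ := φ.continuous_normed
  have hρi : Integrable ρ μ := φ.integrable_normed
  let m : Measure E := μ.withDensity fun y => ENNReal.ofReal (ρ y)
  have hρm : Measurable fun y => ENNReal.ofReal (ρ y) := hρc.measurable.ennreal_ofReal
  have hm1 : IsProbabilityMeasure m := by
    constructor
    rw [withDensity_apply _ MeasurableSet.univ, Measure.restrict_univ,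
      ← ofReal_integral_eq_lintegral_ofReal hρi (ae_of_all _ hρ0), φ.integral_normed]
    simp
  -- Jensen: `ρ` is a probability density, so the left side is the squared norm of an average of `h
  -- (x - y) - h x`, and the `L¹(m)` norm is at most the `L²(m)` norm.
  have key : ∀ x, ‖(ρ ⋆[ContinuousLinearMap.lsmul ℝ ℝ, μ] h) x - h x‖ₑ ^ 2 ≤
      ∫⁻ y, ‖h (x - y) - h x‖ₑ ^ 2 ∂m := by
    intro x
    have hex : Integrable (fun y => ρ y • h (x - y)) μ :=
      (φ.hasCompactSupport_normed.convolutionExists_left (ContinuousLinearMap.lsmul ℝ ℝ)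
        hρc hloc x)
    have e1 : (ρ ⋆[ContinuousLinearMap.lsmul ℝ ℝ, μ] h) x - h x =
        ∫ y, ρ y • (h (x - y) - h x) ∂μ := by
      simp_rw [smul_sub]
      rw [integral_sub hex (hρi.smul_const _), integral_smul_const, φ.integral_normed, one_smul]
      rfl
    have e2 : ‖(ρ ⋆[ContinuousLinearMap.lsmul ℝ ℝ, μ] h) x - h x‖ₑ ≤
        eLpNorm (fun y => h (x - y) - h x) 1 m := by
      rw [e1, eLpNorm_one_eq_lintegral_enorm, lintegral_withDensity_eq_lintegral_mul₀ hρm.aemeasurable]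
      · refine (enorm_integral_le_lintegral_enorm _).trans (le_of_eq (lintegral_congr fun y => ?_))
        simp [enorm_smul, Real.enorm_of_nonneg (hρ0 y)]
      · have : StronglyMeasurable fun y => h (x - y) - h x :=
          (hm.comp_measurable (by fun_prop)).sub stronglyMeasurable_const
        exact this.enorm.aemeasurable
    have e3 : eLpNorm (fun y => h (x - y) - h x) 1 m ≤ eLpNorm (fun y => h (x - y) - h x) 2 m := by
      refine eLpNorm_le_eLpNorm_of_exponent_le (by norm_num) ?_
      exact ((hm.comp_measurable (by fun_prop)).sub stronglyMeasurable_const).aestronglyMeasurable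
    calc _ ≤ eLpNorm (fun y => h (x - y) - h x) 2 m ^ 2 := by gcongr; exact e2.trans e3
      _ = _ := by
        rw [eLpNorm_eq_lintegral_rpow_enorm_toReal (by norm_num) (by norm_num)]
        simp only [toReal_ofNat, rpow_two]
        rw [← ENNReal.rpow_two, ← ENNReal.rpow_mul]
        norm_num
  have hsm : StronglyMeasurable fun p : E × E => h (p.1 - p.2) - h p.1 :=
    (hm.comp_measurable (by fun_prop)).sub (hm.comp_measurable measurable_fst)
  have hsq : ∀ g : E → F, eLpNorm g 2 μ = (∫⁻ x, ‖g x‖ₑ ^ 2 ∂μ) ^ (1 / 2 : ℝ) := by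
    intro g
    rw [eLpNorm_eq_lintegral_rpow_enorm_toReal (by norm_num) (by norm_num)]
    simp
  have hbound : ∫⁻ x, ‖(ρ ⋆[ContinuousLinearMap.lsmul ℝ ℝ, μ] h) x - h x‖ₑ ^ 2 ∂μ ≤ ε ^ 2 := by
    calc _ ≤ ∫⁻ x, ∫⁻ y, ‖h (x - y) - h x‖ₑ ^ 2 ∂m ∂μ := lintegral_mono key
      _ = ∫⁻ y, ∫⁻ x, ‖h (x - y) - h x‖ₑ ^ 2 ∂μ ∂m := by
        refine lintegral_lintegral_swap ?_
        exact (hsm.enorm.pow_const 2).aemeasurable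
      _ ≤ ∫⁻ y, ε ^ 2 ∂m := by
        refine lintegral_mono_ae ?_
        have : ∀ᵐ y ∂m, y ∈ Function.support ρ := by
          rw [ae_withDensity_iff hρm]
          refine ae_of_all _ fun y hy => ?_
          contrapose! hy
          simp [Function.notMem_support.1 hy]
        filter_upwards [this] with y hy
        rw [hρ, φ.support_normed_eq, Metric.mem_ball] at hy
        have := H (y := y) (by linarith)
        rw [hsq] at this
        calc _ = ((∫⁻ x, ‖h (x - y) - h x‖ₑ ^ 2 ∂μ) ^ (1 / 2 : ℝ)) ^ 2 := by
              rw [← ENNReal.rpow_two, ← ENNReal.rpow_mul]; norm_num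
          _ ≤ ε ^ 2 := by gcongr
      _ = ε ^ 2 := by simp
  rw [hsq]
  calc _ ≤ (ε ^ 2) ^ (1 / 2 : ℝ) := by gcongr
    _ = ε := by rw [← ENNReal.rpow_two, ← ENNReal.rpow_mul]; norm_num

open Filter Topology Convolution ENNReal in
/-- A mollified function with weak gradient is smooth, and its gradient is the mollified weak
gradient, at the points whose distance to the complement of the domain exceeds the radius of the
mollifier. -/
theorem fderiv_convolution_normed_of_hasWeakGradientOn {E : Type*} [NormedAddCommGroup E]
    [InnerProductSpace ℝ E] [FiniteDimensional ℝ E] [MeasureSpace E] [BorelSpace E]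
    [(volume : Measure E).IsAddHaarMeasure] {Ω L : Set E} {f : E → ℝ} {G : E → E}
    (hfG : HasWeakGradientOn Ω f G) (hL : MeasurableSet L) (hLΩ : L ⊆ Ω)
    (hf : IntegrableOn f L) (hG : IntegrableOn G L)
    (φ : ContDiffBump (0 : E)) {x : E} (hx : Metric.closedBall x φ.rOut ⊆ L) (v : E) :
    fderiv ℝ (φ.normed volume ⋆[ContinuousLinearMap.lsmul ℝ ℝ, volume] L.indicator f) x v =
      inner ℝ ((φ.normed volume ⋆[ContinuousLinearMap.lsmul ℝ ℝ, volume] L.indicator G) x) v := by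
  set ρ := φ.normed (volume : Measure E) with hρ
  have hρs : ContDiff ℝ ∞ ρ := φ.contDiff_normed
  have hρc : HasCompactSupport ρ := φ.hasCompactSupport_normed
  have hf' : Integrable (L.indicator f) := hf.integrable_indicator hL
  have hG' : Integrable (L.indicator G) := hG.integrable_indicator hL
  have hts : tsupport (fun y => ρ (x - y)) ⊆ Metric.closedBall x φ.rOut := by
    refine closure_minimal (fun y hy => ?_) Metric.isClosed_closedBall
    have : x - y ∈ Function.support ρ := hy
    rw [hρ, φ.support_normed_eq, mem_ball_zero_iff] at this
    rw [Metric.mem_closedBall, dist_comm, dist_eq_norm]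
    exact this.le
  have h0 : ∀ y ∉ L, ρ (x - y) = 0 := fun y hy =>
    image_eq_zero_of_notMem_tsupport (f := fun y => ρ (x - y)) fun h => hy (hx (hts h))
  have hder : ∀ y w, fderiv ℝ (fun y => ρ (x - y)) y w = - fderiv ℝ ρ (x - y) w := by
    intro y w
    have h1 : HasFDerivAt ρ (fderiv ℝ ρ (x - y)) (x - y) :=
      (hρs.differentiable (by simp)).differentiableAt.hasFDerivAt
    have h2 : HasFDerivAt (fun y : E => x - y) (-ContinuousLinearMap.id ℝ E) y := by
      simpa using (hasFDerivAt_id (𝕜 := ℝ) y).const_sub x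
    rw [show fderiv ℝ (fun y => ρ (x - y)) y = _ from (h1.comp y h2).fderiv]
    simp
  have h0' : ∀ y ∉ L, fderiv ℝ ρ (x - y) v = 0 := fun y hy => by
    have : fderiv ℝ (fun y => ρ (x - y)) y = 0 :=
      image_eq_zero_of_notMem_tsupport fun h => hy (hx (hts (tsupport_fderiv_subset ℝ h)))
    have h3 := hder y v
    rw [this] at h3
    simpa using h3.symm
  -- The reflected mollifier centred at `x` is an admissible test function, because the ball around
  -- `x` lies in `L ⊆ Ω`.
  have hweak := hfG.2.2 (fun y => ρ (x - y)) (hρs.comp (by fun_prop))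
    (HasCompactSupport.of_support_subset_isCompact (isCompact_closedBall x φ.rOut)
      ((subset_tsupport _).trans hts)) (hts.trans (hx.trans hLΩ)) v
  simp_rw [hder] at hweak
  have hc : (ρ ⋆[ContinuousLinearMap.lsmul ℝ ℝ, volume] L.indicator f) =
      (L.indicator f) ⋆[(ContinuousLinearMap.lsmul ℝ ℝ).flip, volume] ρ := by
    rw [convolution_flip]
  rw [hc, (hρc.hasFDerivAt_convolution_right _ hf'.locallyIntegrable
    (hρs.of_le (by norm_cast)) x).fderiv,
    convolution_precompR_apply _ hf'.locallyIntegrable (hρc.fderiv ℝ)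
      (hρs.continuous_fderiv (by simp))]
  have e1 : ((L.indicator f) ⋆[(ContinuousLinearMap.lsmul ℝ ℝ).flip, volume]
      fun a => fderiv ℝ ρ a v) x = ∫ y, f y * fderiv ℝ ρ (x - y) v := by
    refine integral_congr_ae (ae_of_all _ fun y => ?_)
    by_cases hy : y ∈ L
    · simp [hy, mul_comm]
    · simp [hy, h0' y hy]
  have e2 : inner ℝ ((ρ ⋆[ContinuousLinearMap.lsmul ℝ ℝ, volume] L.indicator G) x) v =
      ∫ y, ρ (x - y) * inner ℝ (G y) v := by
    rw [convolution_eq_swap, real_inner_comm, ← integral_inner]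
    · refine integral_congr_ae (ae_of_all _ fun y => ?_)
      by_cases hy : y ∈ L
      · simp [hy, inner_smul_right, real_inner_comm]
      · simp [hy, h0 y hy]
    · exact (hρc.convolutionExists_left (ContinuousLinearMap.lsmul ℝ ℝ)
        hρs.continuous hG'.locallyIntegrable x).integrable_swap
  rw [e1, e2]
  simp only [mul_neg, integral_neg, neg_inj] at hweak
  exact hweak

open Filter Topology Convolution ENNReal in
set_option maxHeartbeats 200000 in
/-- Local approximation in `W^{1,2}` by smooth functions. -/
theorem HasWeakGradientOn.exists_contDiff_eLpNorm_sub_le {E : Type*} [NormedAddCommGroup E]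
    [InnerProductSpace ℝ E] [FiniteDimensional ℝ E] [MeasureSpace E] [BorelSpace E]
    [(volume : Measure E).IsAddHaarMeasure] {Ω K L : Set E} {f : E → ℝ} {G : E → E}
    (hfG : HasWeakGradientOn Ω f G) (hL : IsCompact L) (hLΩ : L ⊆ Ω) {δ : ℝ} (hδ : 0 < δ)
    (hKL : Metric.cthickening δ K ⊆ L) (hKm : MeasurableSet K)
    (hf : MemLp f 2 (volume.restrict L)) (hG : MemLp G 2 (volume.restrict L))
    {ε : ℝ≥0∞} (hε : 0 < ε) :
    ∃ g : E → ℝ, ContDiff ℝ ∞ g ∧ eLpNorm (fun x => g x - f x) 2 (volume.restrict K) ≤ ε ∧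
      eLpNorm (fun x => gradient g x - G x) 2 (volume.restrict K) ≤ ε := by
  have hLm := hL.measurableSet
  have : IsFiniteMeasure ((volume : Measure E).restrict L) :=
    ⟨by simpa using hL.measure_lt_top⟩
  have hf' : MemLp (L.indicator f) 2 volume := (memLp_indicator_iff_restrict hLm).2 hf
  have hG' : MemLp (L.indicator G) 2 volume := (memLp_indicator_iff_restrict hLm).2 hG
  have A₁ := exists_eLpNorm_normed_convolution_sub_le hf' hε
  have A₂ := exists_eLpNorm_normed_convolution_sub_le hG' hε
  obtain ⟨δ₁, hδ₁, H₁⟩ := A₁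
  obtain ⟨δ₂, hδ₂, H₂⟩ := A₂
  -- A radius at most `δ` keeps the balls around points of `K` inside `L`; the other two bounds give
  -- `L²` closeness of the function and of its gradient.
  set r := min δ (min δ₁ δ₂)
  have hr : 0 < r := by positivity
  obtain ⟨φ, hφ⟩ : ∃ φ : ContDiffBump (0 : E), φ.rOut = r :=
    ⟨⟨r / 2, r, by positivity, by linarith⟩, rfl⟩
  have hfi : IntegrableOn f L := hf.integrable (by norm_num)
  have hGi : IntegrableOn G L := hG.integrable (by norm_num)
  have hKL' : K ⊆ L := (Metric.self_subset_cthickening K).trans hKL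
  refine ⟨φ.normed volume ⋆[ContinuousLinearMap.lsmul ℝ ℝ, volume] L.indicator f,
    φ.hasCompactSupport_normed.contDiff_convolution_left _ φ.contDiff_normed
      (hfi.integrable_indicator hLm).locallyIntegrable, ?_, ?_⟩
  · refine le_trans ?_ (H₁ φ (hφ.le.trans <| (min_le_right _ _).trans (min_le_left _ _)))
    refine le_trans (le_of_eq ?_) (eLpNorm_mono_measure _ (Measure.restrict_le_self (s := K)))
    refine eLpNorm_congr_ae ?_
    filter_upwards [ae_restrict_mem hKm] with x hx
    simp [hKL' hx]
  · refine le_trans ?_ (H₂ φ (hφ.le.trans <| (min_le_right _ _).trans (min_le_right _ _)))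
    refine le_trans (le_of_eq ?_) (eLpNorm_mono_measure _ (Measure.restrict_le_self (s := K)))
    refine eLpNorm_congr_ae ?_
    filter_upwards [ae_restrict_mem hKm] with x hx
    simp only [hKL' hx, indicator_of_mem]
    congr 1
    refine ext_inner_right ℝ fun v => ?_
    rw [inner_gradient_left]
    refine fderiv_convolution_normed_of_hasWeakGradientOn hfG hLm hLΩ hfi hGi φ ?_ v
    refine ((Metric.closedBall_subset_closedBall ?_).trans
      (Metric.closedBall_subset_cthickening hx δ)).trans hKL
    exact hφ.le.trans (min_le_left _ _)

/-! ### Comparison with Lebesgue measure on compact sets -/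

/-- On each compact subset of `Ω`, the measure `μ` is bounded above and below by multiples of
the Lebesgue measure. -/
def LocallyComparableOn {E : Type*} [TopologicalSpace E] [MeasureSpace E] (Ω : Set E)
    (μ : Measure E) : Prop :=
  ∀ K ⊆ Ω, IsCompact K → ∃ C : NNReal, volume.restrict K ≤ C • μ.restrict K ∧
    μ.restrict K ≤ C • volume.restrict K

theorem eLpNorm_two_le_of_le_smul {E F : Type*} [MeasurableSpace E] [NormedAddCommGroup F]
    {μ ν : Measure E} {C : NNReal} (h : μ ≤ C • ν) (f : E → F) :
    eLpNorm f 2 μ ≤ (C : ENNReal) ^ (1 / 2 : ℝ) * eLpNorm f 2 ν := by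
  refine (eLpNorm_mono_measure f h).trans ?_
  rw [ENNReal.smul_def, eLpNorm_smul_measure_of_ne_top (by norm_num)]
  simp

/-- A continuous positive density attains a positive minimum and a finite maximum on each nonempty
compact set. -/
theorem LocallyComparableOn.of_withDensity {E : Type*} [TopologicalSpace E] [T2Space E]
    [MeasureSpace E] [OpensMeasurableSpace E] {Ω : Set E} {μ : Measure E} {ρ : E → ℝ}
    (hρ : ContinuousOn ρ Ω) (hpos : ∀ x ∈ Ω, 0 < ρ x)
    (hμ : μ.restrict Ω = (volume.withDensity fun x => ENNReal.ofReal (ρ x)).restrict Ω) :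
    LocallyComparableOn Ω μ := by
  intro K hKΩ hK
  have hKm := hK.measurableSet
  have hμK : μ.restrict K = (volume.restrict K).withDensity fun x => ENNReal.ofReal (ρ x) := by
    rw [← restrict_withDensity hKm, ← inter_eq_self_of_subset_left hKΩ, ← Measure.restrict_restrict hKm,
      hμ, Measure.restrict_restrict hKm]
  rcases K.eq_empty_or_nonempty with rfl | hne
  · exact ⟨0, by simp⟩
  obtain ⟨a, ha, hmin⟩ := hK.exists_isMinOn hne (hρ.mono hKΩ)
  obtain ⟨b, hb, hmax⟩ := hK.exists_isMaxOn hne (hρ.mono hKΩ)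
  have hpa := hpos a (hKΩ ha)
  have hle : ∀ {m : Measure E} {u w : E → ENNReal} (C : NNReal), (∀ᵐ x ∂m, u x ≤ C * w x) →
      m.withDensity u ≤ C • m.withDensity w := by
    intro m u w C h
    rw [ENNReal.smul_def, ← withDensity_smul' _ _ (by simp)]
    exact withDensity_mono h
  refine ⟨max (Real.toNNReal (ρ a)⁻¹) (Real.toNNReal (ρ b)), ?_, ?_⟩
  · rw [hμK]
    nth_rewrite 1 [← withDensity_one (μ := volume.restrict K)]
    refine hle _ ?_
    filter_upwards [ae_restrict_mem hKm] with x hx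
    calc (1 : ENNReal) = ENNReal.ofReal ((ρ a)⁻¹ * ρ a) := by
          rw [inv_mul_cancel₀ hpa.ne']; simp
      _ ≤ ENNReal.ofReal ((ρ a)⁻¹ * ρ x) := by
          gcongr
          exact hmin hx
      _ = ENNReal.ofReal (ρ a)⁻¹ * ENNReal.ofReal (ρ x) :=
          ENNReal.ofReal_mul (inv_nonneg.2 hpa.le)
      _ ≤ _ := by
          gcongr
          exact ENNReal.coe_le_coe.2 (le_max_left _ _)
  · rw [hμK]
    nth_rewrite 2 [← withDensity_one (μ := volume.restrict K)]
    refine hle _ ?_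
    filter_upwards [ae_restrict_mem hKm] with x hx
    simp only [Pi.one_apply, mul_one]
    exact (ENNReal.ofReal_le_ofReal (hmax hx)).trans (ENNReal.coe_le_coe.2 (le_max_right _ _))

/-- Local approximation of Sobolev functions by smooth functions, in `L²(μ)`. -/
theorem IsSobolevWithGradient.exists_contDiff_eLpNorm_sub_le {E : Type*} [NormedAddCommGroup E]
    [InnerProductSpace ℝ E] [FiniteDimensional ℝ E] [MeasureSpace E] [BorelSpace E]
    [(volume : Measure E).IsAddHaarMeasure] {Ω U K : Set E} {μ : Measure E} {f : E → ℝ} {G : E → E}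
    (hfG : IsSobolevWithGradient Ω μ f G) (hU : IsOpen U) (hUΩ : U ⊆ Ω)
    (hμ : LocallyComparableOn U μ) (hK : IsCompact K) (hKU : K ⊆ U)
    {ε : ENNReal} (hε : 0 < ε) :
    ∃ g : E → ℝ, ContDiff ℝ ∞ g ∧ eLpNorm (fun x => g x - f x) 2 (μ.restrict K) ≤ ε ∧
      eLpNorm (fun x => gradient g x - G x) 2 (μ.restrict K) ≤ ε := by
  obtain ⟨δ, hδ, hδU⟩ := hK.exists_cthickening_subset_open hU hKU
  have hL : IsCompact (Metric.cthickening δ K) := hK.cthickening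
  obtain ⟨C, hC, -⟩ := hμ _ hδU hL
  obtain ⟨D, -, hD⟩ := hμ _ hKU hK
  have hD' : (D : ENNReal) ^ (1 / 2 : ℝ) ≠ ⊤ := by simp
  set d := (D : ENNReal) ^ (1 / 2 : ℝ)
  -- Returning from Lebesgue measure to `μ` on `K` costs the factor `d`; the `+ 1` keeps the
  -- denominator nonzero.
  obtain ⟨g, hg, h1, h2⟩ := hfG.hasWeakGradientOn.exists_contDiff_eLpNorm_sub_le hL
    (hδU.trans hUΩ) hδ subset_rfl hK.measurableSet
    (hfG.memLp.restrict _ |>.of_measure_le_smul (c := C) (by simp) hC)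
    (hfG.memLp_gradient.restrict _ |>.of_measure_le_smul (c := C) (by simp) hC)
    (ε := ε / (d + 1)) (ENNReal.div_pos hε.ne' (by simp [hD']))
  have hfin : d * (ε / (d + 1)) ≤ ε := by
    calc d * (ε / (d + 1)) ≤ (d + 1) * (ε / (d + 1)) := by gcongr; exact le_self_add
      _ ≤ ε := ENNReal.mul_div_le
  refine ⟨g, hg, ?_, ?_⟩
  · exact (eLpNorm_two_le_of_le_smul hD _).trans ((mul_le_mul_right h1 _).trans hfin)
  · exact (eLpNorm_two_le_of_le_smul hD _).trans ((mul_le_mul_right h2 _).trans hfin)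

theorem LocallyIntegrableOn.integrable_mul_of_hasCompactSupport {E : Type*} [TopologicalSpace E]
    [T2Space E] [MeasurableSpace E] [OpensMeasurableSpace E] {μ : Measure E}
    {Ω : Set E} {f ψ : E → ℝ} (hf : LocallyIntegrableOn f Ω μ) (hψ : Continuous ψ)
    (hc : HasCompactSupport ψ) (hs : tsupport ψ ⊆ Ω) : Integrable (fun x => f x * ψ x) μ := by
  have h1 : IntegrableOn f (tsupport ψ) μ := hf.integrableOn_compact_subset hs hc
  have h2 : IntegrableOn (fun x => f x * ψ x) (tsupport ψ) μ :=
    h1.mul_continuousOn hψ.continuousOn hc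
  refine (integrableOn_iff_integrable_of_support_subset fun x hx => ?_).1 h2
  exact subset_tsupport _ (right_ne_zero_of_mul hx)

/-! ### From the variational formula to the Poincaré inequality -/

section Gap

variable {E : Type*} [NormedAddCommGroup E] [InnerProductSpace ℝ E] [MeasureSpace E]

theorem HasCompactSupport.integral_fderiv_eq_zero [FiniteDimensional ℝ E] [BorelSpace E]
    [(volume : Measure E).IsAddHaarMeasure] {φ : E → ℝ} (hφ : ContDiff ℝ ∞ φ)
    (hc : HasCompactSupport φ) (v : E) : ∫ x, fderiv ℝ φ x v = 0 := by
  have h1 : Continuous fun x => fderiv ℝ φ x v := (hφ.continuous_fderiv (by simp)).clm_apply continuous_const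
  have h2 : HasCompactSupport fun x => fderiv ℝ φ x v := hc.fderiv_apply ℝ v
  have := integral_mul_fderiv_eq_neg_fderiv_mul_of_integrable (μ := volume) (f := fun _ : E => (1 : ℝ))
    (g := φ) (v := v) (by simp) (by simpa using h1.integrable_of_hasCompactSupport h2)
    (by simpa using hφ.continuous.integrable_of_hasCompactSupport hc) (by simp)
    (fun x _ => (hφ.differentiable (by simp)).differentiableAt)
  simpa using this

theorem IsSobolevWithGradient.const_mul_sub_const [FiniteDimensional ℝ E] [BorelSpace E]
    [(volume : Measure E).IsAddHaarMeasure] {Ω : Set E} {μ : Measure E} [IsFiniteMeasure μ]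
    {f : E → ℝ} {G : E → E} (h : IsSobolevWithGradient Ω μ f G) (a m : ℝ) :
    IsSobolevWithGradient Ω μ (fun x => a * (f x - m)) (fun x => a • G x) := by
  refine ⟨(h.memLp.sub (memLp_const m)).const_mul a, ⟨?_, ?_, ?_⟩, h.memLp_gradient.const_smul a⟩
  · exact (h.hasWeakGradientOn.1.sub (locallyIntegrable_const m |>.locallyIntegrableOn Ω)).smul a
  · exact h.hasWeakGradientOn.2.1.smul a
  · intro φ hφ hc hs v
    have h1 : Continuous fun x => fderiv ℝ φ x v :=
      (hφ.continuous_fderiv (by simp)).clm_apply continuous_const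
    have h2 : HasCompactSupport fun x => fderiv ℝ φ x v := hc.fderiv_apply ℝ v
    have h3 : tsupport (fun x => fderiv ℝ φ x v) ⊆ tsupport φ := tsupport_fderiv_apply_subset ℝ v
    have h4 := LocallyIntegrableOn.integrable_mul_of_hasCompactSupport h.hasWeakGradientOn.1 h1 h2
      (h3.trans hs)
    have h5 := (h1.integrable_of_hasCompactSupport h2 (μ := volume)).const_mul m
    simp_rw [mul_assoc, sub_mul, inner_smul_left]
    rw [integral_const_mul, integral_sub h4 h5, integral_const_mul m,
      HasCompactSupport.integral_fderiv_eq_zero hφ hc, h.hasWeakGradientOn.2.2 φ hφ hc hs v,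
      ← integral_neg, mul_zero, sub_zero, ← integral_const_mul, ← integral_neg]
    refine integral_congr_ae (ae_of_all _ fun x => ?_)
    simp
    ring

/-- Centring `f` and dividing by its standard deviation gives an admissible competitor whose energy
is the Rayleigh quotient of `f`. -/
theorem IsSobolevWithGradient.div_variance_mem [FiniteDimensional ℝ E] [BorelSpace E]
    [(volume : Measure E).IsAddHaarMeasure] {Ω : Set E} {μ : Measure E} [IsProbabilityMeasure μ]
    {f : E → ℝ} {G : E → E} (h : IsSobolevWithGradient Ω μ f G)
    (hv : 0 < ∫ x, f x ^ 2 ∂μ - (∫ x, f x ∂μ) ^ 2) :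
    (∫ x, ‖G x‖ ^ 2 ∂μ) / (∫ x, f x ^ 2 ∂μ - (∫ x, f x ∂μ) ^ 2) ∈
      {e : ℝ | ∃ (f : E → ℝ) (G : E → E), IsSobolevWithGradient Ω μ f G ∧
        ∫ x, f x ∂μ = 0 ∧ ∫ x, f x ^ 2 ∂μ = 1 ∧ e = ∫ x, ‖G x‖ ^ 2 ∂μ} := by
  set m := ∫ x, f x ∂μ
  set s := ∫ x, f x ^ 2 ∂μ - m ^ 2 with hs
  have hfi : Integrable f μ := h.memLp.integrable (by norm_num)
  have hf2 : Integrable (fun x => f x ^ 2) μ := h.memLp.integrable_sq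
  have ha : (√s)⁻¹ ^ 2 = s⁻¹ := by rw [inv_pow, Real.sq_sqrt hv.le]
  refine ⟨_, _, h.const_mul_sub_const (√s)⁻¹ m, ?_, ?_, ?_⟩
  · rw [integral_const_mul, integral_sub hfi (integrable_const m)]
    simp [m]
  · simp_rw [mul_pow, sub_sq]
    have h1 : Integrable (fun x => 2 * f x * m) μ := (hfi.const_mul 2).mul_const m
    have h2 : Integrable (fun x => f x ^ 2 - 2 * f x * m) μ := hf2.sub h1
    rw [integral_const_mul, integral_add h2 (integrable_const _), integral_sub hf2 h1,
      integral_mul_const, integral_const_mul, ha]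
    have : ∫ x, f x ^ 2 ∂μ - 2 * m * m + m ^ 2 = s := by rw [hs]; ring
    simp only [integral_const, probReal_univ, smul_eq_mul, one_mul]
    change s⁻¹ * (∫ x, f x ^ 2 ∂μ - 2 * m * m + m ^ 2) = 1
    rw [this, inv_mul_cancel₀ hv.ne']
  · simp_rw [norm_smul, mul_pow]
    rw [integral_const_mul, Real.norm_eq_abs, sq_abs, ha, div_eq_inv_mul]

theorem spectralGap_nonneg (Ω : Set E) (μ : Measure E) : 0 ≤ spectralGap Ω μ := by
  -- This also covers an empty set of competitors, for which the real infimum is `0` by convention.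
  refine Real.sInf_nonneg ?_
  rintro _ ⟨f, G, -, -, -, rfl⟩
  positivity

/-- The Poincaré inequality with the optimal constant. -/
theorem IsSobolevWithGradient.spectralGap_mul_variance_le [FiniteDimensional ℝ E] [BorelSpace E]
    [(volume : Measure E).IsAddHaarMeasure] {Ω : Set E} {μ : Measure E} [IsProbabilityMeasure μ]
    {f : E → ℝ} {G : E → E} (h : IsSobolevWithGradient Ω μ f G) :
    spectralGap Ω μ * (∫ x, f x ^ 2 ∂μ - (∫ x, f x ∂μ) ^ 2) ≤ ∫ x, ‖G x‖ ^ 2 ∂μ := by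
  rcases le_or_gt (∫ x, f x ^ 2 ∂μ - (∫ x, f x ∂μ) ^ 2) 0 with hv | hv
  · exact (mul_nonpos_of_nonneg_of_nonpos (spectralGap_nonneg Ω μ) hv).trans (by positivity)
  · rw [← le_div_iff₀ hv]
    refine csInf_le ⟨0, ?_⟩ (h.div_variance_mem hv)
    rintro _ ⟨f, G, -, -, -, rfl⟩
    positivity

end Gap

/-! ### Limits in `L²`, and closedness of the weak gradient -/

theorem tendsto_integral_norm_sq_of_tendsto_eLpNorm {α F ι : Type*} [MeasurableSpace α]
    {μ : Measure α} [NormedAddCommGroup F] {l : Filter ι} {u : ι → α → F} {w : α → F}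
    (hu : ∀ i, MemLp (u i) 2 μ) (hw : MemLp w 2 μ)
    (h : Filter.Tendsto (fun i => eLpNorm (u i - w) 2 μ) l (nhds 0)) :
    Filter.Tendsto (fun i => ∫ x, ‖u i x‖ ^ 2 ∂μ) l (nhds (∫ x, ‖w x‖ ^ 2 ∂μ)) := by
  have key : ∀ g : α → F, ∀ hg : MemLp g 2 μ, ∫ x, ‖g x‖ ^ 2 ∂μ = ‖hg.toLp g‖ ^ 2 := by
    intro g hg
    rw [Lp.norm_toLp, hg.eLpNorm_eq_integral_rpow_norm (by norm_num) (by norm_num),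
      ENNReal.toReal_ofReal (by positivity), ← Real.rpow_natCast, ← Real.rpow_mul (by positivity)]
    simp
  have h2 : Filter.Tendsto (fun i => (hu i).toLp (u i)) l (nhds (hw.toLp w)) :=
    (Lp.tendsto_Lp_iff_tendsto_eLpNorm'' u hu w hw).2 h
  simp_rw [key _ (hu _), key _ hw]
  exact h2.norm.pow 2

theorem tendsto_integral_of_tendsto_eLpNorm_two {α ι : Type*} [MeasurableSpace α]
    {μ : Measure α} [IsProbabilityMeasure μ] {l : Filter ι} {u : ι → α → ℝ} {w : α → ℝ}
    (hu : ∀ i, MemLp (u i) 2 μ) (hw : MemLp w 2 μ)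
    (h : Filter.Tendsto (fun i => eLpNorm (u i - w) 2 μ) l (nhds 0)) :
    Filter.Tendsto (fun i => ∫ x, u i x ∂μ) l (nhds (∫ x, w x ∂μ)) := by
  refine tendsto_integral_of_L1' w (hw.integrable (by norm_num)).1
    (Filter.Eventually.of_forall fun i => (hu i).integrable (by norm_num)) ?_
  refine tendsto_of_tendsto_of_tendsto_of_le_of_le tendsto_const_nhds h (fun _ => zero_le)
    fun i => ?_
  exact eLpNorm_le_eLpNorm_of_exponent_le (by norm_num) ((hu i).sub hw).1

theorem tendsto_integral_mul_of_tendsto_eLpNorm {α ι : Type*} [MeasurableSpace α]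
    {μ : Measure α} {l : Filter ι} {u : ι → α → ℝ} {w ψ : α → ℝ}
    (hu : ∀ i, MemLp (u i) 2 μ) (hw : MemLp w 2 μ) (hψ : MemLp ψ 2 μ)
    (h : Filter.Tendsto (fun i => eLpNorm (u i - w) 2 μ) l (nhds 0)) :
    Filter.Tendsto (fun i => ∫ x, u i x * ψ x ∂μ) l (nhds (∫ x, w x * ψ x ∂μ)) := by
  refine tendsto_integral_of_L1' _ (hw.integrable_mul hψ).1
    (Filter.Eventually.of_forall fun i => (hu i).integrable_mul hψ) ?_
  have h1 : Filter.Tendsto (fun i => eLpNorm (u i - w) 2 μ * eLpNorm ψ 2 μ) l (nhds 0) := by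
    simpa using ENNReal.Tendsto.mul_const h (Or.inr hψ.2.ne)
  refine tendsto_of_tendsto_of_tendsto_of_le_of_le tendsto_const_nhds h1 (fun _ => zero_le)
    fun i => ?_
  have := eLpNorm_smul_le_mul_eLpNorm (p := 2) (q := 2) (r := 1) hψ.1 ((hu i).sub hw).1
  refine le_trans (le_of_eq ?_) this
  congr 1
  ext x
  simp [sub_mul]

theorem MemLp.restrict_volume_of_locallyComparableOn {E F : Type*} [TopologicalSpace E]
    [MeasureSpace E] [NormedAddCommGroup F] {Ω K : Set E} {μ : Measure E}
    (hμ : LocallyComparableOn Ω μ) {u : E → F} (hu : MemLp u 2 μ) (hK : IsCompact K)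
    (hKΩ : K ⊆ Ω) : MemLp u 2 (volume.restrict K) := by
  obtain ⟨C, hC, -⟩ := hμ K hKΩ hK
  exact (hu.restrict K).of_measure_le_smul (c := C) (by simp) hC

theorem MemLp.locallyIntegrableOn_of_locallyComparableOn {E F : Type*} [NormedAddCommGroup E]
    [NormedSpace ℝ E] [FiniteDimensional ℝ E] [MeasureSpace E] [BorelSpace E]
    [(volume : Measure E).IsAddHaarMeasure] [NormedAddCommGroup F] {Ω : Set E} {μ : Measure E}
    (hΩ : IsOpen Ω) (hμ : LocallyComparableOn Ω μ) {u : E → F} (hu : MemLp u 2 μ) :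
    LocallyIntegrableOn u Ω := by
  rw [locallyIntegrableOn_iff hΩ.isLocallyClosed]
  intro K hKΩ hK
  have : IsFiniteMeasure ((volume : Measure E).restrict K) := ⟨by simpa using hK.measure_lt_top⟩
  exact (MemLp.restrict_volume_of_locallyComparableOn hμ hu hK hKΩ).integrable (by norm_num)

/-- `W^{1,2}` is closed under local `L²` limits of smooth functions. -/
theorem hasWeakGradientOn_of_approx {E : Type*} [NormedAddCommGroup E]
    [InnerProductSpace ℝ E] [FiniteDimensional ℝ E] [MeasureSpace E] [BorelSpace E]
    [(volume : Measure E).IsAddHaarMeasure] {Ω : Set E} {μ : Measure E} {f : E → ℝ}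
    {G : E → E} (hΩ : IsOpen Ω) (hμ : LocallyComparableOn Ω μ) (hf : MemLp f 2 μ)
    (hG : MemLp G 2 μ)
    (h : ∀ K ⊆ Ω, IsCompact K → ∀ ε : ENNReal, 0 < ε → ∃ g : E → ℝ, ContDiff ℝ 1 g ∧
      eLpNorm (fun x => g x - f x) 2 (μ.restrict K) ≤ ε ∧
      eLpNorm (fun x => gradient g x - G x) 2 (μ.restrict K) ≤ ε) :
    HasWeakGradientOn Ω f G := by
  refine ⟨MemLp.locallyIntegrableOn_of_locallyComparableOn hΩ hμ hf,
    MemLp.locallyIntegrableOn_of_locallyComparableOn hΩ hμ hG, fun φ hφ hc hs v => ?_⟩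
  set K := tsupport φ
  have hK : IsCompact K := hc
  have : IsFiniteMeasure ((volume : Measure E).restrict K) := ⟨by simpa using hK.measure_lt_top⟩
  have hfK := MemLp.restrict_volume_of_locallyComparableOn hμ hf hK hs
  have hGK := MemLp.restrict_volume_of_locallyComparableOn hμ hG hK hs
  obtain ⟨C, hC, -⟩ := hμ K hs hK
  -- The tolerance at `j = 0` is `⊤`, which is harmless since only the limit matters.
  have hε : ∀ j : ℕ, (0 : ENNReal) < ((j : ENNReal))⁻¹ := fun j => by simp
  choose g hg h1 h2 using fun j : ℕ => h K hs hK _ (hε j)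
  have hlim : Filter.Tendsto (fun j : ℕ => (C : ENNReal) ^ (1 / 2 : ℝ) * ((j : ENNReal))⁻¹)
      Filter.atTop (nhds 0) := by
    simpa using ENNReal.Tendsto.const_mul ENNReal.tendsto_inv_nat_nhds_zero
      (a := (C : ENNReal) ^ (1 / 2 : ℝ)) (Or.inr (by simp))
  have hdφ : Continuous fun x => fderiv ℝ φ x v :=
    (hφ.continuous_fderiv (by simp)).clm_apply continuous_const
  have hgc : ∀ j, Continuous (gradient (g j)) := fun j =>
    (LinearIsometryEquiv.continuous _).comp ((hg j).continuous_fderiv (by simp))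
  have memK : ∀ {u : E → ℝ}, Continuous u → MemLp u 2 (volume.restrict K) := fun {u} hu => by
    obtain ⟨B, hB⟩ := hK.exists_bound_of_continuousOn hu.continuousOn
    exact MemLp.of_bound hu.aestronglyMeasurable B
      ((ae_restrict_iff' hK.measurableSet).2 (ae_of_all _ hB))
  have t1 : Filter.Tendsto (fun j => ∫ x in K, g j x * fderiv ℝ φ x v) Filter.atTop
      (nhds (∫ x in K, f x * fderiv ℝ φ x v)) := by
    refine tendsto_integral_mul_of_tendsto_eLpNorm (fun j => memK (hg j).continuous) hfK
      (memK hdφ) ?_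
    exact tendsto_of_tendsto_of_tendsto_of_le_of_le tendsto_const_nhds hlim (fun _ => zero_le)
      fun j => (eLpNorm_two_le_of_le_smul hC _).trans (mul_le_mul_right (h1 j) _)
  have t2 : Filter.Tendsto (fun j => ∫ x in K, inner ℝ (gradient (g j) x) v * φ x) Filter.atTop
      (nhds (∫ x in K, inner ℝ (G x) v * φ x)) := by
    refine tendsto_integral_mul_of_tendsto_eLpNorm
      (fun j => memK ((hgc j).inner continuous_const)) (hGK.inner_const v) (memK hφ.continuous) ?_
    have hlim' : Filter.Tendsto (fun j : ℕ => ENNReal.ofReal ‖v‖ *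
        ((C : ENNReal) ^ (1 / 2 : ℝ) * ((j : ENNReal))⁻¹)) Filter.atTop (nhds 0) := by
      simpa using ENNReal.Tendsto.const_mul hlim (a := ENNReal.ofReal ‖v‖) (Or.inr (by simp))
    refine tendsto_of_tendsto_of_tendsto_of_le_of_le tendsto_const_nhds hlim' (fun _ => zero_le)
      fun j => ?_
    refine le_trans ?_ (mul_le_mul_right
      ((eLpNorm_two_le_of_le_smul hC _).trans (mul_le_mul_right (h2 j) _)) _)
    refine eLpNorm_le_mul_eLpNorm_of_ae_le_mul (ae_of_all _ fun x => ?_) 2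
    simp only [Pi.sub_apply, ← inner_sub_left]
    rw [mul_comm]
    exact norm_inner_le_norm _ _
  have hK0 : ∀ x, x ∉ K → φ x = 0 := fun x hx => image_eq_zero_of_notMem_tsupport hx
  have hK0' : ∀ x, x ∉ K → fderiv ℝ φ x v = 0 := fun x hx => by
    rw [image_eq_zero_of_notMem_tsupport fun h => hx (tsupport_fderiv_subset ℝ h)]
    simp
  have ext1 : ∀ u : E → ℝ, ∫ x in K, u x * fderiv ℝ φ x v = ∫ x, u x * fderiv ℝ φ x v :=
    fun u => setIntegral_eq_integral_of_forall_compl_eq_zero fun x hx => by simp [hK0' x hx]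
  have ext2 : ∀ u : E → ℝ, ∫ x in K, u x * φ x = ∫ x, φ x * u x :=
    fun u => by
      simp_rw [mul_comm (φ _)]
      exact setIntegral_eq_integral_of_forall_compl_eq_zero fun x hx => by simp [hK0 x hx]
  rw [ext1] at t1
  rw [ext2] at t2
  refine tendsto_nhds_unique t1 (t2.neg.congr fun j => ?_)
  rw [ext1, ext2]
  have hdc : HasCompactSupport fun x => fderiv ℝ φ x v := hc.fderiv_apply ℝ v
  have hgv : Continuous fun x => fderiv ℝ (g j) x v :=
    ((hg j).continuous_fderiv (by simp)).clm_apply continuous_const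
  rw [integral_mul_fderiv_eq_neg_fderiv_mul_of_integrable
    ((hgv.mul hφ.continuous).integrable_of_hasCompactSupport hc.mul_left)
    (((hg j).continuous.mul hdφ).integrable_of_hasCompactSupport hdc.mul_left)
    (((hg j).continuous.mul hφ.continuous).integrable_of_hasCompactSupport hc.mul_left)
    (fun x _ => ((hg j).differentiable (by simp)).differentiableAt)
    (fun x _ => (hφ.differentiable (by simp)).differentiableAt)]
  simp_rw [inner_gradient_left, mul_comm]

/-! ### The Efron–Stein inequality -/

section EfronStein

variable {n : ℕ} {α : Type*}

/-- Of the pairs `Z i`, take the second component for `i ∈ S`, and the first one otherwise. -/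
def selectOn (S : Finset (Fin n)) (Z : Fin n → α × α) : Fin n → α :=
  fun i => if i ∈ S then (Z i).2 else (Z i).1

/-- Swap the components of the pairs `Z i` with `i ∈ S`. -/
def swapOn (S : Finset (Fin n)) (Z : Fin n → α × α) : Fin n → α × α :=
  fun i => if i ∈ S then (Z i).swap else Z i

/-- Exchanging two independent copies on `T` acts on selections by symmetric difference. Combined
with the invariance of the product law under `swapOn`, this yields all the identities needed for
Efron–Stein. -/
theorem selectOn_swapOn (S T : Finset (Fin n)) (Z : Fin n → α × α) :
    selectOn S (swapOn T Z) = selectOn (symmDiff S T) Z := by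
  ext i
  by_cases hS : i ∈ S <;> by_cases hT : i ∈ T <;>
    simp [selectOn, swapOn, hS, hT, Finset.mem_symmDiff]

variable [MeasurableSpace α] (γ : Measure α) [IsProbabilityMeasure γ]

theorem measurePreserving_swapOn (S : Finset (Fin n)) :
    MeasurePreserving (swapOn S) (Measure.pi fun _ : Fin n => γ.prod γ)
      (Measure.pi fun _ : Fin n => γ.prod γ) := by
  refine measurePreserving_pi (f := fun i p => if i ∈ S then Prod.swap p else p)
    (fun _ => γ.prod γ) (fun _ => γ.prod γ) fun i => ?_
  by_cases hi : i ∈ S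
  · simpa [hi] using Measure.measurePreserving_swap
  · simpa [hi] using! MeasurePreserving.id (γ.prod γ)

theorem measurePreserving_selectOn (S : Finset (Fin n)) :
    MeasurePreserving (selectOn S) (Measure.pi fun _ : Fin n => γ.prod γ)
      (Measure.pi fun _ : Fin n => γ) := by
  refine measurePreserving_pi (f := fun i p => if i ∈ S then Prod.snd p else Prod.fst p)
    (fun _ => γ.prod γ) (fun _ => γ) fun i => ?_
  by_cases hi : i ∈ S
  · simpa [hi] using measurePreserving_snd
  · simpa [hi] using measurePreserving_fst

theorem lintegral_selectOn_singleton (k : Fin n) {A : (Fin n → α) → (Fin n → α) → ENNReal}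
    (hA : Measurable (Function.uncurry A)) :
    ∫⁻ Z, A (selectOn ∅ Z) (selectOn {k} Z) ∂(Measure.pi fun _ : Fin n => γ.prod γ) =
      ∫⁻ x, ∫⁻ t, A x (Function.update x k t) ∂γ ∂(Measure.pi fun _ : Fin n => γ) := by
  have h1 := measurePreserving_arrowProdEquivProdArrow α α (Fin n) (fun _ => γ) (fun _ => γ)
  have hu : Measurable fun p : (Fin n → α) × α => Function.update p.1 k p.2 := by
    rw [measurable_pi_iff]
    intro i
    by_cases hi : i = k
    · subst hi; simpa using measurable_snd
    · simpa [Function.update_of_ne hi] using! (measurable_pi_apply i).comp measurable_fst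
  have hm : Measurable fun p : (Fin n → α) × (Fin n → α) => A p.1 (Function.update p.1 k (p.2 k)) :=
    hA.comp (measurable_fst.prodMk
      (hu.comp (measurable_fst.prodMk ((measurable_pi_apply k).comp measurable_snd))))
  have h2 : ∀ Z : Fin n → α × α, A (selectOn ∅ Z) (selectOn {k} Z) =
      (fun p : (Fin n → α) × (Fin n → α) => A p.1 (Function.update p.1 k (p.2 k)))
        (MeasurableEquiv.arrowProdEquivProdArrow α α (Fin n) Z) := by
    intro Z
    change _ = A (fun i => (Z i).1) (Function.update (fun i => (Z i).1) k (Z k).2)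
    have e1 : selectOn ∅ Z = fun i => (Z i).1 := by ext i; simp [selectOn]
    have e2 : selectOn {k} Z = Function.update (fun i => (Z i).1) k (Z k).2 := by
      ext i
      by_cases hi : i = k
      · subst hi; simp [selectOn]
      · simp [selectOn, hi]
    rw [e1, e2]
  simp_rw [h2]
  rw [h1.lintegral_comp hm, lintegral_prod _ hm.aemeasurable]
  refine lintegral_congr fun x => ?_
  have h3 : Measurable fun t => A x (Function.update x k t) :=
    hA.comp (measurable_const.prodMk (hu.comp (measurable_const.prodMk measurable_id)))
  exact (measurePreserving_eval (fun _ : Fin n => γ) k).lintegral_comp h3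

/-- Resampling one coordinate from its own law leaves the product law unchanged. This isolates an
inner one-dimensional integral. -/
theorem lintegral_pi_eq_lintegral_update (k : Fin n) {A : (Fin n → α) → ENNReal}
    (hA : Measurable A) :
    ∫⁻ x, A x ∂(Measure.pi fun _ : Fin n => γ) =
      ∫⁻ x, ∫⁻ t, A (Function.update x k t) ∂γ ∂(Measure.pi fun _ : Fin n => γ) := by
  rw [← (measurePreserving_selectOn γ {k}).lintegral_comp hA]
  exact lintegral_selectOn_singleton γ k (A := fun _ y => A y) (hA.comp measurable_snd)

theorem integral_selectOn_empty_mul_selectOn_univ {H : (Fin n → α) → ℝ} :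
    ∫ Z, H (selectOn ∅ Z) * H (selectOn Finset.univ Z) ∂(Measure.pi fun _ : Fin n => γ.prod γ) =
      (∫ x, H x ∂(Measure.pi fun _ : Fin n => γ)) ^ 2 := by
  have h1 := measurePreserving_arrowProdEquivProdArrow α α (Fin n) (fun _ => γ) (fun _ => γ)
  have h2 : ∀ Z : Fin n → α × α, H (selectOn ∅ Z) * H (selectOn Finset.univ Z) =
      (fun p : (Fin n → α) × (Fin n → α) => H p.1 * H p.2)
        (MeasurableEquiv.arrowProdEquivProdArrow α α (Fin n) Z) := by
    intro Z
    change _ = H (fun i => (Z i).1) * H (fun i => (Z i).2)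
    have e1 : selectOn ∅ Z = fun i => (Z i).1 := by ext i; simp [selectOn]
    have e2 : selectOn Finset.univ Z = fun i => (Z i).2 := by ext i; simp [selectOn]
    rw [e1, e2]
  simp_rw [h2]
  rw [h1.integral_comp' (g := fun p : (Fin n → α) × (Fin n → α) => H p.1 * H p.2),
    integral_prod_mul, sq]

/-- The Efron–Stein inequality. -/
theorem variance_pi_le_sum {H : (Fin n → α) → ℝ}
    (hH : MemLp H 2 (Measure.pi fun _ : Fin n => γ)) :
    ∫ x, H x ^ 2 ∂(Measure.pi fun _ : Fin n => γ) -
        (∫ x, H x ∂(Measure.pi fun _ : Fin n => γ)) ^ 2 ≤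
      ∑ k, (1 / 2) * ∫ Z, (H (selectOn ∅ Z) - H (selectOn {k} Z)) ^ 2
        ∂(Measure.pi fun _ : Fin n => γ.prod γ) := by
  set P := Measure.pi fun _ : Fin n => γ.prod γ with hP
  let I : Finset (Fin n) → (Fin n → α × α) → ℝ := fun S Z => H (selectOn S Z)
  have hI : ∀ S, MemLp (I S) 2 P := fun S => hH.comp_measurePreserving (measurePreserving_selectOn γ S)
  have hmul : ∀ S T, Integrable (fun Z => I S Z * I T Z) P := fun S T => (hI S).integrable_mul (hI T)
  have hswap : ∀ (R : Finset (Fin n)) (g : (Fin n → α × α) → ℝ),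
      AEStronglyMeasurable g P → ∫ Z, g (swapOn R Z) ∂P = ∫ Z, g Z ∂P := by
    intro R g hg
    have h := measurePreserving_swapOn γ R (n := n)
    rw [← hP] at h
    conv_rhs => rw [← h.map_eq]
    rw [integral_map h.aemeasurable (by rwa [h.map_eq])]
  let S : ℕ → Finset (Fin n) := fun k => Finset.univ.filter fun i => (i : ℕ) < k
  have hS : ∀ k : Fin n, symmDiff (S k) {k} = S (k + 1) := by
    intro k
    ext i
    simp only [Finset.mem_symmDiff, S, Finset.mem_filter, Finset.mem_univ, true_and,
      Finset.mem_singleton, Fin.ext_iff]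
    omega
  have hS' : ∀ k : Fin n, symmDiff (S (k + 1)) {k} = S k := by
    intro k
    rw [← hS, symmDiff_assoc, symmDiff_self, symmDiff_bot]
  have hS'' : ∀ k : Fin n, symmDiff {k} (S k) = S (k + 1) := by
    intro k
    rw [symmDiff_comm, hS]
  have step : ∀ k : Fin n, ∫ Z, I ∅ Z * (I (S k) Z - I (S (k + 1)) Z) ∂P ≤
      (1 / 2) * ∫ Z, (I ∅ Z - I {k} Z) ^ 2 ∂P := by
    intro k
    have i1 : ∀ R, Integrable (fun Z => I R Z * (I (S k) Z - I (S (k + 1)) Z)) P := fun R =>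
      (hI R).integrable_mul ((hI _).sub (hI _))
    have i2 : ∀ R T, Integrable (fun Z => (I R Z - I T Z) ^ 2) P := fun R T =>
      ((hI R).sub (hI T)).integrable_sq
    -- Swapping coordinate `k` turns `I ∅` into `I {k}` and interchanges `S k` with `S (k + 1)`,
    -- whence the sign. Averaging the two expressions replaces `I ∅` by `(I ∅ - I {k}) / 2`.
    have e1 : ∫ Z, I ∅ Z * (I (S k) Z - I (S (k + 1)) Z) ∂P =
        ∫ Z, -(I {k} Z * (I (S k) Z - I (S (k + 1)) Z)) ∂P := by
      rw [← hswap {k} _ (i1 ∅).1]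
      refine integral_congr_ae (ae_of_all _ fun Z => ?_)
      simp only [I, selectOn_swapOn, hS, hS', ← Finset.bot_eq_empty, bot_symmDiff]
      ring
    -- Swapping on `S k` carries `∅` and `{k}` to `S k` and `S (k + 1)`; hence the two squares
    -- produced by `2ab ≤ a² + b²` have the same integral.
    have e2 : ∫ Z, (I (S k) Z - I (S (k + 1)) Z) ^ 2 ∂P = ∫ Z, (I ∅ Z - I {k} Z) ^ 2 ∂P := by
      rw [← hswap (S k) _ (i2 ∅ {k}).1]
      refine integral_congr_ae (ae_of_all _ fun Z => ?_)
      simp only [I, selectOn_swapOn, hS'', ← Finset.bot_eq_empty, bot_symmDiff]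
    have e3 : 2 * ∫ Z, I ∅ Z * (I (S k) Z - I (S (k + 1)) Z) ∂P ≤
        (1 / 2) * ∫ Z, (I ∅ Z - I {k} Z) ^ 2 ∂P +
          (1 / 2) * ∫ Z, (I (S k) Z - I (S (k + 1)) Z) ^ 2 ∂P := by
      rw [two_mul]
      nth_rewrite 2 [e1]
      have i3 : Integrable (fun Z => -(I {k} Z * (I (S k) Z - I (S (k + 1)) Z))) P := (i1 _).neg
      rw [← integral_add (i1 _) i3, ← integral_const_mul, ← integral_const_mul,
        ← integral_add ((i2 _ _).const_mul _) ((i2 _ _).const_mul _)]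
      refine integral_mono ((i1 _).add i3)
        (((i2 _ _).const_mul _).add ((i2 _ _).const_mul _)) fun Z => ?_
      simp only
      nlinarith [sq_nonneg ((I ∅ Z - I {k} Z) - (I (S k) Z - I (S (k + 1)) Z))]
    rw [e2] at e3
    linarith
  have htel : ∀ Z, ∑ k : Fin n, I ∅ Z * (I (S k) Z - I (S (k + 1)) Z) =
      I ∅ Z * I ∅ Z - I ∅ Z * I Finset.univ Z := by
    intro Z
    rw [← Finset.mul_sum, ← mul_sub]
    congr 1
    rw [Fin.sum_univ_eq_sum_range (fun k => I (S k) Z - I (S (k + 1)) Z), Finset.sum_range_sub']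
    congr 2
    · simp [S]
    · ext i
      simp [S]
  have hsq : ∫ Z, I ∅ Z * I ∅ Z ∂P = ∫ x, H x ^ 2 ∂(Measure.pi fun _ : Fin n => γ) := by
    have h := measurePreserving_selectOn γ (∅ : Finset (Fin n))
    rw [← hP] at h
    have h0 := hH.integrable_sq.1
    rw [← h.map_eq, integral_map h.aemeasurable (by rwa [h.map_eq])]
    simp_rw [sq]
    rfl
  rw [← hsq, ← integral_selectOn_empty_mul_selectOn_univ γ (H := H)]
  change ∫ Z, I ∅ Z * I ∅ Z ∂P - ∫ Z, I ∅ Z * I Finset.univ Z ∂P ≤ _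
  rw [← integral_sub (hmul _ _) (hmul _ _)]
  simp_rw [← htel]
  have i4 : ∀ k ∈ Finset.univ (α := Fin n),
      Integrable (fun Z => I ∅ Z * (I (S k) Z - I (S (k + 1)) Z)) P :=
    fun k _ => (hI ∅).integrable_mul ((hI _).sub (hI _))
  rw [integral_finsetSum _ i4]
  exact Finset.sum_le_sum fun k _ => step k

end EfronStein

/-! ### The Gaussian Poincaré inequality -/

section GaussianPoincare

open ProbabilityTheory

theorem hasDerivAt_gaussianPDFReal_zero_one (t : ℝ) :
    HasDerivAt (gaussianPDFReal 0 1) (-(t * gaussianPDFReal 0 1 t)) t := by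
  have h1 : HasDerivAt (fun x : ℝ => -(x - 0) ^ 2 / (2 * ((1 : NNReal) : ℝ))) (-t) t := by
    have := (((hasDerivAt_id t).sub_const 0).pow 2).neg.div_const (2 * ((1 : NNReal) : ℝ))
    convert! this using 1
    simp
    ring
  have h2 := (h1.exp.const_mul (√(2 * Real.pi * ((1 : NNReal) : ℝ)))⁻¹)
  refine h2.congr_deriv ?_
  rw [gaussianPDFReal]
  ring

theorem tendsto_gaussianPDFReal_zero_one_atTop :
    Filter.Tendsto (gaussianPDFReal 0 1) Filter.atTop (nhds 0) := by
  rw [gaussianPDFReal_def]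
  have h : Filter.Tendsto (fun x : ℝ => -(x - 0) ^ 2 / (2 * ((1 : NNReal) : ℝ))) Filter.atTop
      Filter.atBot := by
    have h1 : Filter.Tendsto (fun x : ℝ => x ^ 2 / 2) Filter.atTop Filter.atTop :=
      (Filter.tendsto_pow_atTop (by norm_num)).atTop_div_const (by norm_num)
    refine (Filter.tendsto_neg_atTop_atBot.comp h1).congr fun x => ?_
    simp
    ring
  simpa using! (Real.tendsto_exp_atBot.comp h).const_mul (√(2 * Real.pi * ((1 : NNReal) : ℝ)))⁻¹

/-- The negative of the Gaussian density is an antiderivative of `s` times the density. This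
identity is the source of the sharp constant `1`. -/
theorem lintegral_Ioi_mul_gaussianPDF {t : ℝ} (ht : 0 ≤ t) :
    ∫⁻ s in Ioi t, ENNReal.ofReal s * gaussianPDF 0 1 s = gaussianPDF 0 1 t := by
  have hd : ∀ x ∈ Ici t, HasDerivAt (fun s => -gaussianPDFReal 0 1 s)
      (x * gaussianPDFReal 0 1 x) x := fun x _ => by
    simpa using! (hasDerivAt_gaussianPDFReal_zero_one x).neg
  have hpos : ∀ x ∈ Ioi t, 0 ≤ x * gaussianPDFReal 0 1 x := fun x hx =>
    mul_nonneg (ht.trans (le_of_lt hx)) (gaussianPDFReal_nonneg _ _ _)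
  have hlim : Filter.Tendsto (fun s => -gaussianPDFReal 0 1 s) Filter.atTop (nhds 0) := by
    simpa using tendsto_gaussianPDFReal_zero_one_atTop.neg
  have h1 := integral_Ioi_of_hasDerivAt_of_nonneg' hd hpos hlim
  have h2 := integrableOn_Ioi_deriv_of_nonneg' hd hpos hlim
  rw [gaussianPDF, show gaussianPDFReal 0 1 t = ∫ x in Ioi t, x * gaussianPDFReal 0 1 x by
    rw [h1]; ring, ofReal_integral_eq_lintegral_ofReal h2
      ((ae_restrict_iff' measurableSet_Ioi).2 (ae_of_all _ hpos))]
  refine setLIntegral_congr_fun measurableSet_Ioi fun x hx => ?_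
  rw [gaussianPDF, ENNReal.ofReal_mul (ht.trans (le_of_lt hx))]

theorem enorm_sub_sq_le_mul_lintegral {h h' : ℝ → ℝ} (hd : ∀ t, HasDerivAt h (h' t) t)
    (hc : Continuous h') {s : ℝ} (hs : 0 ≤ s) :
    ‖h s - h 0‖ₑ ^ 2 ≤ ENNReal.ofReal s * ∫⁻ t in Ioc 0 s, ‖h' t‖ₑ ^ 2 := by
  rw [← intervalIntegral.integral_eq_sub_of_hasDerivAt (fun t _ => hd t)
    (hc.intervalIntegrable 0 s), intervalIntegral.integral_of_le hs]
  have h1 : ‖∫ t in Ioc 0 s, h' t‖ₑ ≤ eLpNorm h' 1 (volume.restrict (Ioc 0 s)) := by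
    rw [eLpNorm_one_eq_lintegral_enorm]
    exact enorm_integral_le_lintegral_enorm _
  have h2 := eLpNorm_le_eLpNorm_mul_rpow_measure_univ (p := 1) (q := 2)
    (μ := volume.restrict (Ioc 0 s)) (by norm_num) hc.aestronglyMeasurable
  calc _ ≤ (eLpNorm h' 2 (volume.restrict (Ioc 0 s)) *
        (volume.restrict (Ioc 0 s)) univ ^ (1 / (1 : ENNReal).toReal - 1 / (2 : ENNReal).toReal)) ^ 2 := by
        gcongr
        exact h1.trans h2
    _ = _ := by
      rw [eLpNorm_eq_lintegral_rpow_enorm_toReal (by norm_num) (by norm_num), mul_pow, mul_comm]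
      congr 1
      · simp only [MeasurableSet.univ, Measure.restrict_apply, univ_inter, Real.volume_Ioc, sub_zero]
        rw [← ENNReal.rpow_two, ← ENNReal.rpow_mul]
        norm_num
      · rw [← ENNReal.rpow_two, ← ENNReal.rpow_mul]
        norm_num

/-- Cauchy–Schwarz gives `|h(s) - h(0)|² ≤ s ∫₀ˢ |h'|²`. After exchanging the integrals, the weight
on `|h'(t)|²` is the integral of `s` times the density over `s > t`, which is the density at `t`. -/
theorem lintegral_Ioi_enorm_sub_sq_mul_gaussianPDF_le {h h' : ℝ → ℝ}
    (hd : ∀ t, HasDerivAt h (h' t) t) (hc : Continuous h') :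
    ∫⁻ s in Ioi 0, ‖h s - h 0‖ₑ ^ 2 * gaussianPDF 0 1 s ≤
      ∫⁻ s in Ioi 0, ‖h' s‖ₑ ^ 2 * gaussianPDF 0 1 s := by
  have hk : Measurable fun t => ‖h' t‖ₑ ^ 2 := hc.measurable.enorm.pow_const 2
  have hp : Measurable (gaussianPDF 0 1) := measurable_gaussianPDF 0 1
  calc _ ≤ ∫⁻ s in Ioi 0, ∫⁻ t in Ioi 0, (if t < s then ‖h' t‖ₑ ^ 2 else 0) *
        (ENNReal.ofReal s * gaussianPDF 0 1 s) := by
        refine setLIntegral_mono' measurableSet_Ioi fun s hs => ?_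
        have e : ∫⁻ t in Ioc 0 s, ‖h' t‖ₑ ^ 2 =
            ∫⁻ t in Ioi 0, (if t < s then ‖h' t‖ₑ ^ 2 else 0) := by
          rw [← restrict_Ioo_eq_restrict_Ioc, ← Ioi_inter_Iio, inter_comm,
            ← Measure.restrict_restrict measurableSet_Iio, ← lintegral_indicator measurableSet_Iio]
          rfl
        rw [lintegral_mul_const, ← e, mul_comm (∫⁻ t in Ioc 0 s, ‖h' t‖ₑ ^ 2), mul_right_comm]
        · gcongr
          exact enorm_sub_sq_le_mul_lintegral hd hc (le_of_lt hs)
        · exact Measurable.ite measurableSet_Iio hk measurable_const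
    _ = ∫⁻ t in Ioi 0, ∫⁻ s in Ioi 0, (if t < s then ‖h' t‖ₑ ^ 2 else 0) *
        (ENNReal.ofReal s * gaussianPDF 0 1 s) := by
        refine lintegral_lintegral_swap (Measurable.aemeasurable ?_)
        refine Measurable.mul (Measurable.ite (measurableSet_lt measurable_snd measurable_fst)
          (hk.comp measurable_snd) measurable_const) ?_
        exact (ENNReal.measurable_ofReal.comp measurable_fst).mul (hp.comp measurable_fst)
    _ = _ := by
        refine setLIntegral_congr_fun measurableSet_Ioi fun t ht => ?_
        have ht0 : (0 : ℝ) ≤ t := le_of_lt ht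
        rw [← lintegral_Ioi_mul_gaussianPDF ht0, ← lintegral_const_mul]
        · rw [← lintegral_indicator measurableSet_Ioi, ← lintegral_indicator measurableSet_Ioi]
          refine lintegral_congr fun s => ?_
          by_cases hts : t < s
          · simp [hts, lt_of_le_of_lt ht0 hts]
          · simp [hts]
        · exact ENNReal.measurable_ofReal.mul hp

theorem lintegral_gaussianReal_eq_Ioi_add (g : ℝ → ENNReal) (hg : Measurable g) :
    ∫⁻ s, g s ∂(gaussianReal 0 1) = (∫⁻ s in Ioi 0, g s * gaussianPDF 0 1 s) +
      ∫⁻ s in Ioi 0, g (-s) * gaussianPDF 0 1 s := by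
  have hp : Measurable (gaussianPDF 0 1) := measurable_gaussianPDF 0 1
  rw [gaussianReal_of_var_ne_zero 0 one_ne_zero,
    lintegral_withDensity_eq_lintegral_mul _ hp hg,
    ← lintegral_add_compl _ (measurableSet_Ioi (a := (0 : ℝ)))]
  congr 1
  · simp_rw [Pi.mul_apply, mul_comm]
  · rw [compl_Ioi, ← restrict_Iio_eq_restrict_Iic]
    have h1 : MeasurePreserving (fun x : ℝ => -x) volume volume := Measure.measurePreserving_neg _
    rw [← h1.setLIntegral_comp_preimage measurableSet_Iio (hp.mul hg)]
    have h2 : (fun x : ℝ => -x) ⁻¹' Iio 0 = Ioi 0 := by ext; simp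
    rw [h2]
    refine setLIntegral_congr_fun measurableSet_Ioi fun x _ => ?_
    simp only [Pi.mul_apply, gaussianPDF, gaussianPDFReal, sub_zero, neg_sq]
    rw [mul_comm]

theorem MemLp.lintegral_enorm_sq {β : Type*} [MeasurableSpace β] {m : Measure β} {g : β → ℝ}
    (hg : MemLp g 2 m) : ∫⁻ x, ‖g x‖ₑ ^ 2 ∂m = ENNReal.ofReal (∫ x, g x ^ 2 ∂m) := by
  rw [ofReal_integral_eq_lintegral_ofReal hg.integrable_sq (ae_of_all _ fun _ => sq_nonneg _)]
  refine lintegral_congr fun s => ?_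
  rw [← enorm_pow, Real.enorm_of_nonneg (sq_nonneg _)]

/-- Chen's form of the one-dimensional Gaussian Poincaré inequality. -/
theorem lintegral_enorm_sub_sq_gaussianReal_le {h h' : ℝ → ℝ}
    (hd : ∀ t, HasDerivAt h (h' t) t) (hc : Continuous h') :
    ∫⁻ s, ‖h s - h 0‖ₑ ^ 2 ∂(gaussianReal 0 1) ≤ ∫⁻ s, ‖h' s‖ₑ ^ 2 ∂(gaussianReal 0 1) := by
  have hcont : Continuous h := continuous_iff_continuousAt.2 fun t => (hd t).continuousAt
  rw [lintegral_gaussianReal_eq_Ioi_add _ (by fun_prop), lintegral_gaussianReal_eq_Ioi_add _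
    (by fun_prop)]
  refine add_le_add (lintegral_Ioi_enorm_sub_sq_mul_gaussianPDF_le hd hc) ?_
  have hd2 : ∀ t, HasDerivAt (fun s => h (-s)) (-h' (-t)) t := fun t => by
    simpa using! (hd (-t)).comp t (hasDerivAt_neg t)
  simpa using lintegral_Ioi_enorm_sub_sq_mul_gaussianPDF_le hd2 (hc.comp continuous_neg).neg

/-- The one-dimensional Gaussian Poincaré inequality, in terms of two independent copies. -/
theorem lintegral_lintegral_enorm_sub_sq_gaussianReal_le {h h' : ℝ → ℝ}
    (hd : ∀ t, HasDerivAt h (h' t) t) (hc : Continuous h') :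
    ∫⁻ s, ∫⁻ t, ‖h s - h t‖ₑ ^ 2 ∂(gaussianReal 0 1) ∂(gaussianReal 0 1) ≤
      2 * ∫⁻ s, ‖h' s‖ₑ ^ 2 ∂(gaussianReal 0 1) := by
  set γ := gaussianReal 0 1
  have hcont : Continuous h := continuous_iff_continuousAt.2 fun t => (hd t).continuousAt
  have hle := lintegral_enorm_sub_sq_gaussianReal_le hd hc
  -- An infinite right side is trivial; otherwise Chen's bound puts `h - h 0` in `L²`, so the
  -- squares can be expanded.
  rcases eq_or_ne (∫⁻ s, ‖h' s‖ₑ ^ 2 ∂γ) ⊤ with htop | htop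
  · rw [htop]; simp
  let u : ℝ → ℝ := fun s => h s - h 0
  have hu : Continuous u := hcont.sub continuous_const
  have hu2 : MemLp u 2 γ := by
    refine ⟨hu.aestronglyMeasurable, ?_⟩
    rw [eLpNorm_lt_top_iff_lintegral_rpow_enorm_lt_top (by norm_num) (by norm_num)]
    simpa using (hle.trans_lt htop.lt_top)
  have e1 : ∀ s t, ‖h s - h t‖ₑ ^ 2 = ENNReal.ofReal ((u s - u t) ^ 2) := fun s t => by
    rw [← enorm_pow, Real.enorm_of_nonneg (sq_nonneg _)]
    simp [u]
  have e2 : ∫⁻ s, ‖h s - h 0‖ₑ ^ 2 ∂γ = ENNReal.ofReal (∫ s, u s ^ 2 ∂γ) :=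
    MemLp.lintegral_enorm_sq hu2
  rw [e2] at hle
  simp_rw [e1]
  refine le_trans ?_ (mul_le_mul_right hle 2)
  have i1 : Integrable (fun p : ℝ × ℝ => u p.1 ^ 2) (γ.prod γ) := hu2.integrable_sq.comp_fst γ
  have i2 : Integrable (fun p : ℝ × ℝ => u p.2 ^ 2) (γ.prod γ) := hu2.integrable_sq.comp_snd γ
  have i3 : Integrable (fun p : ℝ × ℝ => u p.1 * u p.2) (γ.prod γ) :=
    (hu2.integrable (by norm_num)).mul_prod (hu2.integrable (by norm_num))
  have i4 : Integrable (fun p : ℝ × ℝ => (u p.1 - u p.2) ^ 2) (γ.prod γ) := by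
    refine ((i1.add i2).sub (i3.const_mul 2)).congr (ae_of_all _ fun p => ?_)
    simp only [Pi.add_apply, Pi.sub_apply]
    ring
  have i5 : Integrable (fun p : ℝ × ℝ => u p.1 ^ 2 + u p.2 ^ 2) (γ.prod γ) := i1.add i2
  rw [← lintegral_prod (fun p : ℝ × ℝ => ENNReal.ofReal ((u p.1 - u p.2) ^ 2)) (by fun_prop),
    ← ofReal_integral_eq_lintegral_ofReal i4 (ae_of_all _ fun _ => sq_nonneg _),
    show (2 : ENNReal) = ENNReal.ofReal 2 by simp, ← ENNReal.ofReal_mul (by norm_num)]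
  refine ENNReal.ofReal_le_ofReal ?_
  -- Twice the variance of `u`, hence at most twice its second moment.
  have e3 : ∫ p, (u p.1 - u p.2) ^ 2 ∂(γ.prod γ) =
      2 * ∫ s, u s ^ 2 ∂γ - 2 * (∫ s, u s ∂γ) ^ 2 := by
    have : ∀ p : ℝ × ℝ, (u p.1 - u p.2) ^ 2 = (u p.1 ^ 2 + u p.2 ^ 2) - 2 * (u p.1 * u p.2) :=
      fun p => by ring
    simp_rw [this]
    rw [integral_sub i5 (i3.const_mul 2), integral_add i1 i2, integral_const_mul,
      integral_prod_mul, integral_fun_fst (fun s => u s ^ 2), integral_fun_snd (fun s => u s ^ 2)]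
    simp
    ring
  rw [e3]
  nlinarith [sq_nonneg (∫ s, u s ∂γ)]

/-- The Gaussian Poincaré inequality in `ℝⁿ`. -/
theorem variance_pi_gaussianReal_le {n : ℕ} {H : (Fin n → ℝ) → ℝ} {D : Fin n → (Fin n → ℝ) → ℝ}
    (hHm : Measurable H) (hH : MemLp H 2 (Measure.pi fun _ : Fin n => gaussianReal 0 1))
    (hD : ∀ k, Measurable (D k))
    (hD2 : ∀ k, MemLp (D k) 2 (Measure.pi fun _ : Fin n => gaussianReal 0 1))
    (hd : ∀ k, ∀ᵐ x ∂(Measure.pi fun _ : Fin n => gaussianReal 0 1),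
      (∀ t, HasDerivAt (fun t => H (Function.update x k t)) (D k (Function.update x k t)) t) ∧
        Continuous fun t => D k (Function.update x k t)) :
    ∫ x, H x ^ 2 ∂(Measure.pi fun _ : Fin n => gaussianReal 0 1) -
        (∫ x, H x ∂(Measure.pi fun _ : Fin n => gaussianReal 0 1)) ^ 2 ≤
      ∑ k, ∫ x, D k x ^ 2 ∂(Measure.pi fun _ : Fin n => gaussianReal 0 1) := by
  refine (variance_pi_le_sum (gaussianReal 0 1) hH).trans (Finset.sum_le_sum fun k _ => ?_)
  set γ := gaussianReal 0 1
  have hms : ∀ S : Finset (Fin n), Measurable (selectOn (α := ℝ) S) := fun S =>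
    (measurePreserving_selectOn γ S).measurable
  have hmu : Measurable fun p : (Fin n → ℝ) × ℝ => Function.update p.1 k p.2 := by
    rw [measurable_pi_iff]
    intro i
    by_cases hi : i = k
    · subst hi; simpa using measurable_snd
    · simpa [Function.update_of_ne hi] using! (measurable_pi_apply i).comp measurable_fst
  have hmd : Measurable fun p : (Fin n → ℝ) × (Fin n → ℝ) => ‖H p.1 - H p.2‖ₑ ^ 2 :=
    (((hHm.comp measurable_fst).sub (hHm.comp measurable_snd)).enorm.pow_const 2)
  have key : ∫⁻ Z, ‖H (selectOn ∅ Z) - H (selectOn {k} Z)‖ₑ ^ 2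
      ∂(Measure.pi fun _ : Fin n => γ.prod γ) ≤
      2 * ∫⁻ x, ‖D k x‖ₑ ^ 2 ∂(Measure.pi fun _ : Fin n => γ) := by
    rw [lintegral_selectOn_singleton γ k (A := fun x y => ‖H x - H y‖ₑ ^ 2) hmd]
    -- Resampling coordinate `k` on both sides reduces the claim to the one-dimensional inequality
    -- on almost every line parallel to the `k`-th axis. Exceptional lines are allowed, so `H` may
    -- be singular at the origin. The factor `2` cancels the `1/2` of Efron–Stein.
    rw [lintegral_pi_eq_lintegral_update γ k, lintegral_pi_eq_lintegral_update γ k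
      ((hD k).enorm.pow_const 2), ← lintegral_const_mul']
    · refine lintegral_mono_ae ?_
      filter_upwards [hd k] with x hx
      simp only [Function.update_idem]
      exact lintegral_lintegral_enorm_sub_sq_gaussianReal_le hx.1 hx.2
    · simp
    · have h1 : Measurable fun p : (Fin n → ℝ) × ℝ => H p.1 - H (Function.update p.1 k p.2) :=
        (hHm.comp measurable_fst).sub (hHm.comp hmu)
      have h2 : Measurable fun p : (Fin n → ℝ) × ℝ =>
        ‖H p.1 - H (Function.update p.1 k p.2)‖ₑ ^ 2 := h1.enorm.pow_const 2
      exact h2.lintegral_prod_right'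
  have hI : ∀ S, MemLp (fun Z => H (selectOn S Z)) 2 (Measure.pi fun _ : Fin n => γ.prod γ) :=
    fun S => MemLp.comp_measurePreserving hH (measurePreserving_selectOn γ S)
  have h1 := (hI ∅).sub (hI {k})
  have e1 := MemLp.lintegral_enorm_sq h1
  simp only [Pi.sub_apply] at e1
  rw [e1, MemLp.lintegral_enorm_sq (hD2 k), show (2 : ENNReal) = ENNReal.ofReal 2 by simp,
    ← ENNReal.ofReal_mul (by norm_num), ENNReal.ofReal_le_ofReal_iff (by positivity)] at key
  linarith

end GaussianPoincare

/-! ### Polar coordinates and radial measures -/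

section Polar

variable {E : Type*} [NormedAddCommGroup E] [InnerProductSpace ℝ E] [MeasureSpace E] [BorelSpace E]

variable (E) in
/-- The uniform probability measure on the unit sphere, as a measure on the ambient space. -/
noncomputable def uniformOnSphere : Measure E :=
  (((volume : Measure E).toSphere univ)⁻¹ • (volume : Measure E).toSphere).map Subtype.val

theorem ae_uniformOnSphere_norm_eq_one : ∀ᵐ θ ∂(uniformOnSphere E), ‖θ‖ = 1 := by
  rw [uniformOnSphere, ae_map_iff measurable_subtype_coe.aemeasurable
    (measurableSet_eq_fun measurable_norm measurable_const)]
  exact ae_of_all _ fun θ => by simp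

variable [FiniteDimensional ℝ E] [(volume : Measure E).IsAddHaarMeasure]

instance [Nontrivial E] : IsProbabilityMeasure (uniformOnSphere E) := by
  have h0 : (volume : Measure E).toSphere univ ≠ 0 := by
    simp only [ne_eq, Measure.measure_univ_eq_zero]
    exact Measure.toSphere_ne_zero _
  have : IsProbabilityMeasure
      (((volume : Measure E).toSphere univ)⁻¹ • (volume : Measure E).toSphere) :=
    ⟨by simpa using ENNReal.inv_mul_cancel h0 (measure_ne_top _ _)⟩
  exact Measure.isProbabilityMeasure_map measurable_subtype_coe.aemeasurable

/-- The origin is null, and off it Lebesgue measure is the surface measure times `r ^ (dim - 1) dr`.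
The surface measure is normalized here, whence its total mass in front. -/
theorem lintegral_eq_lintegral_polar [Nontrivial E] {g : E → ENNReal} (hg : Measurable g) :
    ∫⁻ x, g x = (volume : Measure E).toSphere univ *
      ∫⁻ θ, (∫⁻ r in Ioi (0 : ℝ), ENNReal.ofReal (r ^ (Module.finrank ℝ E - 1)) * g (r • θ))
        ∂(uniformOnSphere E) := by
  have h0 : (volume : Measure E).toSphere univ ≠ 0 := by
    simp only [ne_eq, Measure.measure_univ_eq_zero]
    exact Measure.toSphere_ne_zero _
  have hmp := (volume : Measure E).measurePreserving_homeomorphUnitSphereProd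
  have hm : Measurable fun p : Metric.sphere (0 : E) 1 × Ioi (0 : ℝ) => g (p.2.1 • p.1.1) :=
    hg.comp (by fun_prop)
  have hm2 : Measurable fun θ : E => ∫⁻ r in Ioi (0 : ℝ),
      ENNReal.ofReal (r ^ (Module.finrank ℝ E - 1)) * g (r • θ) := by
    refine Measurable.lintegral_prod_right' (f := fun p : E × ℝ =>
      ENNReal.ofReal (p.2 ^ (Module.finrank ℝ E - 1)) * g (p.2 • p.1)) ?_
    exact (by fun_prop : Measurable fun p : E × ℝ =>
      ENNReal.ofReal (p.2 ^ (Module.finrank ℝ E - 1))).mul (hg.comp (by fun_prop))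
  rw [uniformOnSphere, lintegral_map hm2 measurable_subtype_coe, lintegral_smul_measure, smul_eq_mul,
    ← mul_assoc, ENNReal.mul_inv_cancel h0 (measure_ne_top _ _), one_mul]
  calc ∫⁻ x, g x = ∫⁻ x in {0}ᶜ, g x := by rw [restrict_compl_singleton]
    _ = ∫⁻ x : ({0}ᶜ : Set E), g x ∂(volume.comap Subtype.val) :=
      (lintegral_subtype_comap (measurableSet_singleton _).compl g).symm
    _ = ∫⁻ p, g (p.2.1 • p.1.1) ∂((volume : Measure E).toSphere.prod
          (Measure.volumeIoiPow (Module.finrank ℝ E - 1))) := by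
        rw [← hmp.lintegral_comp hm]
        refine lintegral_congr fun x => ?_
        have := congrArg Subtype.val ((homeomorphUnitSphereProd E).symm_apply_apply x)
        rw [homeomorphUnitSphereProd_symm_apply_coe] at this
        rw [this]
    _ = _ := by
        rw [lintegral_prod _ hm.aemeasurable]
        refine lintegral_congr fun θ => ?_
        have hgm : Measurable fun r : Ioi (0 : ℝ) => g (r.1 • θ.1) := hg.comp (by fun_prop)
        rw [Measure.volumeIoiPow, lintegral_withDensity_eq_lintegral_mul _ (by fun_prop) hgm]
        exact lintegral_subtype_comap measurableSet_Ioi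
          (fun r : ℝ => ENNReal.ofReal (r ^ (Module.finrank ℝ E - 1)) * g (r • θ.1))

theorem lintegral_radial_eq_lintegral_polar [Nontrivial E] {q : ℝ → ℝ} (hq : Measurable q)
    {c c' : ℝ} (hc : 0 < c) (hc' : 0 < c') {g : E → ENNReal} (hg : Measurable g) :
    ∫⁻ x, g x ∂(volume.withDensity fun x : E => ENNReal.ofReal (c * q ‖x‖)) =
      (volume : Measure E).toSphere univ * ENNReal.ofReal (c / c') *
      ∫⁻ θ, ∫⁻ r, g (r • θ) ∂((volume.restrict (Ioi 0)).withDensity fun r : ℝ =>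
        ENNReal.ofReal (c' * (r ^ (Module.finrank ℝ E - 1) * q r))) ∂(uniformOnSphere E) := by
  have hd : Measurable fun x : E => ENNReal.ofReal (c * q ‖x‖) :=
    ((hq.comp measurable_norm).const_mul c).ennreal_ofReal
  have hd' : Measurable fun r : ℝ =>
      ENNReal.ofReal (c' * (r ^ (Module.finrank ℝ E - 1) * q r)) :=
    (((measurable_id.pow_const _).mul hq).const_mul c').ennreal_ofReal
  rw [lintegral_withDensity_eq_lintegral_mul _ hd hg, lintegral_eq_lintegral_polar (hd.mul hg),
    mul_assoc]
  congr 1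
  rw [← lintegral_const_mul' _ _ (by simp)]
  refine lintegral_congr_ae ?_
  filter_upwards [ae_uniformOnSphere_norm_eq_one] with θ hθ
  have hgm : Measurable fun r : ℝ => g (r • θ) := hg.comp (by fun_prop)
  rw [lintegral_withDensity_eq_lintegral_mul _ hd' hgm,
    ← lintegral_const_mul' _ _ (by simp)]
  refine setLIntegral_congr_fun measurableSet_Ioi fun r hr => ?_
  have hr0 : (0 : ℝ) < r := hr
  simp only [Pi.mul_apply, norm_smul, hθ, mul_one, Real.norm_eq_abs, abs_of_pos hr0]
  rw [← mul_assoc, ← mul_assoc, ← ENNReal.ofReal_mul (by positivity),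
    ← ENNReal.ofReal_mul (by positivity)]
  congr 2
  field_simp

/-- In polar coordinates a radial density is a product, up to a constant. That constant is `1`
because both measures are probabilities, so no normalization has to be computed. -/
theorem map_smul_uniformOnSphere_prod [Nontrivial E] {q : ℝ → ℝ} (hq : Measurable q)
    {μ : Measure E} [IsProbabilityMeasure μ] {ν : Measure ℝ} [IsProbabilityMeasure ν]
    (hμ : HasDensityProportionalTo μ volume fun x => q ‖x‖)
    (hν : HasDensityProportionalTo ν (volume.restrict (Ioi 0))
      fun r => r ^ (Module.finrank ℝ E - 1) * q r) :
    ((uniformOnSphere E).prod ν).map (fun p => p.2 • p.1) = μ := by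
  obtain ⟨c, hc, hμ⟩ := hμ
  obtain ⟨c', hc', hν⟩ := hν
  have h := fun (g : E → ENNReal) (hg : Measurable g) =>
    lintegral_radial_eq_lintegral_polar hq hc hc' hg
  rw [← hμ, ← hν] at h
  have h1 : (volume : Measure E).toSphere univ * ENNReal.ofReal (c / c') = 1 := by
    have := h 1 measurable_one
    simpa using this.symm
  have hm : Measurable fun p : E × ℝ => p.2 • p.1 := by fun_prop
  refine Measure.ext fun s hs => ?_
  have h2 := h (s.indicator 1) (measurable_one.indicator hs)
  rw [h1, one_mul, lintegral_indicator_one hs] at h2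
  rw [h2, ← lintegral_indicator_one hs, lintegral_map (measurable_one.indicator hs) hm,
    lintegral_prod]
  exact ((measurable_one.indicator hs).comp hm).aemeasurable

/-- Supplies the law of the radius for the standard Gaussian. The normalizing constant is that of
`μ` times the area of the sphere. -/
theorem exists_radial_part [Nontrivial E] {q : ℝ → ℝ} (hq : Measurable q)
    {μ : Measure E} [IsProbabilityMeasure μ]
    (hμ : HasDensityProportionalTo μ volume fun x => q ‖x‖) :
    ∃ ν : Measure ℝ, IsProbabilityMeasure ν ∧ HasDensityProportionalTo ν (volume.restrict (Ioi 0))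
      fun r => r ^ (Module.finrank ℝ E - 1) * q r := by
  obtain ⟨c, hc, hμ⟩ := hμ
  have h0 : (volume : Measure E).toSphere univ ≠ 0 := by
    simp only [ne_eq, Measure.measure_univ_eq_zero]
    exact Measure.toSphere_ne_zero _
  have hS : 0 < ((volume : Measure E).toSphere univ).toReal :=
    ENNReal.toReal_pos h0 (measure_ne_top _ _)
  have hc' : 0 < ((volume : Measure E).toSphere univ).toReal * c := by positivity
  refine ⟨_, ⟨?_⟩, _, hc', rfl⟩
  have h := lintegral_radial_eq_lintegral_polar (E := E) hq hc hc' measurable_one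
  rw [← hμ, div_mul_cancel_right₀ hc.ne', ENNReal.ofReal_inv_of_pos hS,
    ENNReal.ofReal_toReal (measure_ne_top _ _), ENNReal.mul_inv_cancel h0 (measure_ne_top _ _)] at h
  simpa using h.symm

end Polar

/-! ### The standard Gaussian as a radial measure -/

section StandardGaussian

open ProbabilityTheory

theorem pi_gaussianReal_eq_withDensity (n : ℕ) :
    Measure.pi (fun _ : Fin n => gaussianReal 0 1) =
      volume.withDensity fun x => ENNReal.ofReal (∏ i, gaussianPDFReal 0 1 (x i)) := by
  refine Measure.pi_eq fun s hs => ?_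
  have hint : Integrable (fun x : Fin n → ℝ => ∏ i, gaussianPDFReal 0 1 (x i))
      (Measure.pi fun i => volume.restrict (s i)) :=
    Integrable.fintype_prod fun i => (integrable_gaussianPDFReal 0 1).restrict
  rw [withDensity_apply _ (MeasurableSet.univ_pi hs), volume_pi, Measure.restrict_pi_pi,
    ← ofReal_integral_eq_lintegral_ofReal hint
      (ae_of_all _ fun x => Finset.prod_nonneg fun i _ => gaussianPDFReal_nonneg _ _ _),
    integral_fintype_prod_eq_prod (fun _ => gaussianPDFReal 0 1), ENNReal.ofReal_prod_of_nonneg]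
  · exact Finset.prod_congr rfl fun i _ => (gaussianReal_apply_eq_integral 0 one_ne_zero _).symm
  · exact fun i _ => integral_nonneg fun x => gaussianPDFReal_nonneg _ _ _

/-- The standard Gaussian measure on `ℝⁿ` has a radial density. -/
theorem hasDensityProportionalTo_map_pi_gaussianReal (n : ℕ) :
    HasDensityProportionalTo
      ((Measure.pi fun _ : Fin n => gaussianReal 0 1).map (WithLp.toLp 2))
      (volume : Measure (EuclideanSpace ℝ (Fin n))) (fun x => Real.exp (-(‖x‖ ^ 2 / 2))) := by
  refine ⟨((√(2 * Real.pi))⁻¹) ^ n, by positivity, ?_⟩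
  have hmp : MeasurePreserving (MeasurableEquiv.toLp 2 (Fin n → ℝ)) volume volume :=
    PiLp.volume_preserving_toLp (Fin n)
  refine Measure.ext fun s hs => ?_
  have hm : Measurable (WithLp.toLp 2 : (Fin n → ℝ) → EuclideanSpace ℝ (Fin n)) :=
    (MeasurableEquiv.toLp 2 (Fin n → ℝ)).measurable
  rw [Measure.map_apply hm hs, pi_gaussianReal_eq_withDensity, withDensity_apply _ (hm hs),
    withDensity_apply _ hs, ← hmp.setLIntegral_comp_preimage hs (by fun_prop)]
  refine lintegral_congr fun x => ?_
  congr 1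
  simp only [gaussianPDFReal, Finset.prod_mul_distrib, ← Real.exp_sum]
  simp [EuclideanSpace.norm_sq_eq, Finset.sum_div, neg_div]

end StandardGaussian

/-! ### The Poincaré inequality on the sphere -/

section SpherePoincare

open ProbabilityTheory

theorem integral_eq_integral_prod_of_map_smul {E F : Type*} [NormedAddCommGroup E]
    [NormedSpace ℝ E] [MeasurableSpace E] [BorelSpace E] [SecondCountableTopology E]
    [NormedAddCommGroup F] [NormedSpace ℝ F]
    {σ μ : Measure E} {ν : Measure ℝ} (h : (σ.prod ν).map (fun p => p.2 • p.1) = μ) {g : E → F}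
    (hg : AEStronglyMeasurable g μ) :
    ∫ x, g x ∂μ = ∫ p, g (p.2 • p.1) ∂(σ.prod ν) := by
  subst h
  exact integral_map (by fun_prop) hg

theorem integral_norm_sq_map_pi_gaussianReal (n : ℕ) :
    ∫ x, ‖x‖ ^ 2 ∂((Measure.pi fun _ : Fin n => gaussianReal 0 1).map
      (WithLp.toLp 2 : (Fin n → ℝ) → EuclideanSpace ℝ (Fin n))) = n := by
  have hm : Measurable (WithLp.toLp 2 : (Fin n → ℝ) → EuclideanSpace ℝ (Fin n)) :=
    (MeasurableEquiv.toLp 2 (Fin n → ℝ)).measurable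
  have hint : Integrable (fun t : ℝ => t ^ 2) (gaussianReal 0 1) :=
    (memLp_id_gaussianReal 2).integrable_sq
  have hv : ∫ t, t ^ 2 ∂(gaussianReal 0 1) = 1 := by
    have := variance_id_gaussianReal (μ := 0) (v := 1)
    rw [variance_of_integral_eq_zero aemeasurable_id (by simp)] at this
    simpa using this
  have he : ∀ i : Fin n, Integrable (fun x : Fin n → ℝ => x i ^ 2)
      (Measure.pi fun _ : Fin n => gaussianReal 0 1) := fun i =>
    (measurePreserving_eval (fun _ : Fin n => gaussianReal 0 1) i).integrable_comp_of_integrable hint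
  rw [integral_map hm.aemeasurable (by fun_prop)]
  simp_rw [EuclideanSpace.norm_sq_eq, Real.norm_eq_abs, sq_abs]
  rw [integral_finsetSum _ fun i _ => he i]
  have : ∀ i : Fin n, ∫ x : Fin n → ℝ, x i ^ 2 ∂(Measure.pi fun _ : Fin n => gaussianReal 0 1) = 1 := by
    intro i
    have h := measurePreserving_eval (fun _ : Fin n => gaussianReal 0 1) i
    have h2 := integral_map h.aemeasurable (f := fun t : ℝ => t ^ 2) (by fun_prop)
    rw [h.map_eq, hv] at h2
    exact h2.symm
  simp [this]

/-- As `n ≥ 2`, some coordinate other than `k` exists and is almost surely nonzero, so the line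
parallel to the `k`-th axis misses the origin. -/
theorem ae_pi_gaussianReal_update_ne_zero {n : ℕ} (hn : 2 ≤ n) (k : Fin n) :
    ∀ᵐ x ∂(Measure.pi fun _ : Fin n => gaussianReal 0 1),
      ∀ t, WithLp.toLp 2 (Function.update x k t) ≠ 0 := by
  obtain ⟨j, hj⟩ : ∃ j : Fin n, j ≠ k := by
    have : Nontrivial (Fin n) := Fin.nontrivial_iff_two_le.2 hn
    exact exists_ne k
  have h0 : ∀ᵐ t ∂(gaussianReal 0 1), t ≠ 0 := by
    have := nullSingletonClass_gaussianReal (μ := 0) (v := 1) one_ne_zero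
    rw [ae_iff]
    simp
  have h := measurePreserving_eval (fun _ : Fin n => gaussianReal 0 1) j
  filter_upwards [h.quasiMeasurePreserving.ae h0] with x hx t h1
  have := congrArg (fun y : EuclideanSpace ℝ (Fin n) => y j) h1
  simp [Function.update_of_ne hj] at this
  exact hx this

section Homogeneous

variable {E : Type*} [NormedAddCommGroup E] [InnerProductSpace ℝ E] [CompleteSpace E]
  {Φ : E → ℝ} {Ψ : E → E}

/-- Differentiate `Φ (t • x) = Φ x` in `x`: the gradient is homogeneous of degree `-1`, hence `‖x‖ •
Ψ x` is controlled by the values of `Ψ` on the sphere. -/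
theorem smul_gradient_smul_of_homogeneous (hΦ : ∀ x ≠ 0, HasGradientAt Φ (Ψ x) x)
    (hhom : ∀ x, ∀ t : ℝ, 0 < t → Φ (t • x) = Φ x) {x : E} (hx : x ≠ 0) {t : ℝ} (ht : 0 < t) :
    t • Ψ (t • x) = Ψ x := by
  have h1 : HasGradientAt Φ (Ψ (t • x)) (t • x) := hΦ _ (smul_ne_zero ht.ne' hx)
  have h2 : HasFDerivAt (fun y : E => t • y) (t • ContinuousLinearMap.id ℝ E) x :=
    (hasFDerivAt_id x).const_smul t
  have h3 := h1.hasFDerivAt.comp x h2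
  have h4 : (Φ ∘ fun y : E => t • y) = Φ := funext fun y => hhom y t ht
  rw [h4] at h3
  have h5 := h3.unique (hΦ x hx).hasFDerivAt
  refine ext_inner_right ℝ fun v => ?_
  have h6 := congrArg (fun L : E →L[ℝ] ℝ => L v) h5
  simpa [inner_smul_left, inner_smul_right] using h6

/-- Euler's identity in degree zero: differentiate `Φ (t • x) = Φ x` at `t = 1`. -/
theorem inner_gradient_self_of_homogeneous (hΦ : ∀ x ≠ 0, HasGradientAt Φ (Ψ x) x)
    (hhom : ∀ x, ∀ t : ℝ, 0 < t → Φ (t • x) = Φ x) {x : E} (hx : x ≠ 0) :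
    inner ℝ (Ψ x) x = 0 := by
  have h1 : HasFDerivAt Φ (InnerProductSpace.toDual ℝ E (Ψ x)) ((1 : ℝ) • x) := by
    rw [one_smul]; exact (hΦ x hx).hasFDerivAt
  have h2 : HasDerivAt (fun t : ℝ => t • x) x 1 := by
    simpa using (hasDerivAt_id (1 : ℝ)).smul_const x
  have h3 := h1.comp_hasDerivAt 1 h2
  have h4 : (Φ ∘ fun t : ℝ => t • x) =ᶠ[nhds 1] fun _ => Φ x := by
    filter_upwards [lt_mem_nhds (zero_lt_one' ℝ)] with t ht using hhom x t ht
  have h5 := (h3.congr_of_eventuallyEq h4.symm).unique (hasDerivAt_const 1 (Φ x))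
  simpa using h5

theorem hasGradientAt_norm {x : E} (hx : x ≠ 0) :
    HasGradientAt (fun y : E => ‖y‖) (‖x‖⁻¹ • x) x := by
  have h1 := (hasStrictFDerivAt_norm_sq x).hasFDerivAt.sqrt (by simpa using hx)
  have h2 : (fun y : E => √(‖y‖ ^ 2)) = fun y => ‖y‖ := by
    ext y; exact Real.sqrt_sq (norm_nonneg y)
  rw [h2, Real.sqrt_sq (norm_nonneg x)] at h1
  rw [hasGradientAt_iff_hasFDerivAt]
  refine h1.congr_fderiv ?_
  ext v
  simp
  ring

end Homogeneous

theorem HasDensityProportionalTo.ae_pos {ν : Measure ℝ} {q : ℝ → ℝ}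
    (hν : HasDensityProportionalTo ν (volume.restrict (Ioi 0)) q) : ∀ᵐ r ∂ν, 0 < r := by
  obtain ⟨c, -, rfl⟩ := hν
  exact (withDensity_absolutelyContinuous _ _).ae_le (ae_restrict_mem measurableSet_Ioi)

/-- The Poincaré inequality on the sphere, for functions that are homogeneous of degree zero. -/
theorem sphere_poincare {n : ℕ} (hn : 2 ≤ n) {Φ : EuclideanSpace ℝ (Fin n) → ℝ}
    {Ψ : EuclideanSpace ℝ (Fin n) → EuclideanSpace ℝ (Fin n)}
    (hΦ : ∀ x ≠ 0, HasGradientAt Φ (Ψ x) x) (hΨ : ContinuousOn Ψ {0}ᶜ)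
    (hhom : ∀ x, ∀ t : ℝ, 0 < t → Φ (t • x) = Φ x) :
    ((n : ℝ) - 1) * (∫ θ, Φ θ ^ 2 ∂(uniformOnSphere (EuclideanSpace ℝ (Fin n))) -
        (∫ θ, Φ θ ∂(uniformOnSphere (EuclideanSpace ℝ (Fin n)))) ^ 2) ≤
      ∫ θ, ‖Ψ θ‖ ^ 2 ∂(uniformOnSphere (EuclideanSpace ℝ (Fin n))) := by
  have : Nontrivial (Fin n) := Fin.nontrivial_iff_two_le.2 hn
  set σ := uniformOnSphere (EuclideanSpace ℝ (Fin n)) with hσ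
  set G := Measure.pi fun _ : Fin n => gaussianReal 0 1 with hG
  have htm : Measurable (WithLp.toLp 2 : (Fin n → ℝ) → EuclideanSpace ℝ (Fin n)) :=
    (MeasurableEquiv.toLp 2 (Fin n → ℝ)).measurable
  have hprob : IsProbabilityMeasure
      (G.map (WithLp.toLp 2 : (Fin n → ℝ) → EuclideanSpace ℝ (Fin n))) :=
    Measure.isProbabilityMeasure_map htm.aemeasurable
  have hq : Measurable fun r : ℝ => Real.exp (-(r ^ 2 / 2)) := by fun_prop
  obtain ⟨ν, hνp, hν⟩ := exists_radial_part hq (hasDensityProportionalTo_map_pi_gaussianReal n)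
  have hpol := map_smul_uniformOnSphere_prod hq (hasDensityProportionalTo_map_pi_gaussianReal n) hν
  rw [← hσ, ← hG] at hpol
  have hcΦ : ContinuousOn Φ {0}ᶜ := fun x hx => (hΦ x hx).continuousAt.continuousWithinAt
  have hmΦ : Measurable Φ := measurable_of_continuousOn_compl_singleton 0 hcΦ
  have hmΨ : Measurable Ψ := measurable_of_continuousOn_compl_singleton 0 hΨ
  set m := ∫ θ, Φ θ ∂σ with hm
  have hsub : Metric.sphere (0 : EuclideanSpace ℝ (Fin n)) 1 ⊆ {0}ᶜ := fun x hx h => by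
    rw [mem_singleton_iff] at h
    subst h
    simp at hx
  have hK := isCompact_sphere (0 : EuclideanSpace ℝ (Fin n)) 1
  obtain ⟨C₁, hC₁⟩ := hK.exists_bound_of_continuousOn ((hcΦ.mono hsub).sub (continuousOn_const (c := m)))
  obtain ⟨C₂, hC₂⟩ := hK.exists_bound_of_continuousOn (hΨ.mono hsub)
  -- The degree-one extension has mean zero, second moment `n Var Φ` and energy `Var Φ + ∫ ‖Ψ‖²`.
  -- Moving `Var Φ` to the left turns the Gaussian constant into `n - 1`. `K` is its gradient off
  -- the origin.
  let H : EuclideanSpace ℝ (Fin n) → ℝ := fun x => ‖x‖ * (Φ x - m)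
  let K : EuclideanSpace ℝ (Fin n) → EuclideanSpace ℝ (Fin n) :=
    fun x => ((Φ x - m) * ‖x‖⁻¹) • x + ‖x‖ • Ψ x
  have hHK : ∀ x ≠ 0, HasGradientAt H (K x) x := by
    intro x hx
    have h1 := (hasGradientAt_norm hx).hasFDerivAt.mul ((hΦ x hx).hasFDerivAt.sub_const m)
    rw [hasGradientAt_iff_hasFDerivAt]
    refine h1.congr_fderiv ?_
    ext v
    simp [K]
    ring
  have hHm : Measurable H := measurable_norm.mul (hmΦ.sub_const m)
  have hKm : Measurable K :=
    (((hmΦ.sub_const m).mul measurable_norm.inv).smul measurable_id).add (measurable_norm.smul hmΨ)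
  have hKc : ContinuousOn K {0}ᶜ := by
    refine ContinuousOn.add (ContinuousOn.smul ((hcΦ.sub continuousOn_const).mul
      (continuousOn_id.norm.inv₀ fun x hx => ?_)) continuousOn_id) (continuousOn_id.norm.smul hΨ)
    simpa using hx
  have hN : ∀ x : EuclideanSpace ℝ (Fin n), x ≠ 0 → ‖x‖⁻¹ • x ∈ Metric.sphere (0 : EuclideanSpace ℝ (Fin n)) 1 :=
    fun x hx => by simp [norm_smul, hx]
  have hb₁ : ∀ x ≠ 0, |Φ x - m| ≤ C₁ := fun x hx => by
    have := hC₁ _ (hN x hx)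
    simp only [Pi.sub_apply] at this
    rwa [hhom x _ (by positivity)] at this
  have hb₂ : ∀ x ≠ 0, ‖‖x‖ • Ψ x‖ ≤ C₂ := fun x hx => by
    have h1 := smul_gradient_smul_of_homogeneous hΦ hhom hx (t := ‖x‖⁻¹) (by positivity)
    rw [← h1, smul_smul, mul_inv_cancel₀ (by simpa using hx), one_smul]
    exact hC₂ _ (hN x hx)
  have hne : ∀ᵐ x ∂G, WithLp.toLp 2 x ≠ 0 := by
    have k : Fin n := ⟨0, by omega⟩
    filter_upwards [ae_pi_gaussianReal_update_ne_zero hn k] with x hx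
    simpa using hx (x k)
  have hsq : Integrable (fun x : Fin n → ℝ => ‖WithLp.toLp 2 x‖ ^ 2) G := by
    simp_rw [EuclideanSpace.norm_sq_eq, Real.norm_eq_abs, sq_abs]
    exact integrable_finsetSum _ fun i _ =>
      (measurePreserving_eval (fun _ : Fin n => gaussianReal 0 1) i).integrable_comp_of_integrable
        (memLp_id_gaussianReal 2).integrable_sq
  have hnorm2 : MemLp (fun x : Fin n → ℝ => ‖WithLp.toLp 2 x‖) 2 G :=
    (memLp_two_iff_integrable_sq (htm.norm.aestronglyMeasurable)).2 hsq
  have hHL : MemLp (fun x => H (WithLp.toLp 2 x)) 2 G := by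
    refine (hnorm2.const_mul C₁).of_le (hHm.comp htm).aestronglyMeasurable ?_
    filter_upwards [hne] with x hx
    rw [norm_mul, norm_norm, norm_mul, norm_norm, mul_comm]
    gcongr
    exact (hb₁ _ hx).trans (le_abs_self _)
  have hKb : ∀ᵐ x ∂G, ‖K (WithLp.toLp 2 x)‖ ≤ C₁ + C₂ := by
    filter_upwards [hne] with x hx
    refine (norm_add_le _ _).trans (add_le_add ?_ (hb₂ _ hx))
    rw [norm_smul, norm_mul, mul_assoc, norm_inv, norm_norm, inv_mul_cancel₀ (by simpa using hx),
      mul_one]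
    exact hb₁ _ hx
  have hKL : MemLp (fun x => K (WithLp.toLp 2 x)) 2 G :=
    MemLp.of_bound (hKm.comp htm).aestronglyMeasurable _ hKb
  have hKcomp : ∀ k, Measurable fun x => K (WithLp.toLp 2 x) k := fun k =>
    (EuclideanSpace.proj (𝕜 := ℝ) k).continuous.measurable.comp (hKm.comp htm)
  have hKLk : ∀ k, MemLp (fun x => K (WithLp.toLp 2 x) k) 2 G := fun k =>
    MemLp.of_bound (hKcomp k).aestronglyMeasurable _
      (hKb.mono fun x hx => (PiLp.norm_apply_le _ k).trans hx)
  have hpoin := variance_pi_gaussianReal_le (H := fun x => H (WithLp.toLp 2 x))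
    (D := fun k x => K (WithLp.toLp 2 x) k) (hHm.comp htm) hHL hKcomp hKLk fun k => by
      filter_upwards [ae_pi_gaussianReal_update_ne_zero hn k] with x hx
      have hline : ∀ t, HasDerivAt (fun t => WithLp.toLp 2 (Function.update x k t))
          (EuclideanSpace.single k 1) t := by
        intro t
        have h1 := hasDerivAt_update x k t
        exact (PiLp.continuousLinearEquiv 2 ℝ (fun _ : Fin n => ℝ)).symm.hasFDerivAt.comp_hasDerivAt t h1
      refine ⟨fun t => ?_, ?_⟩
      · have h1 := (hHK _ (hx t)).hasFDerivAt.comp_hasDerivAt t (hline t)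
        refine h1.congr_deriv ?_
        simp [EuclideanSpace.inner_single_right]
      · have h1 : Continuous fun t => WithLp.toLp 2 (Function.update x k t) :=
          continuous_iff_continuousAt.2 fun t => (hline t).continuousAt
        exact (EuclideanSpace.proj (𝕜 := ℝ) k).continuous.comp
          (hKc.comp_continuous h1 fun t => hx t)
  rw [← hG] at hpoin
  have htrans : ∀ g : EuclideanSpace ℝ (Fin n) → ℝ, Measurable g →
      ∫ x, g (WithLp.toLp 2 x) ∂G = ∫ p, g (p.2 • p.1) ∂(σ.prod ν) := fun g hg => by
    rw [← integral_eq_integral_prod_of_map_smul hpol hg.aestronglyMeasurable,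
      integral_map htm.aemeasurable hg.aestronglyMeasurable]
  have hae : ∀ᵐ p ∂(σ.prod ν), ‖p.1‖ = 1 ∧ 0 < p.2 := by
    refine Filter.Eventually.and ?_ ?_
    · exact Measure.quasiMeasurePreserving_fst.ae ae_uniformOnSphere_norm_eq_one
    · exact Measure.quasiMeasurePreserving_snd.ae hν.ae_pos
  have hσΦ : MemLp (fun θ => Φ θ - m) 2 σ := by
    refine MemLp.of_bound (hmΦ.sub_const m).aestronglyMeasurable C₁ ?_
    filter_upwards [ae_uniformOnSphere_norm_eq_one] with θ hθ
    exact hC₁ θ (by simpa using hθ)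
  have hσΨ : MemLp Ψ 2 σ := by
    refine MemLp.of_bound hmΨ.aestronglyMeasurable C₂ ?_
    filter_upwards [ae_uniformOnSphere_norm_eq_one] with θ hθ
    exact hC₂ θ (by simpa using hθ)
  have hσΦ1 : Integrable (fun θ => Φ θ - m) σ := hσΦ.integrable (by norm_num)
  have hΦL : MemLp Φ 2 σ :=
    (hσΦ.add (memLp_const m)).ae_eq (ae_of_all _ fun θ => by simp)
  have hΦi : Integrable Φ σ := hΦL.integrable (by norm_num)
  have hΦ2 : Integrable (fun θ => Φ θ ^ 2) σ := hΦL.integrable_sq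
  have e1 : ∫ x, H (WithLp.toLp 2 x) ∂G = 0 := by
    rw [htrans _ hHm]
    calc _ = ∫ p : EuclideanSpace ℝ (Fin n) × ℝ, (Φ p.1 - m) * p.2 ∂(σ.prod ν) := by
          refine integral_congr_ae ?_
          filter_upwards [hae] with p hp
          simp only [H]
          rw [hhom _ _ hp.2, norm_smul, hp.1, mul_one, Real.norm_eq_abs, abs_of_pos hp.2, mul_comm]
      _ = 0 := by
          rw [integral_prod_mul (fun θ => Φ θ - m) (fun r : ℝ => r),
            integral_sub hΦi (integrable_const m)]
          simp [m]
  have e2 : ∫ x, H (WithLp.toLp 2 x) ^ 2 ∂G = (∫ θ, (Φ θ - m) ^ 2 ∂σ) * ∫ r, r ^ 2 ∂ν := by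
    rw [htrans (fun x => H x ^ 2) (hHm.pow_const 2),
      ← integral_prod_mul (fun θ => (Φ θ - m) ^ 2) (fun r : ℝ => r ^ 2)]
    refine integral_congr_ae ?_
    filter_upwards [hae] with p hp
    simp only [H]
    rw [hhom _ _ hp.2, norm_smul, hp.1, mul_one, Real.norm_eq_abs, abs_of_pos hp.2]
    ring
  -- The radial second moment is the Gaussian one, a sum of `n` unit variances; no Gamma integral is
  -- needed.
  have e3 : ∫ r, r ^ 2 ∂ν = n := by
    have h1 := integral_norm_sq_map_pi_gaussianReal n
    rw [← hG, integral_eq_integral_prod_of_map_smul hpol (by fun_prop)] at h1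
    rw [← h1]
    calc _ = ∫ p : EuclideanSpace ℝ (Fin n) × ℝ, p.2 ^ 2 ∂(σ.prod ν) := by
          rw [integral_fun_snd (fun r : ℝ => r ^ 2)]
          simp
      _ = _ := by
          refine integral_congr_ae ?_
          filter_upwards [hae] with p hp
          rw [norm_smul, hp.1, mul_one, Real.norm_eq_abs, sq_abs]
  have e4 : ∑ k, ∫ x, K (WithLp.toLp 2 x) k ^ 2 ∂G =
      ∫ θ, (Φ θ - m) ^ 2 ∂σ + ∫ θ, ‖Ψ θ‖ ^ 2 ∂σ := by
    rw [← integral_finsetSum _ fun k _ => (hKLk k).integrable_sq]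
    have h1 : ∀ x, ∑ k, K x k ^ 2 = ‖K x‖ ^ 2 := fun x => by
      simp [EuclideanSpace.norm_sq_eq]
    simp_rw [h1]
    rw [htrans (fun x => ‖K x‖ ^ 2) (hKm.norm.pow_const 2),
      ← integral_add hσΦ.integrable_sq hσΨ.integrable_norm_pow']
    calc _ = ∫ p : EuclideanSpace ℝ (Fin n) × ℝ,
          ((Φ p.1 - m) ^ 2 + ‖Ψ p.1‖ ^ 2) ∂(σ.prod ν) := by
          refine integral_congr_ae ?_
          filter_upwards [hae] with p hp
          have hp0 : p.1 ≠ 0 := by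
            rw [← norm_ne_zero_iff, hp.1]
            exact one_ne_zero
          have hnorm : ‖p.2 • p.1‖ = p.2 := by
            rw [norm_smul, hp.1, mul_one, Real.norm_eq_abs, abs_of_pos hp.2]
          have hpne : p.2 ≠ 0 := hp.2.ne'
          -- The gradient of `H` is homogeneous of degree zero, so the radius drops out. Its two
          -- components are orthogonal by Euler's identity.
          have hKe : K (p.2 • p.1) = (Φ p.1 - m) • p.1 + Ψ p.1 := by
            simp only [K]
            rw [hnorm, hhom _ _ hp.2, smul_gradient_smul_of_homogeneous hΦ hhom hp0 hp.2, smul_smul]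
            congr 2
            field_simp
          rw [hKe, sq, norm_add_sq_eq_norm_sq_add_norm_sq_real, ← sq, ← sq, norm_smul, hp.1, mul_one,
            Real.norm_eq_abs, sq_abs]
          rw [inner_smul_left, real_inner_comm, inner_gradient_self_of_homogeneous hΦ hhom hp0,
            mul_zero]
      _ = _ := by
          rw [integral_fun_fst (fun θ => (Φ θ - m) ^ 2 + ‖Ψ θ‖ ^ 2)]
          simp
  have e5 : ∫ θ, (Φ θ - m) ^ 2 ∂σ = ∫ θ, Φ θ ^ 2 ∂σ - m ^ 2 := by
    have h1 : ∀ θ, (Φ θ - m) ^ 2 = Φ θ ^ 2 - 2 * m * Φ θ + m ^ 2 := fun θ => by ring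
    simp_rw [h1]
    have h2 : Integrable (fun θ => 2 * m * Φ θ) σ := hΦi.const_mul _
    have h3 : Integrable (fun θ => Φ θ ^ 2 - 2 * m * Φ θ) σ := hΦ2.sub h2
    rw [integral_add h3 (integrable_const _), integral_sub hΦ2 h2, integral_const_mul]
    simp only [integral_const, probReal_univ, smul_eq_mul, one_mul]
    change ∫ θ, Φ θ ^ 2 ∂σ - 2 * m * m + m ^ 2 = _
    ring
  rw [e1, e2, e3, e4, e5] at hpoin
  linarith

end SpherePoincare

/-! ### Tangential components -/

section Tangential

variable {E : Type*} [NormedAddCommGroup E] [InnerProductSpace ℝ E]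

/-- The component of `w` that is orthogonal to `x`. -/
noncomputable def tangential (x w : E) : E := w - (inner ℝ x w / ‖x‖ ^ 2) • x

theorem norm_tangential_sq {x : E} (hx : x ≠ 0) (w : E) :
    ‖tangential x w‖ ^ 2 = ‖w‖ ^ 2 - inner ℝ x w ^ 2 / ‖x‖ ^ 2 := by
  have hx' : ‖x‖ ≠ 0 := by simpa using hx
  rw [tangential, norm_sub_sq_real, inner_smul_right, norm_smul, mul_pow, Real.norm_eq_abs, sq_abs,
    real_inner_comm]
  field_simp
  ring

theorem norm_tangential_le (x w : E) : ‖tangential x w‖ ≤ ‖w‖ := by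
  -- At the origin the quotient is `0 / 0 = 0`, so the tangential part is the whole vector.
  rcases eq_or_ne x 0 with rfl | hx
  · simp [tangential]
  · refine le_of_sq_le_sq ?_ (norm_nonneg _)
    rw [norm_tangential_sq hx]
    have : 0 ≤ inner ℝ x w ^ 2 / ‖x‖ ^ 2 := by positivity
    linarith

theorem tangential_sub (x w w' : E) :
    tangential x (w - w') = tangential x w - tangential x w' := by
  simp only [tangential, inner_sub_right, sub_div, sub_smul]
  abel

theorem tangential_const_smul (x w : E) (c : ℝ) : tangential x (c • w) = c • tangential x w := by
  simp only [tangential, inner_smul_right, smul_sub, smul_smul, mul_div_assoc]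

theorem tangential_smul {t : ℝ} (ht : t ≠ 0) (x w : E) : tangential (t • x) w = tangential x w := by
  rcases eq_or_ne x 0 with rfl | hx
  · simp
  have hx' : ‖x‖ ≠ 0 := by simpa using hx
  simp only [tangential, inner_smul_left, norm_smul, smul_smul, mul_pow, Real.norm_eq_abs, sq_abs]
  congr 2
  simp
  field_simp

theorem tangential_integral {α : Type*} [MeasurableSpace α] {m : Measure α} [CompleteSpace E]
    (x : E) {g : α → E} (hg : Integrable g m) :
    tangential x (∫ a, g a ∂m) = ∫ a, tangential x (g a) ∂m := by
  simp only [tangential]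
  rw [integral_sub hg (((hg.const_inner x).div_const _).smul_const x), integral_smul_const,
    integral_div, integral_inner hg]

theorem measurable_tangential [MeasurableSpace E] [BorelSpace E] [SecondCountableTopology E] :
    Measurable fun p : E × E => tangential p.1 p.2 := by
  unfold tangential
  fun_prop

end Tangential

/-- Cauchy–Schwarz, from the discriminant of the nonnegative quadratic `t ↦ ∫ (u + t w)²`. -/
theorem sq_integral_mul_le {α : Type*} [MeasurableSpace α] {m : Measure α} {u w : α → ℝ}
    (hu : MemLp u 2 m) (hw : MemLp w 2 m) :
    (∫ a, u a * w a ∂m) ^ 2 ≤ (∫ a, u a ^ 2 ∂m) * ∫ a, w a ^ 2 ∂m := by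
  have h : ∀ t : ℝ, 0 ≤ (∫ a, w a ^ 2 ∂m) * (t * t) + (2 * ∫ a, u a * w a ∂m) * t +
      ∫ a, u a ^ 2 ∂m := by
    intro t
    have i1 := hw.integrable_sq.mul_const (t * t)
    have i2 : Integrable (fun a => 2 * (u a * w a) * t) m :=
      ((hu.integrable_mul hw).const_mul 2).mul_const t
    have i3 : Integrable (fun a => w a ^ 2 * (t * t) + 2 * (u a * w a) * t) m := i1.add i2
    calc 0 ≤ ∫ a, (u a + t * w a) ^ 2 ∂m := integral_nonneg fun a => sq_nonneg _
      _ = ∫ a, (w a ^ 2 * (t * t) + 2 * (u a * w a) * t + u a ^ 2) ∂m := by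
          refine integral_congr_ae (ae_of_all _ fun a => ?_)
          simp only
          ring
      _ = _ := by
          rw [integral_add i3 hu.integrable_sq, integral_add i1 i2, integral_mul_const,
            integral_mul_const, integral_const_mul]
  have := discrim_le_zero h
  rw [discrim] at this
  nlinarith

/-! ### Radial averages of smooth functions -/

section RadialAverage

variable {E : Type*} [NormedAddCommGroup E] [InnerProductSpace ℝ E] [FiniteDimensional ℝ E]

theorem continuous_gradient_of_contDiff {f : E → ℝ} (hf : ContDiff ℝ 1 f) :
    Continuous (gradient f) :=
  (LinearIsometryEquiv.continuous _).comp (hf.continuous_fderiv (by simp))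

/-- On a compact range of radii the integrand's gradient is bounded near `y`, so one may
differentiate under the integral. The cutoff in `r` costs nothing, since the derivative is in `y`.
-/
theorem hasGradientAt_radial_average {f : E → ℝ} (hf : ContDiff ℝ 1 f) {ν : Measure ℝ}
    [IsFiniteMeasure ν] (a b : ℝ) (y : E) :
    HasGradientAt (fun y => ∫ r in Icc a b, f (r • y) ∂ν)
      (∫ r in Icc a b, r • gradient f (r • y) ∂ν) y := by
  have hgc := continuous_gradient_of_contDiff hf
  have hc1 : ∀ z : E, Continuous fun r : ℝ => f (r • z) := fun z => hf.continuous.comp (by fun_prop)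
  have hc2 : Continuous fun p : ℝ × E => p.1 • gradient f (p.1 • p.2) :=
    continuous_fst.smul (hgc.comp (by fun_prop))
  have hc3 : ∀ z : E, Continuous fun r : ℝ => r • gradient f (r • z) := fun z =>
    hc2.comp (by fun_prop : Continuous fun r : ℝ => (r, z))
  obtain ⟨B, hB⟩ := (isCompact_Icc (a := a) (b := b)).prod (isCompact_closedBall y 1)
    |>.exists_bound_of_continuousOn hc2.continuousOn
  have hint : ∀ {F : Type _} [NormedAddCommGroup F] {g : ℝ → F}, Continuous g →
      IntegrableOn g (Icc a b) ν := fun hg => hg.continuousOn.integrableOn_compact isCompact_Icc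
  have key := hasFDerivAt_integral_of_dominated_of_fderiv_le (𝕜 := ℝ)
    (μ := ν.restrict (Icc a b)) (F := fun z r => f (r • z))
    (F' := fun z r => InnerProductSpace.toDual ℝ E (r • gradient f (r • z))) (x₀ := y)
    (bound := fun _ => B) (s := Metric.ball y 1) (Metric.ball_mem_nhds y one_pos)
    (Filter.Eventually.of_forall fun z => (hc1 z).aestronglyMeasurable)
    (hint (hc1 y))
    (((LinearIsometryEquiv.continuous _).comp (hc3 y)).aestronglyMeasurable)
    ?_ (integrable_const B) ?_
  · rw [hasGradientAt_iff_hasFDerivAt]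
    refine key.congr_fderiv ?_
    exact (InnerProductSpace.toDual ℝ E).toContinuousLinearEquiv.integral_comp_comm _
  · filter_upwards [ae_restrict_mem measurableSet_Icc] with r hr z hz
    rw [LinearIsometryEquiv.norm_map]
    exact hB (r, z) ⟨hr, Metric.ball_subset_closedBall hz⟩
  · refine ae_of_all _ fun r z _ => ?_
    have h1 : HasFDerivAt (fun z : E => r • z) (r • ContinuousLinearMap.id ℝ E) z :=
      (hasFDerivAt_id z).const_smul r
    have h2 := ((hf.differentiable (by simp)).differentiableAt (x := r • z)).hasGradientAt.hasFDerivAt.comp z h1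
    refine h2.congr_fderiv ?_
    ext v
    simp

/-- The derivative of `y ↦ y / ‖y‖` at `x` is `‖x‖⁻¹` times the projection orthogonal to `x`. This
makes the degree-zero extension of `Θ` available to the sphere inequality. -/
theorem hasGradientAt_comp_normalize {Θ : E → ℝ} {g x : E} (hx : x ≠ 0)
    (h : HasGradientAt Θ g (‖x‖⁻¹ • x)) :
    HasGradientAt (fun y => Θ (‖y‖⁻¹ • y)) (‖x‖⁻¹ • tangential x g) x := by
  have hx' : ‖x‖ ≠ 0 := by simpa using hx
  have h1 : HasFDerivAt (fun y : E => ‖y‖⁻¹)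
      (-(‖x‖ ^ 2)⁻¹ • InnerProductSpace.toDual ℝ E (‖x‖⁻¹ • x)) x :=
    (hasDerivAt_inv hx').comp_hasFDerivAt x (hasGradientAt_norm hx).hasFDerivAt
  have h3 := h1.smul (hasFDerivAt_id x)
  have h2 := HasFDerivAt.comp (g := Θ) (f := fun y : E => ‖y‖⁻¹ • y) x h.hasFDerivAt h3
  rw [hasGradientAt_iff_hasFDerivAt]
  refine h2.congr_fderiv ?_
  ext v
  simp [tangential, inner_smul_right]
  rw [real_inner_comm x g]
  field_simp
  ring

/-- The sphere inequality is applied to the degree-zero extension of the average. Its tangential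
gradient is an average of `r` times the tangential gradient of `f`, and Cauchy–Schwarz in `r`
extracts the second moment. With `a > 0`, projecting orthogonally to `r • θ` or to `θ` is the same.
-/
theorem radial_average_poincare {n : ℕ} (hn : 2 ≤ n) {f : EuclideanSpace ℝ (Fin n) → ℝ}
    (hf : ContDiff ℝ 1 f) {ν : Measure ℝ} [IsProbabilityMeasure ν]
    (h2 : Integrable (fun r : ℝ => r ^ 2) ν) {a : ℝ} (ha : 0 < a) (b : ℝ) :
    ((n : ℝ) - 1) *
      (∫ θ, (∫ r in Icc a b, f (r • θ) ∂ν) ^ 2 ∂(uniformOnSphere (EuclideanSpace ℝ (Fin n))) -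
        (∫ θ, ∫ r in Icc a b, f (r • θ) ∂ν ∂(uniformOnSphere (EuclideanSpace ℝ (Fin n)))) ^ 2) ≤
      (∫ r, r ^ 2 ∂ν) * ∫ θ, ∫ r in Icc a b, ‖tangential (r • θ) (gradient f (r • θ))‖ ^ 2 ∂ν
        ∂(uniformOnSphere (EuclideanSpace ℝ (Fin n))) := by
  have : Nontrivial (Fin n) := Fin.nontrivial_iff_two_le.2 hn
  set σ := uniformOnSphere (EuclideanSpace ℝ (Fin n)) with hσ
  let Θ : EuclideanSpace ℝ (Fin n) → ℝ := fun y => ∫ r in Icc a b, f (r • y) ∂ν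
  let g : EuclideanSpace ℝ (Fin n) → EuclideanSpace ℝ (Fin n) :=
    fun y => ∫ r in Icc a b, r • gradient f (r • y) ∂ν
  have hgc := continuous_gradient_of_contDiff hf
  have hcg : Continuous g := by
    have : Continuous (Function.uncurry fun (y : EuclideanSpace ℝ (Fin n)) (r : ℝ) =>
        r • gradient f (r • y)) := continuous_snd.smul (hgc.comp (by fun_prop))
    exact continuous_parametric_integral_of_continuous this isCompact_Icc
  have hN : ContinuousOn (fun x : EuclideanSpace ℝ (Fin n) => ‖x‖⁻¹) {0}ᶜ :=
    continuousOn_id.norm.inv₀ fun x hx => by simpa using hx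
  have hmain := sphere_poincare hn (Φ := fun x => Θ (‖x‖⁻¹ • x))
    (Ψ := fun x => ‖x‖⁻¹ • tangential x (g (‖x‖⁻¹ • x)))
    (fun x hx => hasGradientAt_comp_normalize hx (hasGradientAt_radial_average hf a b _))
    (by
      have hgN : ContinuousOn (fun x : EuclideanSpace ℝ (Fin n) => g (‖x‖⁻¹ • x)) {0}ᶜ :=
        hcg.comp_continuousOn (hN.smul continuousOn_id)
      refine hN.smul ?_
      unfold tangential
      refine hgN.sub (ContinuousOn.smul (ContinuousOn.div (continuousOn_id.inner hgN)
        (continuousOn_id.norm.pow 2) fun x hx => ?_) continuousOn_id)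
      simpa using hx)
    (fun x t ht => by
      rw [norm_smul, smul_smul, Real.norm_eq_abs, abs_of_pos ht, mul_inv, mul_comm t⁻¹, mul_assoc,
        inv_mul_cancel₀ ht.ne', mul_one])
  have hone := ae_uniformOnSphere_norm_eq_one (E := EuclideanSpace ℝ (Fin n))
  rw [← hσ] at hmain hone
  have c1 : ∫ θ, Θ (‖θ‖⁻¹ • θ) ^ 2 ∂σ = ∫ θ, Θ θ ^ 2 ∂σ := integral_congr_ae <| by
    filter_upwards [hone] with θ hθ
    simp [hθ]
  have c2 : ∫ θ, Θ (‖θ‖⁻¹ • θ) ∂σ = ∫ θ, Θ θ ∂σ := integral_congr_ae <| by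
    filter_upwards [hone] with θ hθ
    simp [hθ]
  rw [c1, c2] at hmain
  refine hmain.trans ?_
  rw [← integral_const_mul]
  have hcs : ∀ θ : EuclideanSpace ℝ (Fin n), Continuous fun r : ℝ => gradient f (r • θ) :=
    fun θ => hgc.comp (by fun_prop)
  obtain ⟨B, hB⟩ := (isCompact_closedBall (0 : EuclideanSpace ℝ (Fin n)) b).exists_bound_of_continuousOn
    hgc.continuousOn
  have hbd : ∀ θ : EuclideanSpace ℝ (Fin n), ‖θ‖ = 1 → ∀ r ∈ Icc a b,
      ‖tangential θ (gradient f (r • θ))‖ ≤ B := fun θ hθ r hr =>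
    (norm_tangential_le _ _).trans (hB _ (by
      simpa [norm_smul, hθ, abs_of_pos (ha.trans_le hr.1)] using hr.2))
  have hmt : Measurable fun p : EuclideanSpace ℝ (Fin n) × ℝ =>
      ‖tangential (p.2 • p.1) (gradient f (p.2 • p.1))‖ ^ 2 := by
    have h1 : Measurable fun p : EuclideanSpace ℝ (Fin n) × ℝ =>
      (p.2 • p.1, gradient f (p.2 • p.1)) :=
      Measurable.prodMk (by fun_prop) (hgc.measurable.comp (by fun_prop))
    exact (measurable_tangential.comp h1).norm.pow_const 2
  refine integral_mono_of_nonneg (ae_of_all _ fun θ => by positivity) (Integrable.const_mul ?_ _) ?_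
  · refine Integrable.of_bound
      (hmt.stronglyMeasurable.integral_prod_right (ν := ν.restrict (Icc a b))).aestronglyMeasurable
      (B ^ 2) ?_
    filter_upwards [hone] with θ hθ
    have h1 : ∀ᵐ r ∂(ν.restrict (Icc a b)),
        ‖‖tangential (r • θ) (gradient f (r • θ))‖ ^ 2‖ ≤ B ^ 2 := by
      filter_upwards [ae_restrict_mem measurableSet_Icc] with r hr
      rw [tangential_smul (ha.trans_le hr.1).ne', norm_pow, norm_norm]
      exact pow_le_pow_left₀ (norm_nonneg _) (hbd θ hθ r hr) 2
    refine (norm_integral_le_of_norm_le_const h1).trans ?_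
    exact mul_le_of_le_one_right (by positivity)
      (by rw [measureReal_restrict_apply_univ]; exact measureReal_le_one)
  · filter_upwards [hone] with θ hθ
    have hi : IntegrableOn (fun r : ℝ => r • gradient f (r • θ)) (Icc a b) ν :=
      (continuous_id.smul (hcs θ)).continuousOn.integrableOn_compact isCompact_Icc
    have m1 : MemLp (fun r : ℝ => r) 2 (ν.restrict (Icc a b)) :=
      ((memLp_two_iff_integrable_sq (by fun_prop)).2 h2).restrict _
    have hct : Measurable fun r : ℝ => tangential θ (gradient f (r • θ)) :=
      measurable_tangential.comp (measurable_const.prodMk (hcs θ).measurable)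
    have m2 : MemLp (fun r : ℝ => ‖tangential θ (gradient f (r • θ))‖) 2 (ν.restrict (Icc a b)) := by
      refine MemLp.of_bound hct.norm.aestronglyMeasurable B ?_
      filter_upwards [ae_restrict_mem measurableSet_Icc] with r hr
      simpa using hbd θ hθ r hr
    have e1 : ‖tangential θ (g θ)‖ ≤ ∫ r in Icc a b, r * ‖tangential θ (gradient f (r • θ))‖ ∂ν := by
      rw [tangential_integral θ hi]
      refine (norm_integral_le_integral_norm _).trans_eq (setIntegral_congr_fun measurableSet_Icc
        fun r hr => ?_)
      simp only [tangential_const_smul, norm_smul, Real.norm_eq_abs, abs_of_pos (ha.trans_le hr.1)]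
    have e2 : ∫ r in Icc a b, r ^ 2 ∂ν ≤ ∫ r, r ^ 2 ∂ν :=
      setIntegral_le_integral h2 (ae_of_all _ fun r => sq_nonneg r)
    have e3 : ∫ r in Icc a b, ‖tangential (r • θ) (gradient f (r • θ))‖ ^ 2 ∂ν =
        ∫ r in Icc a b, ‖tangential θ (gradient f (r • θ))‖ ^ 2 ∂ν :=
      setIntegral_congr_fun measurableSet_Icc fun r hr => by
        simp only [tangential_smul (ha.trans_le hr.1).ne']
    simp only [hθ, inv_one, one_smul]
    rw [e3]
    have e4 := sq_integral_mul_le m1 m2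
    have e5 := mul_le_mul_of_nonneg_right e2
      (integral_nonneg (μ := ν.restrict (Icc a b))
        fun r => sq_nonneg ‖tangential θ (gradient f (r • θ))‖)
    exact (pow_le_pow_left₀ (norm_nonneg _) e1 2).trans (e4.trans e5)

end RadialAverage

/-! ### `L²` on products: slices, averages and exhaustions -/

section ProductLp

theorem eLpNorm_two_sq {α F : Type*} [MeasurableSpace α] [NormedAddCommGroup F] {m : Measure α}
    (u : α → F) : eLpNorm u 2 m ^ 2 = ∫⁻ a, ‖u a‖ₑ ^ 2 ∂m := by
  have := eLpNorm_nnreal_pow_eq_lintegral (μ := m) (f := u) (p := 2) (by norm_num)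
  simpa using this

variable {α β F : Type*} [MeasurableSpace α] [MeasurableSpace β] [NormedAddCommGroup F]
  {m : Measure α} {ν : Measure β} [SFinite m] [SFinite ν]

theorem eLpNorm_two_sq_prod {w : α × β → F} (hw : AEStronglyMeasurable w (m.prod ν)) :
    eLpNorm w 2 (m.prod ν) ^ 2 = ∫⁻ a, eLpNorm (fun b => w (a, b)) 2 ν ^ 2 ∂m := by
  simp_rw [eLpNorm_two_sq]
  exact lintegral_prod _ (hw.enorm.pow_const 2)

theorem MemLp.ae_memLp_two_prodMk {w : α × β → F} (hw : MemLp w 2 (m.prod ν)) :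
    ∀ᵐ a ∂m, MemLp (fun b => w (a, b)) 2 ν := by
  have h1 : ∫⁻ a, eLpNorm (fun b => w (a, b)) 2 ν ^ 2 ∂m ≠ ⊤ := by
    rw [← eLpNorm_two_sq_prod hw.1]
    exact ENNReal.pow_ne_top hw.2.ne
  have h2 : AEMeasurable (fun a => eLpNorm (fun b => w (a, b)) 2 ν ^ 2) m := by
    simp_rw [eLpNorm_two_sq]
    exact (hw.1.enorm.pow_const 2).lintegral_prod_right'
  filter_upwards [hw.1.prodMk_left, ae_lt_top' h2 h1] with a ha hb
  exact ⟨ha, by simpa using hb⟩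

/-- Averaging over a probability factor contracts `L²`, by Jensen on each slice. -/
theorem eLpNorm_two_integral_prod_le [NormedSpace ℝ F] [IsProbabilityMeasure ν] {w : α × β → F}
    (hw : AEStronglyMeasurable w (m.prod ν)) :
    eLpNorm (fun a => ∫ b, w (a, b) ∂ν) 2 m ≤ eLpNorm w 2 (m.prod ν) := by
  rw [← ENNReal.pow_le_pow_left_iff two_ne_zero, eLpNorm_two_sq, eLpNorm_two_sq_prod hw]
  refine lintegral_mono_ae ?_
  filter_upwards [hw.prodMk_left] with a ha
  gcongr
  calc ‖∫ b, w (a, b) ∂ν‖ₑ ≤ ∫⁻ b, ‖w (a, b)‖ₑ ∂ν := enorm_integral_le_lintegral_enorm _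
    _ = eLpNorm (fun b => w (a, b)) 1 ν := by rw [eLpNorm_one_eq_lintegral_enorm]
    _ ≤ _ := eLpNorm_le_eLpNorm_of_exponent_le (by norm_num) ha

theorem MemLp.integral_prod_two [NormedSpace ℝ F] [IsProbabilityMeasure ν] {w : α × β → F}
    (hw : MemLp w 2 (m.prod ν)) : MemLp (fun a => ∫ b, w (a, b) ∂ν) 2 m :=
  ⟨hw.1.integral_prod_right', (eLpNorm_two_integral_prod_le hw.1).trans_lt hw.2⟩

/-- The approximants are controlled only on the exhausting sets. Cutting them to zero outside leaves
the tail of `w`, which vanishes by absolute continuity of its `L²` norm. -/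
theorem tendsto_eLpNorm_indicator_sub {μ : Measure α} [IsFiniteMeasure μ] {K : ℕ → Set α}
    (hK : ∀ j, MeasurableSet (K j)) (hmono : Monotone K) (hae : ∀ᵐ x ∂μ, ∃ j, x ∈ K j)
    {u : ℕ → α → F} {w : α → F} (hu : ∀ j, AEStronglyMeasurable (u j) μ) (hw : MemLp w 2 μ)
    (h : Filter.Tendsto (fun j => eLpNorm (u j - w) 2 (μ.restrict (K j))) Filter.atTop (nhds 0)) :
    Filter.Tendsto (fun j => eLpNorm ((K j).indicator (u j) - w) 2 μ) Filter.atTop (nhds 0) := by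
  have h0 : Filter.Tendsto (fun j => μ (K j)ᶜ) Filter.atTop (nhds 0) := by
    have := tendsto_measure_iInter_atTop (μ := μ) (s := fun j => (K j)ᶜ)
      (fun j => (hK j).compl.nullMeasurableSet)
      (fun i j hij => compl_subset_compl.2 (hmono hij)) ⟨0, measure_ne_top _ _⟩
    have h2 : μ (⋂ j, (K j)ᶜ) = 0 := by
      rw [← compl_iUnion]
      simpa [ae_iff, compl_def] using hae
    rwa [h2] at this
  have h1 : Filter.Tendsto (fun j => eLpNorm ((K j)ᶜ.indicator w) 2 μ) Filter.atTop (nhds 0) := by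
    rw [ENNReal.tendsto_nhds_zero]
    intro ε hε
    rcases eq_or_ne ε ⊤ with rfl | hε'
    · simp
    obtain ⟨δ, hδ, hδ'⟩ := hw.eLpNorm_indicator_le (by norm_num) (by norm_num)
      (ENNReal.toReal_pos hε.ne' hε')
    filter_upwards [(ENNReal.tendsto_nhds_zero.1 h0) (ENNReal.ofReal δ) (by simpa using hδ)]
      with j hj
    simpa [ENNReal.ofReal_toReal hε'] using hδ' _ (hK j).compl hj
  refine tendsto_of_tendsto_of_tendsto_of_le_of_le tendsto_const_nhds
    (by simpa using! h.add h1) (fun _ => zero_le) fun j => ?_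
  have e : (K j).indicator (u j) - w = (K j).indicator (u j - w) - (K j)ᶜ.indicator w := by
    ext x
    by_cases hx : x ∈ K j <;> simp [hx]
  rw [e]
  refine (eLpNorm_sub_le (((hu j).sub hw.1).indicator (hK j)) (hw.1.indicator (hK j).compl)
    (by norm_num)).trans_eq ?_
  rw [eLpNorm_indicator_eq_eLpNorm_restrict (hK j)]

theorem tendsto_zero_of_eLpNorm_two_sq {ι : Type*} {l : Filter ι} {e : ι → ENNReal}
    (h : Filter.Tendsto (fun i => e i ^ 2) l (nhds 0)) : Filter.Tendsto e l (nhds 0) := by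
  have := (ENNReal.continuous_rpow_const (y := (1 / 2 : ℝ))).tendsto 0 |>.comp h
  refine (this.congr fun i => ?_).trans (by simp)
  simp only [Function.comp, ← ENNReal.rpow_natCast, ← ENNReal.rpow_mul]
  simp

/-- Fast convergence in `L²` of a product implies convergence in `L²` of almost every slice. -/
theorem ae_tendsto_eLpNorm_prodMk {w : ℕ → α × β → F}
    (hw : ∀ j, AEStronglyMeasurable (w j) (m.prod ν))
    (h : ∑' j, eLpNorm (w j) 2 (m.prod ν) ^ 2 ≠ ⊤) :
    ∀ᵐ a ∂m, Filter.Tendsto (fun j => eLpNorm (fun b => w j (a, b)) 2 ν) Filter.atTop (nhds 0) := by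
  have h2 : ∀ j, AEMeasurable (fun a => eLpNorm (fun b => w j (a, b)) 2 ν ^ 2) m := fun j => by
    simp_rw [eLpNorm_two_sq]
    exact ((hw j).enorm.pow_const 2).lintegral_prod_right'
  simp_rw [fun j => eLpNorm_two_sq_prod (hw j)] at h
  rw [← lintegral_tsum h2] at h
  filter_upwards [ae_lt_top' (AEMeasurable.tsum h2) h] with a ha
  exact tendsto_zero_of_eLpNorm_two_sq (ENNReal.tendsto_atTop_zero_of_tsum_ne_top ha.ne)

end ProductLp

/-! ### Spherical shells exhausting the punctured space -/

section Shell

variable {E : Type*} [NormedAddCommGroup E]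

/-- The spherical shell with radii `1 / (j + 1)` and `j + 1`. -/
def normShell (E : Type*) [NormedAddCommGroup E] (j : ℕ) : Set E :=
  norm ⁻¹' Icc (((j : ℝ) + 1)⁻¹) ((j : ℝ) + 1)

theorem isCompact_normShell [ProperSpace E] (j : ℕ) : IsCompact (normShell E j) := by
  refine Metric.isCompact_of_isClosed_isBounded (isClosed_Icc.preimage continuous_norm) ?_
  refine (Metric.isBounded_closedBall (x := (0 : E)) (r := j + 1)).subset fun x hx => ?_
  simpa using hx.2

theorem measurableSet_normShell [MeasurableSpace E] [OpensMeasurableSpace E] (j : ℕ) :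
    MeasurableSet (normShell E j) := measurable_norm measurableSet_Icc

theorem normShell_subset (j : ℕ) : normShell E j ⊆ {0}ᶜ := by
  intro x hx h0
  have := hx.1
  rw [mem_singleton_iff.1 h0, norm_zero] at this
  exact absurd this (not_le.2 (by positivity))

theorem monotone_normShell : Monotone (normShell E) := by
  intro i j hij
  refine preimage_mono (Icc_subset_Icc ?_ ?_) <;> gcongr

theorem exists_mem_normShell_of_ne_zero {x : E} (hx : x ≠ 0) : ∃ j, x ∈ normShell E j := by
  have hx' : 0 < ‖x‖ := norm_pos_iff.2 hx
  obtain ⟨j, hj⟩ := exists_nat_gt (max ‖x‖ ‖x‖⁻¹)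
  refine ⟨j, ?_, ?_⟩
  · refine inv_le_of_inv_le₀ hx' ?_
    exact ((le_max_right _ _).trans hj.le).trans (by simp)
  · exact ((le_max_left _ _).trans hj.le).trans (by simp)

theorem smul_mem_normShell_iff [NormedSpace ℝ E] {θ : E} (hθ : ‖θ‖ = 1) {r : ℝ} (hr : 0 < r)
    (j : ℕ) : r • θ ∈ normShell E j ↔ r ∈ Icc (((j : ℝ) + 1)⁻¹) ((j : ℝ) + 1) := by
  simp [normShell, norm_smul, hθ, abs_of_pos hr]

theorem exists_Icc_of_isCompact_subset_Ioi {K : Set ℝ} (hK : IsCompact K) (hK0 : K ⊆ Ioi 0) :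
    ∃ j₀ : ℕ, ∀ j ≥ j₀, K ⊆ Icc (((j : ℝ) + 1)⁻¹) ((j : ℝ) + 1) := by
  rcases K.eq_empty_or_nonempty with rfl | hne
  · simp
  obtain ⟨a, ha⟩ := hK.exists_isLeast hne
  obtain ⟨b, hb⟩ := hK.exists_isGreatest hne
  obtain ⟨j₀, hj₀⟩ := exists_nat_gt (max b a⁻¹)
  refine ⟨j₀, fun j hj r hr => ?_⟩
  have ha0 : 0 < a := hK0 ha.1
  have hj' : (j₀ : ℝ) ≤ j := by exact_mod_cast hj
  have h1 := (le_max_left b a⁻¹).trans_lt hj₀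
  have h2 := (le_max_right b a⁻¹).trans_lt hj₀
  refine ⟨?_, (hb.2 hr).trans (by linarith)⟩
  exact (inv_le_of_inv_le₀ ha0 (by linarith)).trans (ha.2 hr)

end Shell

/-! ### Smooth approximation on shells -/

section PolarDecomposition

variable {E : Type*} [NormedAddCommGroup E] [InnerProductSpace ℝ E] [FiniteDimensional ℝ E]
  [MeasureSpace E] [BorelSpace E]

/-- Shells avoid the origin, where the density is not controlled. The geometric rate makes the
squared errors summable, so that convergence passes to almost every ray. -/
theorem IsSobolevWithGradient.exists_seq_contDiff [(volume : Measure E).IsAddHaarMeasure]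
    {μ : Measure E} (hμ : LocallyComparableOn {0}ᶜ μ)
    {f : E → ℝ} {G : E → E} (h : IsSobolevWithGradient univ μ f G) :
    ∃ u : ℕ → E → ℝ, ∀ j, ContDiff ℝ ∞ (u j) ∧
      eLpNorm (u j - f) 2 (μ.restrict (normShell E j)) ≤ 2⁻¹ ^ j ∧
      eLpNorm (gradient (u j) - G) 2 (μ.restrict (normShell E j)) ≤ 2⁻¹ ^ j := by
  have := fun j : ℕ => h.exists_contDiff_eLpNorm_sub_le (isOpen_compl_singleton (x := (0 : E)))
    (subset_univ _) hμ (isCompact_normShell j) (normShell_subset j)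
    (ε := (2⁻¹ : ENNReal) ^ j) (by simp [ENNReal.pow_pos])
  choose u hu using this
  exact ⟨u, hu⟩

theorem tendsto_inv_two_pow_ennreal :
    Filter.Tendsto (fun j : ℕ => (2⁻¹ : ENNReal) ^ j) Filter.atTop (nhds 0) :=
  ENNReal.tendsto_pow_atTop_nhds_zero_of_lt_one (by simp)

theorem ae_prod_norm_eq_one_and_pos {ν : Measure ℝ} [SFinite ν] (hν : ∀ᵐ r ∂ν, 0 < r) :
    ∀ᵐ p ∂((uniformOnSphere E).prod ν), ‖p.1‖ = 1 ∧ 0 < p.2 := by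
  have h1 := (Measure.quasiMeasurePreserving_fst (μ := uniformOnSphere E) (ν := ν)).ae
    (ae_uniformOnSphere_norm_eq_one (E := E))
  have h2 := (Measure.quasiMeasurePreserving_snd (μ := uniformOnSphere E) (ν := ν)).ae hν
  filter_upwards [h1, h2] with p hp hp' using ⟨hp, hp'⟩

theorem ae_ne_zero_of_measurePreserving_smul {μ : Measure E} {ν : Measure ℝ} [SFinite ν]
    (hmp : MeasurePreserving (fun p : E × ℝ => p.2 • p.1) ((uniformOnSphere E).prod ν) μ)
    (hν : ∀ᵐ r ∂ν, 0 < r) : ∀ᵐ x ∂μ, x ≠ 0 := by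
  have hm : MeasurableSet {x : E | x ≠ 0} := (measurableSet_singleton (0 : E)).compl
  rw [← hmp.map_eq, ae_map_iff hmp.measurable.aemeasurable hm]
  filter_upwards [ae_prod_norm_eq_one_and_pos hν] with p hp
  rw [smul_ne_zero_iff]
  exact ⟨hp.2.ne', norm_ne_zero_iff.1 (by rw [hp.1]; exact one_ne_zero)⟩

end PolarDecomposition

/-! ### The lower bound for Sobolev functions -/

/-- Limit of the smooth case along approximations cut off to shells. Both sides pass to the limit
because radial averaging and tangential projection are `L²` contractions. -/
theorem IsSobolevWithGradient.radial_average_poincare {n : ℕ} (hn : 2 ≤ n)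
    {μ : Measure (EuclideanSpace ℝ (Fin n))} [IsProbabilityMeasure μ] {ν : Measure ℝ}
    [IsProbabilityMeasure ν] (hμ : LocallyComparableOn {0}ᶜ μ)
    (hmp : MeasurePreserving (fun p : EuclideanSpace ℝ (Fin n) × ℝ => p.2 • p.1)
      ((uniformOnSphere _).prod ν) μ)
    (hν : ∀ᵐ r ∂ν, 0 < r) (h2 : Integrable (fun r : ℝ => r ^ 2) ν)
    {f : EuclideanSpace ℝ (Fin n) → ℝ} {G : EuclideanSpace ℝ (Fin n) → EuclideanSpace ℝ (Fin n)}
    (h : IsSobolevWithGradient univ μ f G) :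
    ((n : ℝ) - 1) *
      (∫ θ, (∫ r, f (r • θ) ∂ν) ^ 2 ∂(uniformOnSphere (EuclideanSpace ℝ (Fin n))) -
        (∫ θ, ∫ r, f (r • θ) ∂ν ∂(uniformOnSphere (EuclideanSpace ℝ (Fin n)))) ^ 2) ≤
      (∫ r, r ^ 2 ∂ν) * ∫ x, ‖tangential x (G x)‖ ^ 2 ∂μ := by
  have : Nontrivial (Fin n) := Fin.nontrivial_iff_two_le.2 hn
  obtain ⟨v, hv⟩ := h.exists_seq_contDiff hμ
  choose hvc hv1 hv2 using hv
  set σ := uniformOnSphere (EuclideanSpace ℝ (Fin n)) with hσ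
  let S : ℕ → Set (EuclideanSpace ℝ (Fin n)) := normShell _
  have hS : ∀ j, MeasurableSet (S j) := measurableSet_normShell
  have hgc : ∀ j, Continuous (gradient (v j)) := fun j =>
    continuous_gradient_of_contDiff ((hvc j).of_le (by exact_mod_cast le_top))
  have hae : ∀ᵐ x ∂μ, ∃ j, x ∈ S j := by
    filter_upwards [ae_ne_zero_of_measurePreserving_smul hmp hν] with x hx
    exact exists_mem_normShell_of_ne_zero hx
  have memS : ∀ {F : Type} [NormedAddCommGroup F] {w : EuclideanSpace ℝ (Fin n) → F} (j : ℕ),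
      Continuous w → SecondCountableTopology F → MemLp ((S j).indicator w) 2 μ := by
    intro F _ w j hw _
    obtain ⟨B, hB⟩ := (isCompact_normShell j).exists_bound_of_continuousOn hw.continuousOn
    rw [memLp_indicator_iff_restrict (hS j)]
    exact MemLp.of_bound hw.aestronglyMeasurable B
      ((ae_restrict_iff' (hS j)).2 (ae_of_all _ hB))
  have mu : ∀ j, MemLp ((S j).indicator (v j)) 2 μ := fun j =>
    memS j (hvc j).continuous inferInstance
  have mg : ∀ j, MemLp ((S j).indicator (gradient (v j))) 2 μ := fun j =>
    memS j (hgc j) inferInstance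
  have tu := tendsto_eLpNorm_indicator_sub hS monotone_normShell hae
    (fun j => (hvc j).continuous.aestronglyMeasurable) h.memLp
    (tendsto_of_tendsto_of_tendsto_of_le_of_le tendsto_const_nhds tendsto_inv_two_pow_ennreal
      (fun _ => zero_le) hv1)
  have tg := tendsto_eLpNorm_indicator_sub hS monotone_normShell hae
    (fun j => (hgc j).aestronglyMeasurable) h.memLp_gradient
    (tendsto_of_tendsto_of_tendsto_of_le_of_le tendsto_const_nhds tendsto_inv_two_pow_ennreal
      (fun _ => zero_le) hv2)
  have mw : ∀ {w : EuclideanSpace ℝ (Fin n) → ℝ}, MemLp w 2 μ →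
      MemLp (fun p : EuclideanSpace ℝ (Fin n) × ℝ => w (p.2 • p.1)) 2 (σ.prod ν) :=
    fun hw => hw.comp_measurePreserving hmp
  have mJ : ∀ {w : EuclideanSpace ℝ (Fin n) → ℝ}, MemLp w 2 μ →
      MemLp (fun θ => ∫ r, w (r • θ) ∂ν) 2 σ := fun hw => MemLp.integral_prod_two (mw hw)
  have tJ : Filter.Tendsto (fun j => eLpNorm ((fun θ => ∫ r, (S j).indicator (v j) (r • θ) ∂ν) -
      fun θ => ∫ r, f (r • θ) ∂ν) 2 σ) Filter.atTop (nhds 0) := by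
    refine tendsto_of_tendsto_of_tendsto_of_le_of_le tendsto_const_nhds tu (fun _ => zero_le)
      fun j => ?_
    rw [← eLpNorm_comp_measurePreserving ((mu j).1.sub h.memLp.1) hmp]
    refine le_trans (le_of_eq (eLpNorm_congr_ae ?_))
      (eLpNorm_two_integral_prod_le (mw ((mu j).sub h.memLp)).1)
    filter_upwards [MemLp.ae_memLp_two_prodMk (mw (mu j)),
      MemLp.ae_memLp_two_prodMk (mw h.memLp)] with θ h1 h2
    exact (integral_sub (h1.integrable (by norm_num)) (h2.integrable (by norm_num))).symm
  have l1 := tendsto_integral_norm_sq_of_tendsto_eLpNorm (fun j => mJ (mu j)) (mJ h.memLp) tJ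
  have l2 := tendsto_integral_of_tendsto_eLpNorm_two (fun j => mJ (mu j)) (mJ h.memLp) tJ
  have mT : ∀ {w : EuclideanSpace ℝ (Fin n) → EuclideanSpace ℝ (Fin n)}, MemLp w 2 μ →
      MemLp (fun x => tangential x (w x)) 2 μ := fun {w} hw =>
    hw.of_le (measurable_tangential.comp_aemeasurable
      (measurable_id.aemeasurable.prodMk hw.1.aemeasurable)).aestronglyMeasurable
      (ae_of_all _ fun x => norm_tangential_le _ _)
  have tT : Filter.Tendsto (fun j => eLpNorm
      ((fun x => tangential x ((S j).indicator (gradient (v j)) x)) -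
      fun x => tangential x (G x)) 2 μ) Filter.atTop (nhds 0) := by
    refine tendsto_of_tendsto_of_tendsto_of_le_of_le tendsto_const_nhds tg (fun _ => zero_le)
      fun j => eLpNorm_mono fun x => ?_
    simp only [Pi.sub_apply]
    rw [← tangential_sub]
    exact norm_tangential_le _ _
  have l3 := tendsto_integral_norm_sq_of_tendsto_eLpNorm (fun j => mT (mg j))
    (mT h.memLp_gradient) tT
  simp only [Real.norm_eq_abs, sq_abs] at l1
  refine le_of_tendsto_of_tendsto' ((l1.sub (l2.pow 2)).const_mul ((n : ℝ) - 1))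
    (l3.const_mul (∫ r, r ^ 2 ∂ν)) fun j => ?_
  have key := _root_.radial_average_poincare hn (f := v j)
    ((hvc j).of_le (by exact_mod_cast le_top)) h2 (a := ((j : ℝ) + 1)⁻¹) (by positivity) ((j : ℝ) + 1)
  rw [← hσ] at key
  have hone := ae_uniformOnSphere_norm_eq_one (E := EuclideanSpace ℝ (Fin n))
  rw [← hσ] at hone
  -- Along a ray the shell is an interval of radii, so the cutoff function has exactly the truncated
  -- average of the smooth inequality.
  have e1 : ∀ᵐ θ ∂σ, ∫ r, (S j).indicator (v j) (r • θ) ∂ν =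
      ∫ r in Icc (((j : ℝ) + 1)⁻¹) ((j : ℝ) + 1), v j (r • θ) ∂ν := by
    filter_upwards [hone] with θ hθ
    rw [← integral_indicator measurableSet_Icc]
    refine integral_congr_ae ?_
    filter_upwards [hν] with r hr
    by_cases hr' : r ∈ Icc (((j : ℝ) + 1)⁻¹) ((j : ℝ) + 1)
    · rw [indicator_of_mem hr', indicator_of_mem ((smul_mem_normShell_iff hθ hr j).2 hr')]
    · rw [indicator_of_notMem hr',
        indicator_of_notMem (mt (smul_mem_normShell_iff hθ hr j).1 hr')]
  have e2 : ∫ x, ‖tangential x ((S j).indicator (gradient (v j)) x)‖ ^ 2 ∂μ =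
      ∫ θ, ∫ r in Icc (((j : ℝ) + 1)⁻¹) ((j : ℝ) + 1),
        ‖tangential (r • θ) (gradient (v j) (r • θ))‖ ^ 2 ∂ν ∂σ := by
    have hT := mT (mg j)
    have hTi : Integrable (fun p : EuclideanSpace ℝ (Fin n) × ℝ =>
        ‖tangential (p.2 • p.1) ((S j).indicator (gradient (v j)) (p.2 • p.1))‖ ^ 2) (σ.prod ν) :=
      (hT.comp_measurePreserving hmp).norm.integrable_sq
    rw [integral_eq_integral_prod_of_map_smul
        (g := fun x => ‖tangential x ((S j).indicator (gradient (v j)) x)‖ ^ 2) hmp.map_eq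
        (hT.1.norm.pow 2), integral_prod _ hTi]
    refine integral_congr_ae ?_
    filter_upwards [hone] with θ hθ
    rw [← integral_indicator measurableSet_Icc]
    refine integral_congr_ae ?_
    filter_upwards [hν] with r hr
    by_cases hr' : r ∈ Icc (((j : ℝ) + 1)⁻¹) ((j : ℝ) + 1)
    · have hm : r • θ ∈ S j := (smul_mem_normShell_iff hθ hr j).2 hr'
      simp only [indicator_of_mem hr', indicator_of_mem hm]
    · have hm : r • θ ∉ S j := mt (smul_mem_normShell_iff hθ hr j).1 hr'
      simp only [indicator_of_notMem hr', indicator_of_notMem hm]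
      simp [tangential]
  rw [e2, integral_congr_ae e1, integral_congr_ae (e1.mono fun θ hθ => congrArg (· ^ 2) hθ)]
  exact key

/-- On almost every ray the restricted approximations and their gradients converge in `L²` on
compact sets of radii. The chain rule identifies their derivatives, and closedness of the weak
gradient concludes. -/
theorem IsSobolevWithGradient.ae_isSobolevWithGradient_ray {E : Type*} [NormedAddCommGroup E]
    [InnerProductSpace ℝ E] [FiniteDimensional ℝ E] [MeasureSpace E] [BorelSpace E]
    [(volume : Measure E).IsAddHaarMeasure] [Nontrivial E] {μ : Measure E} {ν : Measure ℝ}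
    [IsProbabilityMeasure ν] (hμ : LocallyComparableOn {0}ᶜ μ)
    (hνc : LocallyComparableOn (Ioi 0) ν)
    (hmp : MeasurePreserving (fun p : E × ℝ => p.2 • p.1) ((uniformOnSphere _).prod ν) μ)
    {f : E → ℝ} {G : E → E} (h : IsSobolevWithGradient univ μ f G) :
    ∀ᵐ θ ∂(uniformOnSphere E), IsSobolevWithGradient (Ioi 0) ν (fun r => f (r • θ))
      (fun r => inner ℝ (G (r • θ)) θ) := by
  obtain ⟨v, hv⟩ := h.exists_seq_contDiff hμ
  choose hvc hv1 hv2 using hv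
  have hgc : ∀ j, Continuous (gradient (v j)) := fun j =>
    continuous_gradient_of_contDiff ((hvc j).of_le (by exact_mod_cast le_top))
  have hS : ∀ j, MeasurableSet (normShell E j) := measurableSet_normShell
  have hsum : ∑' j : ℕ, ((2⁻¹ : ENNReal) ^ j) ^ 2 ≠ ⊤ := by
    refine ne_top_of_le_ne_top ?_ (ENNReal.tsum_le_tsum fun j : ℕ =>
      (pow_le_of_le_one zero_le (pow_le_one' (by simp) j) two_ne_zero :
        ((2⁻¹ : ENNReal) ^ j) ^ 2 ≤ 2⁻¹ ^ j))
    rw [ENNReal.tsum_geometric]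
    simp
  have a1 : ∀ j, AEStronglyMeasurable ((normShell E j).indicator (v j - f)) μ := fun j =>
    ((hvc j).continuous.aestronglyMeasurable.sub h.memLp.1).indicator (hS j)
  have a2 : ∀ j, AEStronglyMeasurable ((normShell E j).indicator (gradient (v j) - G)) μ :=
    fun j => ((hgc j).aestronglyMeasurable.sub h.memLp_gradient.1).indicator (hS j)
  have t1 := ae_tendsto_eLpNorm_prodMk (m := uniformOnSphere E) (ν := ν)
    (w := fun j => (normShell E j).indicator (v j - f) ∘ fun p : E × ℝ => p.2 • p.1)
    (fun j => (a1 j).comp_measurePreserving hmp) (by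
      refine ne_top_of_le_ne_top hsum (ENNReal.tsum_le_tsum fun j => ?_)
      rw [eLpNorm_comp_measurePreserving (a1 j) hmp, eLpNorm_indicator_eq_eLpNorm_restrict (hS j)]
      exact pow_le_pow_left' (hv1 j) 2)
  have t2 := ae_tendsto_eLpNorm_prodMk (m := uniformOnSphere E) (ν := ν)
    (w := fun j => (normShell E j).indicator (gradient (v j) - G) ∘ fun p : E × ℝ => p.2 • p.1)
    (fun j => (a2 j).comp_measurePreserving hmp) (by
      refine ne_top_of_le_ne_top hsum (ENNReal.tsum_le_tsum fun j => ?_)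
      rw [eLpNorm_comp_measurePreserving (a2 j) hmp, eLpNorm_indicator_eq_eLpNorm_restrict (hS j)]
      exact pow_le_pow_left' (hv2 j) 2)
  filter_upwards [t1, t2, ae_uniformOnSphere_norm_eq_one (E := E),
    MemLp.ae_memLp_two_prodMk (h.memLp.comp_measurePreserving hmp),
    MemLp.ae_memLp_two_prodMk (h.memLp_gradient.comp_measurePreserving hmp)]
    with θ ht1 ht2 hθ hf hG
  have hG' : MemLp (fun r : ℝ => inner ℝ (G (r • θ)) θ) 2 ν := hG.inner_const θ
  refine ⟨hf, hasWeakGradientOn_of_approx isOpen_Ioi hνc hf hG' fun K hK hKc ε hε => ?_, hG'⟩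
  obtain ⟨j₀, hj₀⟩ := exists_Icc_of_isCompact_subset_Ioi hKc hK
  obtain ⟨j, hj, e1, e2⟩ := ((Filter.eventually_ge_atTop j₀).and
    (((ENNReal.tendsto_nhds_zero.1 ht1) ε hε).and ((ENNReal.tendsto_nhds_zero.1 ht2) ε hε))).exists
  have hmem : ∀ r ∈ K, r • θ ∈ normShell E j := fun r hr =>
    (smul_mem_normShell_iff hθ (hK hr) j).2 (hj₀ j hj hr)
  refine ⟨fun r => v j (r • θ), ((hvc j).of_le (by exact_mod_cast le_top)).comp (by fun_prop),
    ?_, ?_⟩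
  · refine le_trans (le_of_eq (eLpNorm_congr_ae ?_))
      ((eLpNorm_mono_measure _ Measure.restrict_le_self).trans e1)
    filter_upwards [ae_restrict_mem hKc.measurableSet] with r hr
    simp [hmem r hr]
  · refine le_trans (eLpNorm_mono_ae ?_)
      ((eLpNorm_mono_measure _ Measure.restrict_le_self).trans e2)
    filter_upwards [ae_restrict_mem hKc.measurableSet] with r hr
    have hd : HasDerivAt (fun r : ℝ => v j (r • θ)) (inner ℝ (gradient (v j) (r • θ)) θ) r := by
      have h1 : HasDerivAt (fun r : ℝ => r • θ) ((1 : ℝ) • θ) r := (hasDerivAt_id r).smul_const θ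
      have h2 := (((hvc j).differentiable (by simp)).differentiableAt
        (x := r • θ)).hasGradientAt.hasFDerivAt.comp_hasDerivAt r h1
      simpa using! h2
    rw [gradient_eq_deriv', hd.deriv, ← inner_sub_left]
    refine (norm_inner_le_norm _ _).trans ?_
    simp [hmem r hr, hθ]

/-- With `A = ∫ F²` the variance of the radial average `F`, the variance along rays averages to `1 -
A`. It is paid for by the radial energy, and `A` by the tangential energy. -/
theorem min_spectralGap_le_integral_norm_sq {n : ℕ} (hn : 2 ≤ n)
    {μ : Measure (EuclideanSpace ℝ (Fin n))} [IsProbabilityMeasure μ] {ν : Measure ℝ}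
    [IsProbabilityMeasure ν] (hμ : LocallyComparableOn {0}ᶜ μ)
    (hνc : LocallyComparableOn (Ioi 0) ν)
    (hmp : MeasurePreserving (fun p : EuclideanSpace ℝ (Fin n) × ℝ => p.2 • p.1)
      ((uniformOnSphere _).prod ν) μ)
    (hν : ∀ᵐ r ∂ν, 0 < r) (h2 : Integrable (fun r : ℝ => r ^ 2) ν)
    {f : EuclideanSpace ℝ (Fin n) → ℝ} {G : EuclideanSpace ℝ (Fin n) → EuclideanSpace ℝ (Fin n)}
    (h : IsSobolevWithGradient univ μ f G) (h0 : ∫ x, f x ∂μ = 0) (h1 : ∫ x, f x ^ 2 ∂μ = 1) :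
    min (spectralGap (Ioi 0) ν) (((n : ℝ) - 1) / ∫ r, r ^ 2 ∂ν) ≤ ∫ x, ‖G x‖ ^ 2 ∂μ := by
  have : Nontrivial (Fin n) := Fin.nontrivial_iff_two_le.2 hn
  have hS := h.radial_average_poincare hn hμ hmp hν h2
  have hR := h.ae_isSobolevWithGradient_ray hμ hνc hmp
  set σ := uniformOnSphere (EuclideanSpace ℝ (Fin n)) with hσ
  set M := ∫ r, r ^ 2 ∂ν with hM
  set lam := spectralGap (Ioi 0) ν
  have hMpos : 0 < M := by
    rw [hM, integral_pos_iff_support_of_nonneg (fun r => sq_nonneg r) h2, pos_iff_ne_zero]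
    intro hz
    have hne : ∀ᵐ r ∂ν, r ∈ (Function.support fun r : ℝ => r ^ 2) := by
      filter_upwards [hν] with r hr
      simpa using hr.ne'
    have h3 : ∀ᵐ r ∂ν, r ∉ (Function.support fun r : ℝ => r ^ 2) :=
      measure_eq_zero_iff_ae_notMem.1 hz
    obtain ⟨r, hr, hr'⟩ := (hne.and h3).exists
    exact hr' hr
  have mf : MemLp (fun p : EuclideanSpace ℝ (Fin n) × ℝ => f (p.2 • p.1)) 2 (σ.prod ν) :=
    h.memLp.comp_measurePreserving hmp
  have mG : MemLp (fun p : EuclideanSpace ℝ (Fin n) × ℝ => G (p.2 • p.1)) 2 (σ.prod ν) :=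
    h.memLp_gradient.comp_measurePreserving hmp
  have mT : MemLp (fun x => tangential x (G x)) 2 μ :=
    h.memLp_gradient.of_le (measurable_tangential.comp_aemeasurable
      (measurable_id.aemeasurable.prodMk h.memLp_gradient.1.aemeasurable)).aestronglyMeasurable
      (ae_of_all _ fun x => norm_tangential_le _ _)
  have mF : MemLp (fun θ => ∫ r, f (r • θ) ∂ν) 2 σ := MemLp.integral_prod_two mf
  have e0 : ∫ θ, ∫ r, f (r • θ) ∂ν ∂σ = 0 := by
    rw [← h0, integral_eq_integral_prod_of_map_smul hmp.map_eq h.memLp.1,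
      integral_prod _ (mf.integrable (by norm_num))]
  have e1 : ∫ θ, ∫ r, f (r • θ) ^ 2 ∂ν ∂σ = 1 := by
    rw [← h1, integral_eq_integral_prod_of_map_smul (g := fun x => f x ^ 2) hmp.map_eq
      (h.memLp.1.pow 2), integral_prod _ mf.integrable_sq]
  have i1 : Integrable (fun θ => ∫ r, f (r • θ) ^ 2 ∂ν) σ := mf.integrable_sq.integral_prod_left
  have iR : Integrable (fun p : EuclideanSpace ℝ (Fin n) × ℝ => inner ℝ (G (p.2 • p.1)) p.1 ^ 2)
      (σ.prod ν) := by
    refine Integrable.mono' mG.norm.integrable_sq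
      ((mG.1.inner measurable_fst.aestronglyMeasurable).pow 2) ?_
    filter_upwards [ae_prod_norm_eq_one_and_pos hν] with p hp
    have := norm_inner_le_norm (𝕜 := ℝ) (G (p.2 • p.1)) p.1
    rw [hp.1, mul_one] at this
    rw [norm_pow]
    exact pow_le_pow_left₀ (norm_nonneg _) this 2
  -- Pythagoras: the radial energy is the total energy minus the tangential one.
  have eR : ∫ θ, ∫ r, inner ℝ (G (r • θ)) θ ^ 2 ∂ν ∂σ =
      ∫ x, ‖G x‖ ^ 2 ∂μ - ∫ x, ‖tangential x (G x)‖ ^ 2 ∂μ := by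
    have i2 := h.memLp_gradient.norm.integrable_sq
    have i3 := mT.norm.integrable_sq
    rw [← integral_sub i2 i3, integral_eq_integral_prod_of_map_smul
      (g := fun x => ‖G x‖ ^ 2 - ‖tangential x (G x)‖ ^ 2) hmp.map_eq (i2.1.sub i3.1),
      ← integral_prod (fun p : EuclideanSpace ℝ (Fin n) × ℝ => inner ℝ (G (p.2 • p.1)) p.1 ^ 2) iR]
    refine integral_congr_ae ?_
    filter_upwards [ae_prod_norm_eq_one_and_pos hν] with p hp
    have hp0 : p.1 ≠ 0 := norm_ne_zero_iff.1 (by rw [hp.1]; exact one_ne_zero)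
    rw [tangential_smul hp.2.ne', norm_tangential_sq hp0, hp.1, real_inner_comm]
    ring
  have k1 : lam * (1 - ∫ θ, (∫ r, f (r • θ) ∂ν) ^ 2 ∂σ) ≤
      ∫ x, ‖G x‖ ^ 2 ∂μ - ∫ x, ‖tangential x (G x)‖ ^ 2 ∂μ := by
    rw [← eR, ← e1, ← integral_sub i1 mF.integrable_sq, ← integral_const_mul]
    refine integral_mono_ae ((i1.sub mF.integrable_sq).const_mul _) iR.integral_prod_left ?_
    filter_upwards [hR] with θ hθ
    have := hθ.spectralGap_mul_variance_le
    simpa only [Real.norm_eq_abs, sq_abs] using this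
  have k2 : 0 ≤ 1 - ∫ θ, (∫ r, f (r • θ) ∂ν) ^ 2 ∂σ := by
    rw [← e1, sub_nonneg]
    refine integral_mono_ae mF.integrable_sq i1 ?_
    filter_upwards [MemLp.ae_memLp_two_prodMk mf] with θ hθ
    have := sq_integral_mul_le hθ (memLp_const (1 : ℝ))
    simpa using! this
  have k3 : 0 ≤ ∫ θ, (∫ r, f (r • θ) ∂ν) ^ 2 ∂σ := by positivity
  rw [e0] at hS
  -- Writing `m = m (1 - A) + m A`, the first term is bounded using `m ≤ lam` and the second using
  -- `m M ≤ n - 1`.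
  set m := min lam (((n : ℝ) - 1) / M)
  have m1 : m ≤ lam := min_le_left _ _
  have m2 : m * M ≤ (n : ℝ) - 1 := (le_div_iff₀ hMpos).1 (min_le_right _ _)
  have k4 : m * ∫ θ, (∫ r, f (r • θ) ∂ν) ^ 2 ∂σ ≤ ∫ x, ‖tangential x (G x)‖ ^ 2 ∂μ := by
    refine le_of_mul_le_mul_left ?_ hMpos
    have := mul_le_mul_of_nonneg_right m2 k3
    linarith
  have k5 := mul_le_mul_of_nonneg_right m1 k2
  linarith

/-! ### Lipschitz test functions -/

section Lipschitz

variable {E : Type*} [NormedAddCommGroup E] [InnerProductSpace ℝ E]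

theorem HasWeakGradientOn.mono [MeasureSpace E] {Ω Ω' : Set E} (hΩ : Ω' ⊆ Ω) {f : E → ℝ}
    {G : E → E} (h : HasWeakGradientOn Ω f G) : HasWeakGradientOn Ω' f G :=
  ⟨h.1.mono_set hΩ, h.2.1.mono_set hΩ, fun φ hφ hc hs => h.2.2 φ hφ hc (hs.trans hΩ)⟩

theorem norm_gradient [CompleteSpace E] (u : E → ℝ) (x : E) :
    ‖gradient u x‖ = ‖fderiv ℝ u x‖ := by
  simp [gradient]

variable [FiniteDimensional ℝ E] [MeasureSpace E] [BorelSpace E]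

theorem measurable_gradient (u : E → ℝ) : Measurable (gradient u) :=
  (InnerProductSpace.toDual ℝ E).symm.continuous.measurable.comp (measurable_fderiv ℝ u)

/-- By Rademacher the classical gradient exists almost everywhere, and Lipschitz functions may be
integrated by parts. This produces test functions across the origin without any information on `μ`
there. -/
theorem LipschitzWith.hasWeakGradientOn_univ [(volume : Measure E).IsAddHaarMeasure]
    {C : NNReal} {u : E → ℝ} (hu : LipschitzWith C u) :
    HasWeakGradientOn univ u (gradient u) := by
  refine ⟨hu.continuous.locallyIntegrable.locallyIntegrableOn _, ?_, fun φ hφ hc _ v => ?_⟩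
  · refine (MemLp.locallyIntegrable (p := ⊤) ?_ le_top).locallyIntegrableOn _
    exact memLp_top_of_bound (measurable_gradient u).aestronglyMeasurable C
      (ae_of_all _ fun x => (norm_gradient u x).trans_le (norm_fderiv_le_of_lipschitz ℝ hu))
  · obtain ⟨D, hD⟩ := hφ.lipschitzWith_of_hasCompactSupport hc (by simp)
    have key := hu.integral_lineDeriv_mul_eq (μ := volume) hD hc v
    have e1 : ∫ x, lineDeriv ℝ φ x (-v) * u x = -∫ x, u x * fderiv ℝ φ x v := by
      rw [← integral_neg]
      refine integral_congr_ae (ae_of_all _ fun x => ?_)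
      simp only
      rw [((hφ.differentiable (by simp)).differentiableAt).lineDeriv_eq_fderiv]
      simp [mul_comm]
    have e2 : ∫ x, lineDeriv ℝ u x v * φ x = ∫ x, φ x * inner ℝ (gradient u x) v := by
      refine integral_congr_ae ?_
      filter_upwards [hu.ae_differentiableAt (μ := volume)] with x hx
      rw [hx.lineDeriv_eq_fderiv, inner_gradient_left, mul_comm]
    rw [← e2, key, e1, neg_neg]

theorem LipschitzWith.isSobolevWithGradient_univ [(volume : Measure E).IsAddHaarMeasure]
    {μ : Measure E} [IsFiniteMeasure μ] {C : NNReal} {u : E → ℝ} (hu : LipschitzWith C u)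
    (h2 : MemLp u 2 μ) : IsSobolevWithGradient univ μ u (gradient u) :=
  ⟨h2, hu.hasWeakGradientOn_univ,
    MemLp.of_bound (measurable_gradient u).aestronglyMeasurable C
      (ae_of_all _ fun x => (norm_gradient u x).trans_le (norm_fderiv_le_of_lipschitz ℝ hu))⟩

end Lipschitz

/-! ### Coordinates as test functions -/

section Coordinates

variable {n : ℕ} {μ : Measure (EuclideanSpace ℝ (Fin n))} [IsProbabilityMeasure μ]

theorem memLp_two_eval (h2 : Integrable (fun x => ‖x‖ ^ 2) μ) (i : Fin n) :
    MemLp (fun x : EuclideanSpace ℝ (Fin n) => x i) 2 μ := by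
  have h : MemLp (fun x : EuclideanSpace ℝ (Fin n) => x) 2 μ :=
    (memLp_two_iff_integrable_sq_norm (by fun_prop)).2 h2
  exact h.of_le (by fun_prop) (ae_of_all _ fun x => PiLp.norm_apply_le x i)

theorem lipschitzWith_eval (i : Fin n) :
    LipschitzWith 1 (fun x : EuclideanSpace ℝ (Fin n) => x i) :=
  LipschitzWith.of_dist_le_mul fun x y => by
    simpa [dist_eq_norm] using PiLp.norm_apply_le (x - y) i

theorem isSobolevWithGradient_eval (h2 : Integrable (fun x => ‖x‖ ^ 2) μ) (i : Fin n) :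
    IsSobolevWithGradient univ μ (fun x => x i) (gradient fun x => x i) :=
  (lipschitzWith_eval i).isSobolevWithGradient_univ (memLp_two_eval h2 i)

theorem integral_norm_sq_eq_sum (h2 : Integrable (fun x => ‖x‖ ^ 2) μ) :
    ∫ x, ‖x‖ ^ 2 ∂μ = ∑ i, ∫ x, x i ^ 2 ∂μ := by
  rw [← integral_finsetSum _ fun i _ => (memLp_two_eval h2 i).integrable_sq]
  simp_rw [EuclideanSpace.norm_sq_eq, Real.norm_eq_abs, sq_abs]

/-- Each coordinate is centred with gradient of norm at most one. Summing the `n` Poincaré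
inequalities avoids showing that the coordinates have equal second moments. -/
theorem spectralGap_mul_integral_norm_sq_le (h2 : Integrable (fun x => ‖x‖ ^ 2) μ)
    (h0 : ∀ i, ∫ x, x i ∂μ = 0) : spectralGap univ μ * ∫ x, ‖x‖ ^ 2 ∂μ ≤ n := by
  rw [integral_norm_sq_eq_sum h2, Finset.mul_sum]
  calc ∑ i, spectralGap univ μ * ∫ x, x i ^ 2 ∂μ ≤ ∑ _i : Fin n, (1 : ℝ) := by
        refine Finset.sum_le_sum fun i _ => ?_
        have h := (isSobolevWithGradient_eval h2 i).spectralGap_mul_variance_le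
        rw [h0 i, zero_pow two_ne_zero, sub_zero] at h
        refine h.trans ?_
        refine (integral_mono (isSobolevWithGradient_eval h2 i).memLp_gradient.norm.integrable_sq
          (integrable_const (1 : ℝ)) fun x => ?_).trans (by simp)
        have : ‖gradient (fun x : EuclideanSpace ℝ (Fin n) => x i) x‖ ≤ 1 :=
          (norm_gradient _ x).trans_le (norm_fderiv_le_of_lipschitz ℝ (lipschitzWith_eval i))
        exact pow_le_one₀ (norm_nonneg _) this
    _ = n := by simp

/-- A lower bound on a real infimum needs a competitor, since the infimum of the empty set is `0`.
Some coordinate has positive variance. -/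
theorem exists_isSobolevWithGradient_normalized (h2 : Integrable (fun x => ‖x‖ ^ 2) μ)
    (h0 : ∀ i, ∫ x, x i ∂μ = 0) (hpos : 0 < ∫ x, ‖x‖ ^ 2 ∂μ) :
    {e : ℝ | ∃ (f : EuclideanSpace ℝ (Fin n) → ℝ)
        (G : EuclideanSpace ℝ (Fin n) → EuclideanSpace ℝ (Fin n)),
        IsSobolevWithGradient univ μ f G ∧ ∫ x, f x ∂μ = 0 ∧ ∫ x, f x ^ 2 ∂μ = 1 ∧
        e = ∫ x, ‖G x‖ ^ 2 ∂μ}.Nonempty := by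
  rw [integral_norm_sq_eq_sum h2] at hpos
  obtain ⟨i, -, hi⟩ : ∃ i ∈ Finset.univ, 0 < ∫ x, x i ^ 2 ∂μ := by
    by_contra! hcon
    exact absurd hpos (not_lt.2 (Finset.sum_nonpos hcon))
  refine ⟨_, (isSobolevWithGradient_eval h2 i).div_variance_mem ?_⟩
  rwa [h0 i, zero_pow two_ne_zero, sub_zero]

end Coordinates

/-- The integrand against Lebesgue measure is odd. -/
theorem integral_eval_eq_zero_of_radial {n : ℕ} {μ : Measure (EuclideanSpace ℝ (Fin n))}
    {q : ℝ → ℝ} (hq : Measurable q) (hμ : HasDensityProportionalTo μ volume fun x => q ‖x‖)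
    (i : Fin n) : ∫ x, x i ∂μ = 0 := by
  obtain ⟨c, -, rfl⟩ := hμ
  have hm : Measurable fun x : EuclideanSpace ℝ (Fin n) => (c * q ‖x‖).toNNReal :=
    ((hq.comp measurable_norm).const_mul c).real_toNNReal
  have e := integral_withDensity_eq_integral_smul (μ := volume) hm
    (fun x : EuclideanSpace ℝ (Fin n) => x i)
  have h := integral_neg_eq_self (μ := volume)
    (fun x : EuclideanSpace ℝ (Fin n) => (c * q ‖x‖).toNNReal • x i)
  have h2 : ∀ x : EuclideanSpace ℝ (Fin n), (c * q ‖-x‖).toNNReal • (-x) i =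
      -((c * q ‖x‖).toNNReal • x i) := fun x => by simp
  simp_rw [h2] at h
  rw [integral_neg] at h
  refine e.trans ?_
  linarith

/-! ### Radial test functions, by clamping -/

section Clamp

theorem lipschitzWith_clamp (a b : ℝ) : LipschitzWith 1 fun t : ℝ => max a (min b t) :=
  (LipschitzWith.id.const_min b).const_max a

theorem tendsto_clamp_natCast (t : ℝ) :
    Filter.Tendsto (fun R : ℕ => max (-(R : ℝ)) (min R t)) Filter.atTop (nhds t) := by
  obtain ⟨R₀, hR₀⟩ := exists_nat_ge |t|
  refine tendsto_const_nhds.congr' ?_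
  filter_upwards [Filter.eventually_ge_atTop R₀] with R hR
  have hR' : (R₀ : ℝ) ≤ R := by exact_mod_cast hR
  have := abs_le.1 (hR₀.trans hR')
  rw [min_eq_right this.2, max_eq_right this.1]

theorem abs_clamp_le {R : ℝ} (hR : 0 ≤ R) (t : ℝ) : |max (-R) (min R t)| ≤ R :=
  abs_le.2 ⟨le_max_left _ _, max_le (by linarith) (min_le_left _ _)⟩

theorem abs_clamp_le_abs {R : ℝ} (hR : 0 ≤ R) (t : ℝ) : |max (-R) (min R t)| ≤ |t| := by
  have := (lipschitzWith_clamp (-R) R).dist_le_mul t 0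
  simpa [hR] using! this

theorem exists_lipschitzWith_comp_clamp {v : ℝ → ℝ} (hv : ContDiff ℝ 1 v) {a b : ℝ} (hab : a ≤ b) :
    ∃ C, LipschitzWith C fun t => v (max a (min b t)) := by
  obtain ⟨C, hC⟩ := hv.contDiffOn.exists_lipschitzOnWith (s := Icc a b) one_ne_zero
    (convex_Icc a b) isCompact_Icc
  refine ⟨C * 1, ?_⟩
  have h := hC.comp ((lipschitzWith_clamp a b).lipschitzOnWith (s := univ))
    fun t _ => ⟨le_max_left _ _, max_le hab (min_le_left _ _)⟩
  exact lipschitzOnWith_univ.1 h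

end Clamp

section RadialTest

variable {E : Type*} [NormedAddCommGroup E] [InnerProductSpace ℝ E]

/-- For `‖x‖` in the interval, both clamps and the norm are 1-Lipschitz, so the slope is at most
that of `v`; outside it the function is locally constant. Estimating increments handles points of
non-differentiability too. -/
theorem norm_fderiv_clamp_comp_norm_le {v : ℝ → ℝ} (hv : Differentiable ℝ v) {a b : ℝ}
    (R : ℝ) (x : E) :
    ‖fderiv ℝ (fun x : E => max (-R) (min R (v (max a (min b ‖x‖))))) x‖ ≤
      ‖(Icc a b).indicator (deriv v) ‖x‖‖ := by
  by_cases hx : ‖x‖ ∈ Icc a b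
  · rw [indicator_of_mem hx]
    refine le_of_forall_pos_le_add fun ε hε => ?_
    have hd := (hv ‖x‖).hasDerivAt.isLittleO.def hε
    have hc : Filter.Tendsto (fun y : E => max a (min b ‖y‖)) (nhds x) (nhds ‖x‖) := by
      have : Continuous fun y : E => max a (min b ‖y‖) := by fun_prop
      simpa [max_eq_right hx.1, min_eq_right hx.2] using this.tendsto x
    refine norm_fderiv_le_of_lip' ℝ (by positivity) ?_
    filter_upwards [hc.eventually hd] with y hy
    have h1 := (lipschitzWith_clamp (-R) R).dist_le_mul (v (max a (min b ‖y‖))) (v ‖x‖)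
    have h2 := (lipschitzWith_clamp a b).dist_le_mul ‖y‖ ‖x‖
    have h3 := abs_norm_sub_norm_le y x
    simp only [Real.dist_eq, NNReal.coe_one, one_mul, max_eq_right hx.1, min_eq_right hx.2] at h1 h2
    simp only [Real.norm_eq_abs, smul_eq_mul] at hy ⊢
    rw [min_eq_right hx.2, max_eq_right hx.1]
    refine h1.trans ?_
    set s := max a (min b ‖y‖) - ‖x‖
    have h4 : |v (max a (min b ‖y‖)) - v ‖x‖| ≤ |s * deriv v ‖x‖| + ε * |s| := by
      have := abs_add_le (v (max a (min b ‖y‖)) - v ‖x‖ - s * deriv v ‖x‖) (s * deriv v ‖x‖)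
      rw [sub_add_cancel] at this
      linarith
    rw [abs_mul] at h4
    have h5 : |s| ≤ ‖y - x‖ := h2.trans h3
    nlinarith [abs_nonneg (deriv v ‖x‖), mul_le_mul_of_nonneg_right h5
      (add_nonneg (abs_nonneg (deriv v ‖x‖)) hε.le)]
  · rw [indicator_of_notMem hx, norm_zero]
    refine norm_fderiv_le_of_lip' ℝ le_rfl ?_
    have hcl : ∀ᶠ y in nhds x, max a (min b ‖y‖) = max a (min b ‖x‖) := by
      rcases not_and_or.1 hx with h | h
      · filter_upwards [continuous_norm.continuousAt.eventually_lt_const (not_le.1 h)] with y hy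
        rw [max_eq_left ((min_le_right _ _).trans hy.le),
          max_eq_left ((min_le_right _ _).trans (not_le.1 h).le)]
      · filter_upwards [continuous_norm.continuousAt.eventually_const_lt (not_le.1 h)] with y hy
        rw [min_eq_left hy.le, min_eq_left (not_le.1 h).le]
    filter_upwards [hcl] with y hy
    simp [hy]

variable [FiniteDimensional ℝ E] [MeasureSpace E] [BorelSpace E]

theorem measurePreserving_norm_of_measurePreserving_smul [Nontrivial E]
    [(volume : Measure E).IsAddHaarMeasure] {μ : Measure E} {ν : Measure ℝ} [SFinite ν]
    (hmp : MeasurePreserving (fun p : E × ℝ => p.2 • p.1) ((uniformOnSphere E).prod ν) μ)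
    (hν : ∀ᵐ r ∂ν, 0 < r) : MeasurePreserving (fun x : E => ‖x‖) μ ν := by
  refine ⟨measurable_norm, ?_⟩
  rw [← hmp.map_eq, Measure.map_map measurable_norm hmp.measurable]
  have h : (fun x : E => ‖x‖) ∘ (fun p : E × ℝ => p.2 • p.1)
      =ᵐ[(uniformOnSphere E).prod ν] Prod.snd := by
    filter_upwards [ae_prod_norm_eq_one_and_pos hν] with p hp
    simp [norm_smul, hp.1, abs_of_pos hp.2]
  rw [Measure.map_congr h]
  exact measurePreserving_snd.map_eq

theorem spectralGap_mul_variance_clamp_le [(volume : Measure E).IsAddHaarMeasure]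
    {μ : Measure E} [IsProbabilityMeasure μ] {ν : Measure ℝ}
    (hmp : MeasurePreserving (fun x : E => ‖x‖) μ ν) {v : ℝ → ℝ} (hv : ContDiff ℝ 1 v) {a b R : ℝ}
    (hab : a ≤ b) (hR : 0 ≤ R) :
    spectralGap univ μ * (∫ r, max (-R) (min R (v (max a (min b r)))) ^ 2 ∂ν -
      (∫ r, max (-R) (min R (v (max a (min b r)))) ∂ν) ^ 2) ≤
      ∫ r, ‖(Icc a b).indicator (deriv v) r‖ ^ 2 ∂ν := by
  obtain ⟨C, hC⟩ := exists_lipschitzWith_comp_clamp hv hab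
  have hL := ((lipschitzWith_clamp (-R) R).comp hC).comp (lipschitzWith_one_norm (E := E))
  have hm : MemLp (fun x : E => max (-R) (min R (v (max a (min b ‖x‖))))) 2 μ :=
    MemLp.of_bound hL.continuous.aestronglyMeasurable R (ae_of_all _ fun x => abs_clamp_le hR _)
  have hS := (hL.isSobolevWithGradient_univ hm)
  have key := hS.spectralGap_mul_variance_le
  have hint : ∀ h : ℝ → ℝ, Measurable h → ∫ x, h ‖x‖ ∂μ = ∫ r, h r ∂ν := fun h hh => by
    rw [← hmp.map_eq, integral_map hmp.measurable.aemeasurable hh.aestronglyMeasurable]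
  have hc : Continuous fun r => max (-R) (min R (v (max a (min b r)))) :=
    ((lipschitzWith_clamp (-R) R).comp hC).continuous
  have hdc : Continuous (deriv v) := hv.continuous_deriv le_rfl
  have hi : Measurable ((Icc a b).indicator (deriv v)) :=
    hdc.measurable.indicator measurableSet_Icc
  rw [← hint _ (hc.measurable.pow_const 2), ← hint _ hc.measurable,
    ← hint _ (hi.norm.pow_const 2)]
  refine key.trans ?_
  obtain ⟨B, hB⟩ := (isCompact_Icc (a := a) (b := b)).exists_bound_of_continuousOn hdc.continuousOn
  refine integral_mono hS.memLp_gradient.norm.integrable_sq ?_ fun x => ?_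
  · refine Integrable.of_bound (C := B ^ 2)
      ((hi.comp measurable_norm).norm.pow_const 2).aestronglyMeasurable (ae_of_all _ fun x => ?_)
    by_cases hx : ‖x‖ ∈ Icc a b
    · simp only [indicator_of_mem hx, norm_pow, norm_norm]
      exact pow_le_pow_left₀ (norm_nonneg _) (hB _ hx) 2
    · simp only [indicator_of_notMem hx]
      simp only [norm_zero, ne_eq, OfNat.ofNat_ne_zero, not_false_eq_true, zero_pow]
      positivity
  · simp only
    rw [norm_gradient]
    exact pow_le_pow_left₀ (norm_nonneg _)
      (norm_fderiv_clamp_comp_norm_le (hv.differentiable one_ne_zero) R x) 2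

end RadialTest

/-- Rather than show that `f(‖x‖)` has a weak gradient across the origin, approximate `f` by smooth
functions on `[a j, b j]`, freeze them outside so that no energy is created there, and clamp the
values to `[-R, R]`. These are Lipschitz test functions. Let `j → ∞`, then `R → ∞`. -/
theorem IsSobolevWithGradient.spectralGap_mul_variance_le_of_radial {E : Type*}
    [NormedAddCommGroup E] [InnerProductSpace ℝ E] [FiniteDimensional ℝ E] [MeasureSpace E]
    [BorelSpace E] [(volume : Measure E).IsAddHaarMeasure]
    {μ : Measure E} [IsProbabilityMeasure μ] {ν : Measure ℝ} [IsProbabilityMeasure ν]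
    (hmp : MeasurePreserving (fun x : E => ‖x‖) μ ν) (hνc : LocallyComparableOn (Ioi 0) ν)
    (hν : ∀ᵐ r ∂ν, 0 < r) {f g : ℝ → ℝ} (h : IsSobolevWithGradient (Ioi 0) ν f g) :
    spectralGap univ μ * (∫ r, f r ^ 2 ∂ν - (∫ r, f r ∂ν) ^ 2) ≤ ∫ r, ‖g r‖ ^ 2 ∂ν := by
  let a : ℕ → ℝ := fun j => ((j : ℝ) + 1)⁻¹
  let b : ℕ → ℝ := fun j => (j : ℝ) + 1
  let K : ℕ → Set ℝ := fun j => Icc (a j) (b j)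
  have hab : ∀ j, a j ≤ b j := fun j => by
    have h1 : (1 : ℝ) ≤ j + 1 := by simp
    exact (inv_le_one_of_one_le₀ h1).trans h1
  have hKm : ∀ j, MeasurableSet (K j) := fun j => measurableSet_Icc
  have hK0 : ∀ j, K j ⊆ Ioi 0 := fun j r hr => (by positivity : (0 : ℝ) < a j).trans_le hr.1
  have hmono : Monotone K := fun i j hij => Icc_subset_Icc (by simp only [a]; gcongr)
    (by simp only [b]; gcongr)
  have hae : ∀ᵐ r ∂ν, ∃ j, r ∈ K j := by
    filter_upwards [hν] with r hr
    obtain ⟨j, hj⟩ := exists_mem_normShell_of_ne_zero hr.ne'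
    refine ⟨j, ?_⟩
    simpa [normShell, abs_of_pos hr] using! hj
  have happ := fun j : ℕ => h.exists_contDiff_eLpNorm_sub_le isOpen_Ioi subset_rfl hνc
    isCompact_Icc (hK0 j) (ε := (2⁻¹ : ENNReal) ^ j) (by simp [ENNReal.pow_pos])
  choose v hvc hv1 hv2 using happ
  have hvc1 : ∀ j, ContDiff ℝ 1 (v j) := fun j => (hvc j).of_le (by exact_mod_cast le_top)
  have hdc : ∀ j, Continuous (deriv (v j)) := fun j => (hvc1 j).continuous_deriv le_rfl
  have hv2' : ∀ j, eLpNorm (deriv (v j) - g) 2 (ν.restrict (K j)) ≤ 2⁻¹ ^ j := fun j => by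
    refine le_trans (le_of_eq ?_) (hv2 j)
    simp_rw [gradient_eq_deriv']
    rfl
  have tg := tendsto_eLpNorm_indicator_sub hKm hmono hae
    (fun j => (hdc j).aestronglyMeasurable) h.memLp_gradient
    (tendsto_of_tendsto_of_tendsto_of_le_of_le tendsto_const_nhds tendsto_inv_two_pow_ennreal
      (fun _ => zero_le) hv2')
  have mg : ∀ j, MemLp ((K j).indicator (deriv (v j))) 2 ν := fun j => by
    obtain ⟨B, hB⟩ := (isCompact_Icc (a := a j) (b := b j)).exists_bound_of_continuousOn
      (hdc j).continuousOn
    rw [memLp_indicator_iff_restrict (hKm j)]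
    exact MemLp.of_bound (hdc j).aestronglyMeasurable B
      ((ae_restrict_iff' (hKm j)).2 (ae_of_all _ hB))
  have lg := tendsto_integral_norm_sq_of_tendsto_eLpNorm mg h.memLp_gradient tg
  have mT : ∀ R : ℕ, MemLp (fun r => max (-(R : ℝ)) (min R (f r))) 2 ν := fun R =>
    h.memLp.of_le ((lipschitzWith_clamp _ _).continuous.comp_aestronglyMeasurable h.memLp.1)
      (ae_of_all _ fun r => abs_clamp_le_abs R.cast_nonneg _)
  have step : ∀ R : ℕ, spectralGap univ μ * (∫ r, max (-(R : ℝ)) (min R (f r)) ^ 2 ∂ν -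
      (∫ r, max (-(R : ℝ)) (min R (f r)) ∂ν) ^ 2) ≤ ∫ r, ‖g r‖ ^ 2 ∂ν := by
    intro R
    let p : ℕ → ℝ → ℝ := fun j r => max (-(R : ℝ)) (min R (v j (max (a j) (min (b j) r))))
    have hpc : ∀ j, Continuous (p j) := fun j =>
      (lipschitzWith_clamp _ _).continuous.comp
        ((hvc j).continuous.comp (lipschitzWith_clamp _ _).continuous)
    have hpR : ∀ j r, |p j r| ≤ R := fun j r => abs_clamp_le R.cast_nonneg _
    have mp : ∀ j, MemLp (p j) 2 ν := fun j =>
      MemLp.of_bound (hpc j).aestronglyMeasurable R (ae_of_all _ (hpR j))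
    have hp1 : ∀ j, eLpNorm (p j - fun r => max (-(R : ℝ)) (min R (f r))) 2 (ν.restrict (K j)) ≤
        2⁻¹ ^ j := fun j => by
      refine (eLpNorm_mono_ae ?_).trans (hv1 j)
      filter_upwards [ae_restrict_mem (hKm j)] with r hr
      have := (lipschitzWith_clamp (-(R : ℝ)) R).dist_le_mul (v j r) (f r)
      simp only [Real.dist_eq, NNReal.coe_one, one_mul] at this
      simp only [Pi.sub_apply, p, Real.norm_eq_abs]
      rwa [min_eq_right hr.2, max_eq_right hr.1]
    have t1 := tendsto_eLpNorm_indicator_sub hKm hmono hae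
      (fun j => (hpc j).aestronglyMeasurable) (mT R)
      (tendsto_of_tendsto_of_tendsto_of_le_of_le tendsto_const_nhds tendsto_inv_two_pow_ennreal
        (fun _ => zero_le) hp1)
    -- Applied to the constant `R`: its `L²` norm outside `K j` tends to zero, and it dominates the
    -- frozen part of `p j`.
    have t2 := tendsto_eLpNorm_indicator_sub (μ := ν) hKm hmono hae
      (u := fun _ _ => (R : ℝ)) (w := fun _ => (R : ℝ)) (fun j => aestronglyMeasurable_const)
      (memLp_const _) (by simp)
    have tp : Filter.Tendsto (fun j => eLpNorm (p j - fun r => max (-(R : ℝ)) (min R (f r))) 2 ν)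
        Filter.atTop (nhds 0) := by
      refine tendsto_of_tendsto_of_tendsto_of_le_of_le tendsto_const_nhds
        (by simpa using! t1.add t2) (fun _ => zero_le) fun j => ?_
      have e : p j - (fun r => max (-(R : ℝ)) (min R (f r))) =
          ((K j).indicator (p j) - fun r => max (-(R : ℝ)) (min R (f r))) +
            (K j)ᶜ.indicator (p j) := by
        rw [sub_add_eq_add_sub, indicator_self_add_compl]
      rw [e]
      refine (eLpNorm_add_le (((mp j).1.indicator (hKm j)).sub (mT R).1)
        ((mp j).1.indicator (hKm j).compl) (by norm_num)).trans ?_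
      refine add_le_add le_rfl (eLpNorm_mono fun r => ?_)
      by_cases hr : r ∈ K j
      · simp [hr]
      · simpa [hr] using hpR j r
    have l1 := tendsto_integral_norm_sq_of_tendsto_eLpNorm mp (mT R) tp
    have l2 := tendsto_integral_of_tendsto_eLpNorm_two mp (mT R) tp
    simp only [Real.norm_eq_abs, sq_abs] at l1
    exact le_of_tendsto_of_tendsto' ((l1.sub (l2.pow 2)).const_mul _) lg fun j =>
      spectralGap_mul_variance_clamp_le hmp (hvc1 j) (hab j) R.cast_nonneg
  have l1 : Filter.Tendsto (fun R : ℕ => ∫ r, max (-(R : ℝ)) (min R (f r)) ^ 2 ∂ν) Filter.atTop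
      (nhds (∫ r, f r ^ 2 ∂ν)) := by
    refine tendsto_integral_of_dominated_convergence (fun r => f r ^ 2)
      (fun R => (mT R).1.pow 2) h.memLp.integrable_sq (fun R => ae_of_all _ fun r => ?_)
      (ae_of_all _ fun r => (tendsto_clamp_natCast (f r)).pow 2)
    rw [Real.norm_eq_abs, abs_pow, ← sq_abs (f r)]
    exact pow_le_pow_left₀ (abs_nonneg _) (abs_clamp_le_abs R.cast_nonneg _) 2
  have l2 : Filter.Tendsto (fun R : ℕ => ∫ r, max (-(R : ℝ)) (min R (f r)) ∂ν) Filter.atTop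
      (nhds (∫ r, f r ∂ν)) :=
    tendsto_integral_of_dominated_convergence (fun r => |f r|)
      (fun R => (mT R).1) (h.memLp.integrable (by norm_num)).abs
      (fun R => ae_of_all _ fun r => abs_clamp_le_abs R.cast_nonneg _)
      (ae_of_all _ fun r => tendsto_clamp_natCast (f r))
  exact le_of_tendsto' ((l1.sub (l2.pow 2)).const_mul _) step

/-- The radius itself is a competitor: its variance is positive because `ν` has no atoms. -/
theorem exists_isSobolevWithGradient_Ioi_normalized {ν : Measure ℝ} [IsProbabilityMeasure ν]
    (hac : ν ≪ volume) (h2 : Integrable (fun r : ℝ => r ^ 2) ν) :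
    {e : ℝ | ∃ (f : ℝ → ℝ) (G : ℝ → ℝ), IsSobolevWithGradient (Ioi 0) ν f G ∧ ∫ x, f x ∂ν = 0 ∧
      ∫ x, f x ^ 2 ∂ν = 1 ∧ e = ∫ x, ‖G x‖ ^ 2 ∂ν}.Nonempty := by
  have hm : MemLp (fun r : ℝ => r) 2 ν := (memLp_two_iff_integrable_sq (by fun_prop)).2 h2
  have hS := (LipschitzWith.id (α := ℝ)).isSobolevWithGradient_univ (μ := ν) hm
  refine ⟨_, IsSobolevWithGradient.div_variance_mem (Ω := Ioi 0) (f := fun r => r)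
    ⟨hS.1, hS.2.mono (subset_univ _), hS.3⟩ ?_⟩
  set c := ∫ r, r ∂ν with hc
  have hi : Integrable (fun r : ℝ => r) ν := hm.integrable (by norm_num)
  have h3 : Integrable (fun r : ℝ => (r - c) ^ 2) ν := (hm.sub (memLp_const c)).integrable_sq
  have e : ∫ r, r ^ 2 ∂ν - c ^ 2 = ∫ r, (r - c) ^ 2 ∂ν := by
    have i1 : Integrable (fun r : ℝ => 2 * r * c) ν := (hi.const_mul 2).mul_const c
    have i2 : Integrable (fun r : ℝ => r ^ 2 - 2 * r * c) ν := h2.sub i1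
    simp_rw [sub_sq]
    rw [integral_add i2 (integrable_const _), integral_sub h2 i1, integral_mul_const,
      integral_const_mul, ← hc]
    simp
    ring
  rw [e]
  refine lt_of_le_of_ne (by positivity) fun h0 => ?_
  have h4 := (integral_eq_zero_iff_of_nonneg (fun r => sq_nonneg _) h3).1 h0.symm
  have h5 : ∀ᵐ r ∂ν, r ≠ c := hac.ae_le
    (measure_eq_zero_iff_ae_notMem.1 (measure_singleton c))
  obtain ⟨r, hr, hr'⟩ := (h4.and h5).exists
  simp only [Pi.zero_apply, ne_eq, OfNat.ofNat_ne_zero, not_false_eq_true, pow_eq_zero_iff] at hr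
  exact hr' (sub_eq_zero.1 hr)

/-! ### The two-sided estimate -/

theorem lemma4 (n : ℕ) (hn : 2 ≤ n) (V : ℝ → ℝ) (hV : ContDiffOn ℝ ∞ V (Ioi 0))
    (μ : Measure (EuclideanSpace ℝ (Fin n))) [IsProbabilityMeasure μ]
    (hμ : HasDensityProportionalTo μ volume (fun x => Real.exp (-V ‖x‖)))
    (hμ₂ : Integrable (fun x => ‖x‖ ^ 2) μ)
    (ν : Measure ℝ) [IsProbabilityMeasure ν]
    (hν : HasDensityProportionalTo ν (volume.restrict (Ioi 0))
      (fun r => r ^ (n - 1) * Real.exp (-V r))) :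
    min (spectralGap (Ioi 0) ν) (((n : ℝ) - 1) / ∫ x, ‖x‖ ^ 2 ∂μ) ≤ spectralGap univ μ ∧
      spectralGap univ μ ≤ min (spectralGap (Ioi 0) ν) ((n : ℝ) / ∫ x, ‖x‖ ^ 2 ∂μ) := by
  have hnt : Nontrivial (Fin n) := Fin.nontrivial_iff_two_le.2 hn
  have hqc : ContinuousOn (fun r => Real.exp (-V r)) (Ioi 0) :=
    Real.continuous_exp.comp_continuousOn hV.continuousOn.neg
  have hnorm : MapsTo (fun x : EuclideanSpace ℝ (Fin n) => ‖x‖) {0}ᶜ (Ioi 0) := fun x hx =>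
    norm_pos_iff.2 hx
  have hμc : LocallyComparableOn {0}ᶜ μ := by
    obtain ⟨c, hc, rfl⟩ := hμ
    exact LocallyComparableOn.of_withDensity
      (continuousOn_const.mul (hqc.comp continuous_norm.continuousOn hnorm))
      (fun x _ => mul_pos hc (Real.exp_pos _)) rfl
  have hνc : LocallyComparableOn (Ioi 0) ν := by
    obtain ⟨c, hc, rfl⟩ := hν
    refine LocallyComparableOn.of_withDensity
      (continuousOn_const.mul ((continuousOn_id.pow (n - 1)).mul hqc))
      (fun x (hx : 0 < x) => mul_pos hc (mul_pos (pow_pos hx _) (Real.exp_pos _))) ?_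
    rw [restrict_withDensity measurableSet_Ioi, restrict_withDensity measurableSet_Ioi,
      Measure.restrict_restrict measurableSet_Ioi, inter_self]
    rfl
  have hac : ν ≪ volume := by
    obtain ⟨c, hc, rfl⟩ := hν
    exact (withDensity_absolutelyContinuous _ _).trans Measure.absolutelyContinuous_restrict
  have hν0 : ∀ᵐ r ∂ν, 0 < r := hν.ae_pos
  -- Nothing is assumed on `V` off the positive half-line, not even measurability. Setting the
  -- profile to zero there changes the densities only on null sets.
  let q : ℝ → ℝ := (Ioi 0).piecewise (fun r => Real.exp (-V r)) 0
  have hq : Measurable q := hqc.measurable_piecewise continuousOn_const measurableSet_Ioi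
  have hqe : ∀ r, 0 < r → q r = Real.exp (-V r) := fun r hr =>
    piecewise_eq_of_mem _ _ _ (mem_Ioi.2 hr)
  have hμq : HasDensityProportionalTo μ volume fun x => q ‖x‖ := by
    obtain ⟨c, hc, rfl⟩ := hμ
    refine ⟨c, hc, withDensity_congr_ae ?_⟩
    have h0 : ∀ᵐ x : EuclideanSpace ℝ (Fin n), x ≠ 0 := by simp [ae_iff]
    filter_upwards [h0] with x hx
    rw [hqe _ (norm_pos_iff.2 hx)]
  have hνq : HasDensityProportionalTo ν (volume.restrict (Ioi 0))
      fun r => r ^ (Module.finrank ℝ (EuclideanSpace ℝ (Fin n)) - 1) * q r := by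
    obtain ⟨c, hc, rfl⟩ := hν
    refine ⟨c, hc, withDensity_congr_ae ?_⟩
    filter_upwards [ae_restrict_mem measurableSet_Ioi] with r hr
    rw [hqe _ hr, finrank_euclideanSpace_fin]
  have hmp : MeasurePreserving (fun p : EuclideanSpace ℝ (Fin n) × ℝ => p.2 • p.1)
      ((uniformOnSphere _).prod ν) μ :=
    ⟨by fun_prop, map_smul_uniformOnSphere_prod hq hμq hνq⟩
  have hmn := measurePreserving_norm_of_measurePreserving_smul hmp hν0
  have h2 : Integrable (fun r : ℝ => r ^ 2) ν := by
    rw [← hmn.map_eq, integrable_map_measure (by fun_prop) (by fun_prop)]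
    exact hμ₂
  have hM : ∫ x, ‖x‖ ^ 2 ∂μ = ∫ r, r ^ 2 ∂ν := by
    rw [← hmn.map_eq, integral_map (by fun_prop) (by fun_prop)]
  have h0 := integral_eval_eq_zero_of_radial hq hμq
  have hMpos : 0 < ∫ x, ‖x‖ ^ 2 ∂μ := by
    refine lt_of_le_of_ne (by positivity) fun hz => ?_
    have h4 := (integral_eq_zero_iff_of_nonneg (fun x => by positivity) hμ₂).1 hz.symm
    obtain ⟨x, hx, hx'⟩ := (h4.and (ae_ne_zero_of_measurePreserving_smul hmp hν0)).exists
    simp at hx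
    exact hx' hx
  refine ⟨?_, le_min ?_ ?_⟩
  · refine le_csInf (exists_isSobolevWithGradient_normalized hμ₂ h0 hMpos) ?_
    rintro _ ⟨f, G, h, hf0, hf1, rfl⟩
    rw [hM]
    exact min_spectralGap_le_integral_norm_sq hn hμc hνc hmp hν0 h2 h hf0 hf1
  · refine le_csInf (exists_isSobolevWithGradient_Ioi_normalized hac h2) ?_
    rintro _ ⟨f, g, h, hf0, hf1, rfl⟩
    have := h.spectralGap_mul_variance_le_of_radial hmn hνc hν0
    rwa [hf0, hf1, zero_pow two_ne_zero, sub_zero, mul_one] at this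
  · rw [le_div_iff₀ hMpos]
    exact spectralGap_mul_integral_norm_sq_le hμ₂ h0
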